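/- \textbf{Definitions.} Groups are discrete. A \emph{pointed dynamical system} $(G,X,0)$ is a group $G$ acting by continuous maps on a compact metric space $(X,d)$, with a point $0\in X$ fixed by $G$. It is \emph{expansive} if there is $0<\Delta\le 1$ such that $d(gx,gy)\le\Delta$ for all $g\in G$ implies $x=y$. A point $x$ is \emph{homoclinic} if for every $\epsilon>0$ we have $d(gx,0)<\epsilon$ for all but finitely many $g\in G$. The system has the \emph{shadowing property} if for every $\epsilon>0$ there are $\delta>0$ and a finite $S\subseteq G$ such that for each $x:G\to X$ with $d(s\cdot x(g),x(sg))<\delta$ for all $g\in G$, $s\in S$, there is $y\in X$ with $d(x(g),gy)<\epsilon$ for all $g\in G$. An \emph{endomorphism} is a continuous $G$-equivariant map $f:X\to X$ with $f(0)=0$. A self-map $f$ of a space with special point $0$ is \emph{asymptotically nilpotent} if $f^n(x)\to 0$ for all $x$, and \emph{nilpotent} on a set $Y$ if there is $n$ with $f^n(x)=0$ for all $x\in Y$ (\emph{nilpotent} if this holds for the whole space). For $E,A\subseteq G$ let $\partial_EA=\{g\in A: Eg\not\subseteq A\}$. A \emph{$(\delta,E)$-designation} in $(G,X,0)$ is a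 family $(A_i,x_i)_{i\in I}$ with $x_i\in X$, $(A_i)_{i \in I}$ a partition of $G$, and $d(gx_i,0)<\delta$ for all $i\in I$ and $g\in\partial_EA_i$; an \emph{$\epsilon$-realization} of it is a point $y$ with $d(gy,gx_i)<\epsilon$ for all $i\in I$, $g\in A_i$. A \emph{tiered dynamical system} $\mathcal X$ consists of a compact metric space $X$ with a point $0$, a directed set $\mathcal T$ with least element $t_0$, for each $t\in\mathcal T$ an expansive pointed dynamical system $(G_t,X_t,0)$ with $0\in X_t\subseteq X$ (with the metric of $X$), such that $X_t\subseteq X_{t'}$ for $t\le t'$, and finite-to-one surjective homomorphisms $\phi^{t'}_t:G_{t'}\to G_t$ for $t\le t'$, with $\phi^t_t=\mathrm{id}$, $\phi^{t'}_t\circ\phi^{t''}_{t'}=\phi^{t''}_t$ for $t \le t' \le t''$, and $\phi^{t'}_t(g)\cdot x=g\cdot x$ for $x\in X_t$, $g\in G_{t'}$. Its \emph{base group} is $G_{t_0}$. An \emph{evolution map} is a continuous $f:X\to X$ such that for all $t\le t'$ and $x\in X_t$ with $f(x)\in X_{t'}$ we have $f(\phi^{t'}_t(g)\cdot x)=g\cdot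 f(x)$ for all $g\in G_{t'}$. The pair $(\mathcal X,f)$ belongs to the class $\mathfrak C_3$ if (i) for each $t$ there is $s\ge t$ with $f^k(X_t)\subseteq X_s$ for all $k\in\mathbb N$; (ii) for each $t$ there is $w\ge t$ such that for all $\epsilon>0$ there are $\delta>0$ and a finite $E\subseteq G_w$ such that every $(\delta,E)$-designation in $(G_w,X_w,0)$ with all points $x_i\in X_t$ has an $\epsilon$-realization in $X_w$; (iii) for all $t$, $x\in X_t$, $\epsilon>0$ there are $t'\ge t$ and $y\in X_{t'}$ homoclinic in $(G_{t'},X_{t'},0)$ with $d(x,y)<\epsilon$; (iv) every $G_t$ is residually finite. A group $G$ is \emph{nil-rigid on $\mathfrak C_3$} if for every tiered dynamical system $\mathcal X$ with base group $G$ and every asymptotically nilpotent evolution map $f$ with $(\mathcal X,f)\in\mathfrak C_3$, the map $f$ is nilpotent on each tier $X_t$. For a finite discrete alphabet $\Sigma$, $G$ acts on $\Sigma^G$ (with the product topology) by $(g\cdot x)_h=x_{g^{-1}h}$. A \emph{subshift} is a closed invariant subset $X\subseteq\Sigma^G$; it is \emph{of finite type} (SFT) if there is a clopen $C\subseteq\Sigma^G$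 with $x\in X\iff g\cdot x\in C$ for all $g\in G$. A \emph{cellular automaton} on $X$ is a continuous map $f:X\to X$ commuting with the action. The \emph{support} of $x$ relative to a symbol $0\in\Sigma$ is $\{g: x_g\ne 0\}$. \textbf{Theorem.} Let $G$ be a residually finite group. \begin{enumerate} \item If $G$ is solvable, then $G$ is nil-rigid on $\mathfrak C_3$. \item Suppose that $G$ is virtually solvable (it has a solvable subgroup of finite index). \begin{enumerate} \item If $(G,X,0)$ is an expansive pointed dynamical system with the shadowing property whose homoclinic points are dense in $X$, then every asymptotically nilpotent endomorphism of $(G,X,0)$ is nilpotent. \item If $\Sigma$ is a finite alphabet, $0\in\Sigma$, and $X\subseteq\Sigma^G$ is an SFT that contains $0^G$ and in which the points with finite support are dense, then every cellular automaton on $X$ that is asymptotically nilpotent (towards $0^G$) is nilpotent. \item In particular, for every finite alphabet $\Sigma\ni 0$, every asymptotically nilpotent cellular automaton on the full shift $\Sigma^G$ is nilpotent. \end{enumerate} \end{enumerate} -/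

import Mathlib

open Filter Topology

universe a b c u v w

/-! ### Pointed dynamical systems -/

/-- `(G, X, o)` is a pointed dynamical system: the discrete group `G` acts by continuous maps on
the compact metric space `X` and fixes the special point `o`. -/
structure IsPointedSystem (G : Type u) (X : Type v) [Group G] [MetricSpace X] [MulAction G X]
    (o : X) : Prop where
  compact : CompactSpace X
  continuous_smul : ∀ g : G, Continuous fun x : X => g • x
  smul_zero : ∀ g : G, g • o = o

/-- The action has an expansivity constant `0 < Δ ≤ 1`. -/
def IsExpansive (G : Type u) (X : Type v) [Group G] [MetricSpace X] [MulAction G X] : Prop :=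
  ∃ Δ : ℝ, 0 < Δ ∧ Δ ≤ 1 ∧ ∀ x y : X, (∀ g : G, dist (g • x) (g • y) ≤ Δ) → x = y

/-- `x` is asymptotic to the special point `o` under the action of `G`. -/
def IsHomoclinic (G : Type u) {X : Type v} [Group G] [MetricSpace X] [MulAction G X]
    (o x : X) : Prop :=
  ∀ ε : ℝ, 0 < ε → ∃ E : Finset G, ∀ g : G, g ∉ E → dist (g • x) o < ε

/-- The shadowing (pseudo-orbit tracing) property. Pseudo-orbits are controlled along a finite set
`S` of group elements; when `G` is finitely generated this is the same, by uniform continuity, as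
fixing for `S` one finite generating set. -/
def HasShadowing (G : Type u) (X : Type v) [Group G] [MetricSpace X] [MulAction G X] : Prop :=
  ∀ ε : ℝ, 0 < ε → ∃ δ : ℝ, 0 < δ ∧ ∃ S : Finset G, ∀ x : G → X,
    (∀ g : G, ∀ s ∈ S, dist (s • x g) (x (s * g)) < δ) →
      ∃ y : X, ∀ g : G, dist (x g) (g • y) < ε

/-- Endomorphisms of the pointed dynamical system `(G, X, o)`. -/
structure IsEndomorphism (G : Type u) {X : Type v} [Group G] [MetricSpace X] [MulAction G X]
    (o : X) (f : X → X) : Prop where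
  continuous : Continuous f
  map_zero : f o = o
  map_smul : ∀ (g : G) (x : X), f (g • x) = g • f x

/-- `f ^ n (x)` converges to `o` for every point `x`. -/
def IsAsymptoticallyNilpotent {X : Type v} [TopologicalSpace X] (o : X) (f : X → X) : Prop :=
  ∀ x : X, Tendsto (fun n : ℕ => f^[n] x) atTop (𝓝 o)

/-- Some iterate of `f` sends all of `Y` to `o`. -/
def IsNilpotentOn {X : Type v} (o : X) (f : X → X) (Y : Set X) : Prop :=
  ∃ n : ℕ, ∀ x ∈ Y, f^[n] x = o

/-! ### Designations -/

/-- The `E`-border `{g ∈ A | E g ⊄ A}` of `A`. -/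
def border {G : Type u} [Group G] (E A : Set G) : Set G :=
  {g | g ∈ A ∧ ∃ e ∈ E, e * g ∉ A}

/-- `(A i, x i)` is a `(δ, E)`-designation: the `A i` partition `G`, and `g • x i` is `δ`-close to
the special point for `g` in the `E`-border of `A i`. -/
structure IsDesignation {G : Type u} {X : Type v} [Group G] [MetricSpace X] [MulAction G X]
    (o : X) (δ : ℝ) (E : Set G) {I : Type w} (A : I → Set G) (x : I → X) : Prop where
  disjoint : ∀ i j : I, i ≠ j → Disjoint (A i) (A j)
  cover : ∀ g : G, ∃ i : I, g ∈ A i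
  near : ∀ i : I, ∀ g ∈ border E (A i), dist (g • x i) o < δ

/-- `y` is an `ε`-realization of `(A i, x i)`. -/
def IsRealization {G : Type u} {X : Type v} [Group G] [MetricSpace X] [MulAction G X]
    (ε : ℝ) {I : Type w} (A : I → Set G) (x : I → X) (y : X) : Prop :=
  ∀ i : I, ∀ g ∈ A i, dist (g • y) (g • x i) < ε

/-! ### Tiered dynamical systems -/

/-- Tiered dynamical systems. The set `tier t` carries the metric of the ambient space `Space`. -/
structure TDS where
  /-- the ambient space -/
  Space : Type a
  [metricSpace : MetricSpace Space]
  [compactSpace : CompactSpace Space]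
  /-- the special point -/
  zero : Space
  /-- the directed set of tiers, with least element `⊥` -/
  Index : Type b
  [preorder : Preorder Index]
  [orderBot : OrderBot Index]
  [directed : IsDirectedOrder Index]
  /-- the acting groups -/
  Grp : Index → Type c
  [group : ∀ t, Group (Grp t)]
  /-- the tiers -/
  tier : Index → Set Space
  [action : ∀ t, MulAction (Grp t) (tier t)]
  zero_mem : ∀ t, zero ∈ tier t
  isPointedSystem : ∀ t, IsPointedSystem (Grp t) (tier t) ⟨zero, zero_mem t⟩
  isExpansive : ∀ t, IsExpansive (Grp t) (tier t)
  tier_mono : ∀ {t t' : Index}, t ≤ t' → tier t ⊆ tier t'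
  /-- the connecting homomorphisms -/
  φ : ∀ {t t' : Index}, t ≤ t' → (Grp t' →* Grp t)
  φ_surjective : ∀ {t t' : Index} (h : t ≤ t'), Function.Surjective (φ h)
  φ_finite : ∀ {t t' : Index} (h : t ≤ t') (g : Grp t), {g' : Grp t' | φ h g' = g}.Finite
  φ_refl : ∀ t : Index, φ (le_refl t) = MonoidHom.id (Grp t)
  φ_trans : ∀ {t t' t'' : Index} (h : t ≤ t') (h' : t' ≤ t''),
    (φ h).comp (φ h') = φ (h.trans h')
  φ_smul : ∀ {t t' : Index} (h : t ≤ t') (x : tier t) (g : Grp t'),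
    ((φ h g • x : tier t) : Space) = (g • (⟨x, tier_mono h x.2⟩ : tier t') : tier t')

namespace TDS

attribute [instance] metricSpace compactSpace preorder orderBot directed group action

/-- The special point as a point of the tier `t`. -/
def zeroAt (𝒳 : TDS.{a, b, c}) (t : 𝒳.Index) : 𝒳.tier t := ⟨𝒳.zero, 𝒳.zero_mem t⟩

/-- A point of the tier `t` as a point of a higher tier. -/
def lift (𝒳 : TDS.{a, b, c}) {t t' : 𝒳.Index} (h : t ≤ t') (x : 𝒳.tier t) : 𝒳.tier t' :=
  ⟨x, 𝒳.tier_mono h x.2⟩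

/-- Evolution maps of a tiered system. -/
structure IsEvolution (𝒳 : TDS.{a, b, c}) (f : 𝒳.Space → 𝒳.Space) : Prop where
  continuous : Continuous f
  map_smul : ∀ {t t' : 𝒳.Index} (h : t ≤ t') (x : 𝒳.tier t) (hx : f x ∈ 𝒳.tier t')
    (g : 𝒳.Grp t'), f (𝒳.φ h g • x : 𝒳.tier t) = (g • (⟨f x, hx⟩ : 𝒳.tier t') : 𝒳.tier t')

/-- Every tier is `f`-stabilizing. -/
def IsStabilizing (𝒳 : TDS.{a, b, c}) (f : 𝒳.Space → 𝒳.Space) : Prop :=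
  ∀ t : 𝒳.Index, ∃ s : 𝒳.Index, t ≤ s ∧ ∀ k : ℕ, ∀ x ∈ 𝒳.tier t, f^[k] x ∈ 𝒳.tier s

/-- Every tier is weakly `0`-gluing. The index types `I` range over the universe of the acting
groups, which is no restriction since at most `|G|` members of a partition of a group `G` are
nonempty. -/
def IsWeaklyGluing (𝒳 : TDS.{a, b, c}) : Prop :=
  ∀ t : 𝒳.Index, ∃ (r : 𝒳.Index) (h : t ≤ r), ∀ ε : ℝ, 0 < ε →
    ∃ δ : ℝ, 0 < δ ∧ ∃ E : Finset (𝒳.Grp r),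
      ∀ (I : Type c) (A : I → Set (𝒳.Grp r)) (x : I → 𝒳.tier t),
        IsDesignation (𝒳.zeroAt r) δ (E : Set (𝒳.Grp r)) A (fun i => 𝒳.lift h (x i)) →
          ∃ y : 𝒳.tier r, IsRealization ε A (fun i => 𝒳.lift h (x i)) y

/-- Weakly dense homoclinic points. -/
def HasWeaklyDenseHomoclinic (𝒳 : TDS.{a, b, c}) : Prop :=
  ∀ (t : 𝒳.Index) (x : 𝒳.tier t) (ε : ℝ), 0 < ε → ∃ t' : 𝒳.Index, t ≤ t' ∧ ∃ y : 𝒳.tier t',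
    dist (x : 𝒳.Space) (y : 𝒳.Space) < ε ∧ IsHomoclinic (𝒳.Grp t') (𝒳.zeroAt t') y

end TDS

/-- Evolutions of tiered dynamical systems. -/
structure ETDS where
  /-- the tiered system -/
  sys : TDS.{a, b, c}
  /-- the evolution map -/
  map : sys.Space → sys.Space
  isEvolution : sys.IsEvolution map

/-- The class `ℭ₂`: stabilizing, weakly `0`-gluing, with weakly dense homoclinic points. -/
def classC2 : Set ETDS.{a, b, c} :=
  {𝒴 | 𝒴.sys.IsStabilizing 𝒴.map ∧ 𝒴.sys.IsWeaklyGluing ∧ 𝒴.sys.HasWeaklyDenseHomoclinic}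

/-- The class `ℭ₃`: members of `ℭ₂` all of whose groups are residually finite. -/
def classC3 : Set ETDS.{a, b, c} :=
  {𝒴 | 𝒴 ∈ classC2 ∧ ∀ t : 𝒴.sys.Index, Group.ResiduallyFinite (𝒴.sys.Grp t)}

/-- A tiered system is nil-rigid on the class `C`. -/
def TDS.IsNilRigidOn (𝒳 : TDS.{a, b, c}) (C : Set ETDS.{a, b, c}) : Prop :=
  ∀ (f : 𝒳.Space → 𝒳.Space) (hf : 𝒳.IsEvolution f), (⟨𝒳, f, hf⟩ : ETDS.{a, b, c}) ∈ C →
    IsAsymptoticallyNilpotent 𝒳.zero f → ∀ t : 𝒳.Index, IsNilpotentOn 𝒳.zero f (𝒳.tier t)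

/-- A group `G` is nil-rigid on the class `C`: all tiered systems with base group `G` (up to
isomorphism) are. -/
def IsNilRigidGroupOn (G : Type u) [Group G] (C : Set ETDS.{a, b, c}) : Prop :=
  ∀ 𝒳 : TDS.{a, b, c}, Nonempty (𝒳.Grp ⊥ ≃* G) → 𝒳.IsNilRigidOn C

/-- Some subgroup of finite index is solvable. -/
def IsVirtuallySolvable (G : Type u) [Group G] : Prop :=
  ∃ H : Subgroup G, H.FiniteIndex ∧ Group.IsSolvable H

/-! ### Subshifts

`mulShift g` is the left shift action of `g⁻¹` on configurations, so that conditions on all `g`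
are the same for `mulShift` and for the left shift `(g • x) h = x (g⁻¹ * h)`. -/

open SymbolicDynamics.FullShift in
/-- `X` is a shift of finite type: membership is tested by a clopen set along the orbit. -/
def IsSFT {A : Type v} [TopologicalSpace A] {G : Type u} [Group G] (X : MulSubshift A G) : Prop :=
  ∃ C : Set (G → A), IsClopen C ∧ ∀ x : G → A, x ∈ X.carrier ↔ ∀ g : G, mulShift g x ∈ C

open SymbolicDynamics.FullShift in
/-- Cellular automata on the subshift `X`: continuous self-maps commuting with all shifts. -/
structure IsCellularAutomaton {A : Type v} [TopologicalSpace A] {G : Type u} [Group G]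
    (X : MulSubshift A G) (f : X.carrier → X.carrier) : Prop where
  continuous : Continuous f
  map_shift : ∀ (g : G) (x : X.carrier),
    (f ⟨mulShift g x, X.mapsTo g x.2⟩ : G → A) = mulShift g (f x : G → A)

/-- The configurations with finite support relative to the symbol `z`. -/
def finiteSupport {A : Type v} (G : Type u) (z : A) : Set (G → A) :=
  {x | {g : G | x g ≠ z}.Finite}

/-! Call a configuration mortal if some iterate of the map makes it zero everywhere. Everything
rests on one contradiction. Suppose there are mortal configurations that visit the origin
arbitrarily late although, at some time `τ`, they vanish on a prescribed window. Restart each at its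
time `τ` and superpose infinitely many, each so far out that the earlier ones die before meeting it.
The superposition visits the origin at unboundedly late times, against asymptotic nilpotency. The
abstract models record this as `not_nested`; for tiered systems it is `Arena.notNested_of_lift`.
Windows and supports are taken modulo a subgroup `R`, so that periodic configurations are covered as
well.

On `ℤ`, a Baire argument yields a wall: a finite pattern after which nothing crosses the origin any
more. Walls isolate half-lines, and the contradiction shows first that a wall is mortal
(`LineModel.IsWall.mortal`), then that a single cell is (`LineModel.mortal_singleton`).

On a group, mortality of configurations that are finite modulo a subgroup descends the derived
series. If configurations periodic modulo deep subgroups are mortal, a configuration wandering away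
from the cosets of `P` could be replaced, as seen from a late visit, by a mortal periodic one, which
again gives a nested family; hence the dynamics is confined (`GroupModel.exists_confinement`).
Confinement makes the relevant part of an abelian layer finitely generated, and its cyclic
generators are treated one at a time: along an infinite cyclic direction the dynamics is a
one-dimensional model (`GroupModel.mortal_of_zpowers`). Residual finiteness supplies the deep
subgroups. At the trivial subgroup, every homoclinic point dies.

Uniformity comes from Baire category and superposition: some homoclinic point has a neighbourhood
that is uniformly small from some time on, and any point small on a large finite set can be
superposed with it without affecting its own late orbit (`TDS.exists_uniform_bound`). Compactness
then gives nilpotency on each tier. The remaining statements are the case of a single tier; for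
subshifts one first passes to a finitely generated subgroup.

In place of equality of symbols there are two thresholds, `close` (below `Δ / 2`) and `agree` (at
most `Δ`): two `close` relations compose to `agree`, and `agree` on a neighbourhood improves to
`close`. -/

/-! ### One-dimensional models -/

/-- An abstract asymptotically nilpotent dynamics on subsets of `ℤ`: `agree n J J' j` and
`close n J J' j` compare the states at the site `j` after `n` steps, started from `J` and `J'`.
The last field excludes infinitely many nested dying configurations with late visits to the
origin. -/
structure LineModel where
  agree : ℕ → Set ℤ → Set ℤ → ℤ → Prop
  close : ℕ → Set ℤ → Set ℤ → ℤ → Prop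
  close_refl : ∀ n J j, close n J J j
  close_symm : ∀ {n J J' j}, close n J J' j → close n J' J j
  agree_of_close : ∀ {n J J' J'' j}, close n J J' j → close n J' J'' j → agree n J J'' j
  init : ∀ {J J' j}, (∀ i, j - 1 ≤ i → i ≤ j + 1 → (i ∈ J ↔ i ∈ J')) → close 0 J J' j
  step : ∀ {n J J' j}, (∀ i, j - 1 ≤ i → i ≤ j + 1 → agree n J J' i) →
    close n J J' j ∧ close (n + 1) J J' j
  agree_shift : ∀ n J J' j a,
    agree n J J' (j + a) ↔ agree n {x | x + a ∈ J} {x | x + a ∈ J'} j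
  eventually_close : ∀ J j, ∃ N, ∀ n ≥ N, close n J ∅ j
  not_nested : ¬ ∀ D N : ℕ, ∃ (J : Set ℤ) (τ n : ℕ), N ≤ n ∧ (∃ m, ∀ j, agree m J ∅ j) ∧
    (∃ D' : ℕ, ∀ j : ℤ, (j < -D' ∨ D' < j) → agree τ J ∅ j) ∧
    (∀ j : ℤ, -D ≤ j → j ≤ D → agree τ J ∅ j) ∧
    ∃ i : ℤ, -1 ≤ i ∧ i ≤ 1 ∧ ¬ close (τ + n) J ∅ i

namespace LineModel

variable (L : LineModel)

theorem agree_of_close' {n : ℕ} {J J' : Set ℤ} {j : ℤ} (h : L.close n J J' j) :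
    L.agree n J J' j :=
  L.agree_of_close h (L.close_refl _ _ _)

theorem close_of_eq_window {n : ℕ} : ∀ {J J' : Set ℤ} {j : ℤ},
    (∀ i, j - (n + 1) ≤ i → i ≤ j + (n + 1) → (i ∈ J ↔ i ∈ J')) → L.close n J J' j := by
  induction n with
  | zero =>
    intro J J' j h
    exact L.init fun i h1 h2 => h i (by push_cast; omega) (by push_cast; omega)
  | succ n ih =>
    intro J J' j h
    refine (L.step fun i h1 h2 => L.agree_of_close' (ih fun k h3 h4 => ?_)).2
    exact h k (by push_cast; omega) (by push_cast; omega)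

theorem eventually_close_Icc (J : Set ℤ) (C : ℕ) :
    ∃ N, ∀ n ≥ N, ∀ j : ℤ, -C ≤ j → j ≤ C → L.close n J ∅ j := by
  choose N hN using L.eventually_close J
  refine ⟨(Finset.Icc (-C : ℤ) C).sup N, fun n hn j h1 h2 => hN j n (le_trans ?_ hn)⟩
  exact Finset.le_sup (f := N) (Finset.mem_Icc.2 ⟨h1, h2⟩)

theorem agree_empty_mono {J : Set ℤ} {m n : ℕ} (hmn : m ≤ n) (h : ∀ j, L.agree m J ∅ j) :
    ∀ j, L.agree n J ∅ j := by
  induction n, hmn using Nat.le_induction with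
  | base => exact h
  | succ n _ ih => exact fun j => L.agree_of_close' (L.step fun i _ _ => ih i).2

/-- The window `p` on `[-D, D]` keeps the sites `-1, 0, 1` empty from time `N` on. -/
structure IsWall (D N : ℕ) (p : Set ℤ) : Prop where
  le : N + 2 ≤ D
  sub : ∀ i ∈ p, -(D : ℤ) ≤ i ∧ i ≤ D
  wall : ∀ J : Set ℤ, (∀ i, -(D : ℤ) ≤ i → i ≤ D → (i ∈ J ↔ i ∈ p)) →
    ∀ n ≥ N, ∀ j : ℤ, -1 ≤ j → j ≤ 1 → L.agree n J ∅ j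

/-- Baire category by hand: if every window could be extended to a configuration with a later visit
near the origin, the limit of successive extensions would have arbitrarily late visits. -/
theorem exists_isWall : ∃ D N p, L.IsWall D N p := by
  obtain ⟨D, N, p, h⟩ : ∃ (D N : ℕ) (p : Set ℤ), ∀ J : Set ℤ,
      (∀ i, -(D : ℤ) ≤ i → i ≤ D → (i ∈ J ↔ i ∈ p)) →
      ∀ n ≥ N, ∀ j : ℤ, -1 ≤ j → j ≤ 1 → L.agree n J ∅ j := by
    by_contra hcon
    push Not at hcon
    choose J hJ t ht j hj1 hj2 hj using hcon
    -- A state consists of radius, time bound and pattern. What happens at the sites `-1, 0, 1` at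
    -- time `t` depends on the cells within `t + 2`, so the new radius protects the visit just
    -- found.
    let nx : ℕ × ℕ × Set ℤ → ℕ × ℕ × Set ℤ := fun x =>
      (x.1 + t x.1 x.2.1 x.2.2 + 3, t x.1 x.2.1 x.2.2 + 1, J x.1 x.2.1 x.2.2)
    let s : ℕ → ℕ × ℕ × Set ℤ := fun k => nx^[k] (0, 0, ∅)
    have hs : ∀ k, s (k + 1) = nx (s k) := fun k => Function.iterate_succ_apply' _ _ _
    have hD : ∀ k, (s (k + 1)).1 = (s k).1 + t (s k).1 (s k).2.1 (s k).2.2 + 3 := fun k => by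
      rw [hs]
    have hT : ∀ k, (s (k + 1)).2.1 = t (s k).1 (s k).2.1 (s k).2.2 + 1 := fun k => by rw [hs]
    have hP : ∀ k, (s (k + 1)).2.2 = J (s k).1 (s k).2.1 (s k).2.2 := fun k => by rw [hs]
    have hDmono : ∀ k l, k ≤ l → (s k).1 ≤ (s l).1 := by
      intro k l hkl
      induction l, hkl using Nat.le_induction with
      | base => exact le_rfl
      | succ l _ ih => rw [hD]; omega
    have hDk : ∀ k, k ≤ (s k).1 := by
      intro k
      induction k with
      | zero => exact Nat.zero_le _
      | succ k ih => rw [hD]; omega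
    have hst : ∀ k l, k ≤ l → ∀ i : ℤ, -((s k).1 : ℤ) ≤ i → i ≤ (s k).1 →
        (i ∈ (s l).2.2 ↔ i ∈ (s k).2.2) := by
      intro k l hkl i h1 h2
      induction l, hkl using Nat.le_induction with
      | base => exact Iff.rfl
      | succ l hl ih =>
        have := hDmono k l hl
        rw [hP, hJ _ _ _ i (by omega) (by omega), ih]
    let Jinf : Set ℤ := {i | i ∈ (s i.natAbs).2.2}
    have hinf : ∀ k, ∀ i : ℤ, -((s k).1 : ℤ) ≤ i → i ≤ (s k).1 →
        (i ∈ Jinf ↔ i ∈ (s k).2.2) := by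
      intro k i h1 h2
      change i ∈ (s i.natAbs).2.2 ↔ _
      have h3 := hDk i.natAbs
      rcases le_total k i.natAbs with h | h
      · exact hst _ _ h i h1 h2
      · exact (hst _ _ h i (by omega) (by omega)).symm
    obtain ⟨N, hN⟩ := L.eventually_close_Icc Jinf 1
    have hTk : ∀ k, k ≤ t (s k).1 (s k).2.1 (s k).2.2 := by
      intro k
      induction k with
      | zero => exact Nat.zero_le _
      | succ k ih =>
        have := ht (s (k + 1)).1 (s (k + 1)).2.1 (s (k + 1)).2.2
        have := hT k
        omega
    have h1 := hN _ (hTk N) (j (s N).1 (s N).2.1 (s N).2.2)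
      (by push_cast; exact hj1 _ _ _) (by push_cast; exact hj2 _ _ _)
    refine hj (s N).1 (s N).2.1 (s N).2.2 (L.agree_of_close (L.close_symm ?_) h1)
    have h2 := hj1 (s N).1 (s N).2.1 (s N).2.2
    have h3 := hj2 (s N).1 (s N).2.1 (s N).2.2
    refine L.close_of_eq_window fun i h4 h5 => ?_
    have h6 := hD N
    rw [hinf (N + 1) i (by omega) (by omega), hP]
  -- The radius is enlarged so that until time `N` nothing from the far side of the pattern passes
  -- its centre; this starts the induction in `IsWall.agree_right_zero`.
  refine ⟨D + N + 2, N, {i | i ∈ p ∧ -((D + N + 2 : ℕ) : ℤ) ≤ i ∧ i ≤ (D + N + 2 : ℕ)},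
    by omega, fun i hi => hi.2, fun J hJ => h J fun i h1 h2 => ?_⟩
  rw [hJ i (by push_cast; omega) (by push_cast; omega)]
  exact ⟨fun h => h.1, fun h => ⟨h, by push_cast; omega, by push_cast; omega⟩⟩

/-- The mirror image of a model. -/
def reflect : LineModel where
  agree n J J' j := L.agree n (-J) (-J') (-j)
  close n J J' j := L.close n (-J) (-J') (-j)
  close_refl _ _ _ := L.close_refl _ _ _
  close_symm h := L.close_symm h
  agree_of_close h h' := L.agree_of_close h h'
  init h := L.init fun i h1 h2 => h (-i) (by omega) (by omega)
  step h := L.step fun i h1 h2 => by simpa using h (-i) (by omega) (by omega)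
  agree_shift n J J' j a := by
    have := L.agree_shift n (-J) (-J') (-j) (-a)
    rw [show -(j + a) = -j + -a by ring, this]
    have e : ∀ J : Set ℤ, {x | x + -a ∈ -J} = -{x | x + a ∈ J} := fun J => by
      ext x
      simp only [Set.mem_ofPred_eq, Set.mem_neg]
      rw [show -(x + -a) = -x + a by ring]
    rw [e, e]
  eventually_close J j := by simpa using L.eventually_close (-J) (-j)
  not_nested h := by
    refine L.not_nested fun D N => ?_
    obtain ⟨J, τ, n, hn, ⟨m, hm⟩, ⟨D', hD'⟩, hD, i, h1, h2, h3⟩ := h D N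
    refine ⟨-J, τ, n, hn, ⟨m, fun j => by simpa using hm (-j)⟩,
      ⟨D', fun j hj => by simpa using hD' (-j) (by omega)⟩,
      fun j h1 h2 => by simpa using hD (-j) (by omega) (by omega),
      -i, by omega, by omega, by simpa using h3⟩

theorem IsWall.reflect {L : LineModel} {D N : ℕ} {p : Set ℤ} (h : L.IsWall D N p) :
    L.reflect.IsWall D N (-p) where
  le := h.le
  sub i hi := by have := h.sub (-i) hi; omega
  wall J hJ n hn j h1 h2 := by
    have := h.wall (-J) (fun i h3 h4 => by simpa using hJ (-i) (by omega) (by omega)) n hn (-j)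
      (by omega) (by omega)
    simpa [LineModel.reflect] using this

/-- The configuration `J` shows the window `p` of radius `D` at the site `x`. -/
def Shows (D : ℕ) (p J : Set ℤ) (x : ℤ) : Prop :=
  ∀ i : ℤ, -(D : ℤ) ≤ i → i ≤ D → (i + x ∈ J ↔ i ∈ p)

/-! ### Walls separate the line, and are mortal. -/

section Wall

variable {L}
variable {D N : ℕ} {p : Set ℤ}

theorem IsWall.close_zero (hw : L.IsWall D N p) {J : Set ℤ} (hJ : Shows D p J 0) {n : ℕ}
    (hn : N ≤ n) : L.close n J ∅ 0 :=
  (L.step fun i h1 h2 => hw.wall J (by simpa [Shows] using hJ) n hn i (by omega) (by omega)).1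

/-- To the right of a wall, the dynamics does not depend on what is to the left of it. -/
theorem IsWall.agree_right_zero (hw : L.IsWall D N p) {J J' : Set ℤ} (hJ : Shows D p J 0)
    (hJ' : Shows D p J' 0) (hJJ' : ∀ i : ℤ, 0 ≤ i → (i ∈ J ↔ i ∈ J')) {n : ℕ} (hn : N ≤ n) :
    ∀ j : ℤ, 0 ≤ j → L.agree n J J' j := by
  have hle := hw.le
  induction n, hn using Nat.le_induction with
  | base =>
    intro j hj
    refine L.agree_of_close' (L.close_of_eq_window fun i h1 h2 => ?_)
    rcases le_or_gt 0 i with h | h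
    · exact hJJ' i h
    · have h3 := hJ i (by omega) (by omega)
      have h4 := hJ' i (by omega) (by omega)
      simp only [add_zero] at h3 h4
      rw [h3, h4]
  | succ n hn ih =>
    intro j hj
    rcases eq_or_lt_of_le hj with h | h
    · subst h
      exact L.agree_of_close (hw.close_zero hJ (by omega))
        (L.close_symm (hw.close_zero hJ' (by omega)))
    · exact L.agree_of_close' (L.step fun i h1 h2 => ih i (by omega)).2

theorem IsWall.agree_right (hw : L.IsWall D N p) {J J' : Set ℤ} {x : ℤ} (hJ : Shows D p J x)
    (hJ' : Shows D p J' x) (hJJ' : ∀ i : ℤ, x ≤ i → (i ∈ J ↔ i ∈ J')) {n : ℕ} (hn : N ≤ n) :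
    ∀ j : ℤ, x ≤ j → L.agree n J J' j := by
  intro j hj
  have := hw.agree_right_zero (J := {y | y + x ∈ J}) (J' := {y | y + x ∈ J'})
    (by simpa [Shows] using hJ) (by simpa [Shows] using hJ')
    (fun i hi => hJJ' (i + x) (by omega)) hn (j - x) (by omega)
  simpa using (L.agree_shift n J J' (j - x) x).2 this

/-- A configuration that equals a dead one to the right of a wall is dead there. -/
theorem IsWall.agree_empty_right (hw : L.IsWall D N p) {J J' : Set ℤ} {x : ℤ}
    (hJ : Shows D p J x) (hJ' : Shows D p J' x) (hJJ' : ∀ i : ℤ, x ≤ i → (i ∈ J ↔ i ∈ J'))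
    {n : ℕ} (hn : N ≤ n) (hdead : ∀ j, L.agree n J' ∅ j) :
    ∀ j : ℤ, x ≤ j → L.agree n J ∅ j := by
  intro j hj
  rcases eq_or_lt_of_le hj with h | h
  · subst h
    have := hw.close_zero (J := {y | y + x ∈ J}) (by simpa [Shows] using hJ) hn
    have := (L.agree_shift n J ∅ 0 x).2 (by simpa using L.agree_of_close' this)
    simpa using this
  · exact L.agree_of_close
      (L.step fun i h1 h2 => hw.agree_right hJ hJ' hJJ' hn i (by omega)).1
      (L.step fun i _ _ => hdead i).1

theorem IsWall.agree_empty_left (hw : L.IsWall D N p) {J J' : Set ℤ} {x : ℤ}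
    (hJ : Shows D p J x) (hJ' : Shows D p J' x) (hJJ' : ∀ i : ℤ, i ≤ x → (i ∈ J ↔ i ∈ J'))
    {n : ℕ} (hn : N ≤ n) (hdead : ∀ j, L.agree n J' ∅ j) :
    ∀ j : ℤ, j ≤ x → L.agree n J ∅ j := by
  intro j hj
  have hs : ∀ J : Set ℤ, Shows D p J x → Shows D (-p) (-J) (-x) := by
    intro J hJ i h1 h2
    have := hJ (-i) (by omega) (by omega)
    rw [Set.mem_neg, Set.mem_neg, ← this, show -(i + -x) = -i + x by ring]
  have := hw.reflect.agree_empty_right (hs J hJ) (hs J' hJ')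
    (fun i hi => hJJ' (-i) (by omega)) hn
    (fun j => by simpa [LineModel.reflect] using hdead (-j)) (-j) (by omega)
  simpa [LineModel.reflect] using this

/-- Two walls, dead on their outer sides, kill everything. -/
theorem IsWall.mortal_of_two (hw : L.IsWall D N p) {J J₁ J₂ : Set ℤ} {x y : ℤ}
    (hx : Shows D p J x) (hx' : Shows D p J₁ x) (hxJ : ∀ i : ℤ, i ≤ x → (i ∈ J ↔ i ∈ J₁))
    (hy : Shows D p J y) (hy' : Shows D p J₂ y) (hyJ : ∀ i : ℤ, y ≤ i → (i ∈ J ↔ i ∈ J₂))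
    {m : ℕ} (hm : N ≤ m) (hd₁ : ∀ j, L.agree m J₁ ∅ j) (hd₂ : ∀ j, L.agree m J₂ ∅ j) :
    ∃ n, ∀ j, L.agree n J ∅ j := by
  obtain ⟨N', hN'⟩ := L.eventually_close_Icc J (x.natAbs + y.natAbs)
  refine ⟨max m N', fun j => ?_⟩
  have h1 : m ≤ max m N' := le_max_left _ _
  rcases le_or_gt j x with h | h
  · exact hw.agree_empty_left hx hx' hxJ (hm.trans h1) (L.agree_empty_mono h1 hd₁) j h
  rcases le_or_gt y j with h' | h'
  · exact hw.agree_empty_right hy hy' hyJ (hm.trans h1) (L.agree_empty_mono h1 hd₂) j h'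
  · exact L.agree_of_close' (hN' _ (le_max_right _ _) j (by omega) (by omega))

theorem agree_translate (L : LineModel) {n : ℕ} {J : Set ℤ} (a : ℤ)
    (h : ∀ j, L.agree n J ∅ j) : ∀ j, L.agree n {x | x + a ∈ J} ∅ j := fun j => by
  simpa using (L.agree_shift n J ∅ j a).1 (h (j + a))

/-- The configuration on the left of a wall can be completed periodically, so that nothing but the
right side of the wall survives; two such half-lines facing each other annihilate. -/
theorem IsWall.not_right_immortal (hw : L.IsWall D N p)
    (him : ∀ n ≥ N, ∃ j : ℤ, 0 ≤ j ∧ ¬ L.agree n p ∅ j) : False := by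
  -- Copies of the window `[-D, D]` at distance `2 * D + 1` tile the line, so the periodic extension
  -- `P` shows a wall at each multiple of `k`. Being periodic, it dies uniformly, at a time `τ`.
  obtain ⟨k, hk⟩ : ∃ k : ℤ, k = 2 * D + 1 := ⟨_, rfl⟩
  obtain ⟨P, hP⟩ : ∃ P : Set ℤ, P = {x | ∃ i : ℤ, x - k * i ∈ p} := ⟨_, rfl⟩
  have hPp : ∀ i : ℤ, -(D : ℤ) ≤ i → i ≤ D → (i ∈ P ↔ i ∈ p) := by
    intro i h1 h2
    rw [hP]
    refine ⟨fun ⟨l, hl⟩ => ?_, fun h => ⟨0, by simpa using h⟩⟩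
    have h3 := hw.sub _ hl
    obtain rfl : l = 0 := by
      rcases lt_trichotomy l 0 with h | h | h
      · nlinarith
      · exact h
      · nlinarith
    simpa using hl
  have hPper : ∀ l : ℤ, {x | x + k * l ∈ P} = P := by
    intro l
    ext x
    rw [hP]
    constructor
    · rintro ⟨i, hi⟩
      exact ⟨i - l, by rwa [show x - k * (i - l) = x + k * l - k * i by ring]⟩
    · rintro ⟨i, hi⟩
      exact ⟨i + l, by rwa [show x + k * l - k * (i + l) = x - k * i by ring]⟩
  obtain ⟨τ, hτN, hτ⟩ : ∃ τ, N ≤ τ ∧ ∀ j, L.agree τ P ∅ j := by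
    obtain ⟨N₁, hN₁⟩ := L.eventually_close_Icc P k.natAbs
    refine ⟨max N N₁, le_max_left _ _, fun j => ?_⟩
    have h1 := Int.emod_nonneg j (show k ≠ 0 by omega)
    have h2 := Int.emod_lt_of_pos j (show 0 < k by omega)
    have h3 := L.agree_of_close' (hN₁ _ (le_max_right N N₁) (j % k) (by omega) (by omega))
    have h4 := (L.agree_shift (max N N₁) P ∅ (j % k) (k * (j / k))).2
      (by rw [hPper]; simpa using h3)
    rwa [Int.emod_add_mul_ediv] at h4
  refine L.not_nested fun D' N' => ?_
  obtain ⟨N₂, hN₂⟩ := L.eventually_close_Icc p (D' + D + τ + 3)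
  -- By time `n₁` the pattern `p` has vanished near its own centre, so its live site `a` is far to
  -- the right. Placing the wall at `-a` brings this late visit to the origin.
  obtain ⟨n₁, hn₁⟩ : ∃ n₁, n₁ = max N₂ N' + τ + N := ⟨_, rfl⟩
  obtain ⟨a, ha0, ha⟩ := him n₁ (by omega)
  have haC : (D' + D + τ + 3 : ℕ) < a := by
    by_contra hcon
    exact ha (L.agree_of_close' (hN₂ n₁ (by omega) a (by omega) (by omega)))
  obtain ⟨h, hh⟩ : ∃ h : ℤ, h = a + n₁ + D + D' + τ + 10 := ⟨_, rfl⟩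
  -- Two periodic half-lines facing each other: outside the walls at `-a` and `h` all is dead at
  -- time `τ`, so only a bounded part survives. The right wall is too far away to be felt at the
  -- origin by time `n₁`; `J'` below omits it.
  obtain ⟨J, hJ⟩ : ∃ J : Set ℤ,
    J = {x | (x ≤ D - a ∧ x + a ∈ P) ∨ (h - D ≤ x ∧ x - h ∈ P)} := ⟨_, rfl⟩
  obtain ⟨J', hJ'⟩ : ∃ J' : Set ℤ, J' = {x | x ≤ D - a ∧ x + a ∈ P} := ⟨_, rfl⟩
  have memJ : ∀ x, x ∈ J ↔ (x ≤ D - a ∧ x + a ∈ P) ∨ (h - D ≤ x ∧ x - h ∈ P) := by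
    intro x; rw [hJ]; rfl
  have memJ' : ∀ x, x ∈ J' ↔ x ≤ D - a ∧ x + a ∈ P := by
    intro x; rw [hJ']; rfl
  have hleft : ∀ i : ℤ, i ≤ -a → (i ∈ J ↔ i ∈ {x | x + a ∈ P}) := by
    intro i hi
    rw [memJ, Set.mem_ofPred_eq]
    have h1 : i ≤ D - a := by omega
    have h2 : ¬ h - D ≤ i := by omega
    tauto
  have hright : ∀ i : ℤ, h ≤ i → (i ∈ J ↔ i ∈ {x | x + -h ∈ P}) := by
    intro i hi
    rw [memJ, Set.mem_ofPred_eq, ← sub_eq_add_neg]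
    have h1 : ¬ i ≤ D - a := by omega
    have h2 : h - D ≤ i := by omega
    tauto
  have hsJ : Shows D p J (-a) := by
    intro i h1 h2
    rw [memJ, ← hPp i h1 h2]
    have h3 : i + -a ≤ D - a := by omega
    have h4 : ¬ h - D ≤ i + -a := by omega
    rw [show i + -a + a = i by ring]
    tauto
  have hsJ' : Shows D p J h := by
    intro i h1 h2
    rw [memJ, ← hPp i h1 h2]
    have h3 : ¬ i + h ≤ D - a := by omega
    have h4 : h - D ≤ i + h := by omega
    rw [show i + h - h = i by ring]
    tauto
  have hsP : ∀ b : ℤ, Shows D p {x | x + b ∈ P} (-b) := by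
    intro b i h1 h2
    rw [← hPp i h1 h2, Set.mem_ofPred_eq, neg_add_cancel_right]
  have hsP' : Shows D p {x | x + -h ∈ P} h := by simpa using hsP (-h)
  refine ⟨J, τ, n₁ - τ, by omega, ?_, ⟨a.natAbs + h.natAbs, ?_⟩, ?_, ?_⟩
  · exact hw.mortal_of_two hsJ (hsP a) hleft hsJ' hsP' hright hτN (L.agree_translate _ hτ)
      (L.agree_translate _ hτ)
  · rintro j (hj | hj)
    · exact hw.agree_empty_left hsJ (hsP a) hleft hτN (L.agree_translate _ hτ) j (by omega)
    · exact hw.agree_empty_right hsJ' hsP' hright hτN (L.agree_translate _ hτ) j (by omega)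
  · intro j h1 h2
    refine L.agree_of_close' (L.close_of_eq_window fun i h3 h4 => ?_)
    rw [memJ]
    have h5 : ¬ i ≤ D - a := by omega
    have h6 : ¬ h - D ≤ i := by omega
    simp [h5, h6]
  · by_contra hcon
    push Not at hcon
    rw [show τ + (n₁ - τ) = n₁ by omega] at hcon
    have h1 : L.close n₁ J' ∅ 0 := by
      refine (L.step fun i h1 h2 => L.agree_of_close (L.close_of_eq_window fun l h3 h4 => ?_)
        (hcon i (by omega) (by omega))).1
      rw [memJ, memJ']
      have h6 : ¬ h - D ≤ l := by omega
      tauto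
    have hsp : Shows D p {x | x + a ∈ p} (-a) := by
      intro i _ _
      rw [Set.mem_ofPred_eq, neg_add_cancel_right]
    have hsJ'' : Shows D p J' (-a) := by
      intro i h1 h2
      rw [memJ', ← hPp i h1 h2, show i + -a + a = i by ring]
      have h3 : i + -a ≤ D - a := by omega
      tauto
    have heq : ∀ i : ℤ, -a ≤ i → (i ∈ J' ↔ i ∈ {x | x + a ∈ p}) := by
      intro i hi
      rw [memJ', Set.mem_ofPred_eq]
      rcases le_or_gt i (D - a) with h2 | h2
      · rw [hPp _ (by omega) (by omega)]
        tauto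
      · have h3 : i + a ∉ p := fun h => by have := hw.sub _ h; omega
        have h4 : ¬ i ≤ D - a := by omega
        tauto
    have h2 : L.close n₁ J' {x | x + a ∈ p} 0 :=
      (L.step fun i h1 h2 => hw.agree_right hsJ'' hsp heq (by omega) i (by omega)).1
    have h3 := L.agree_of_close (L.close_symm h2) h1
    have h4 := (L.agree_shift n₁ p ∅ 0 a).2 (by simpa using h3)
    exact ha (by simpa using h4)

/-- Once one side of the wall is empty it stays so, since the wall keeps the centre empty. Hence an
immortal `p` is immortal on one fixed side, which `IsWall.not_right_immortal` excludes up to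
reflection. -/
theorem IsWall.mortal (hw : L.IsWall D N p) : ∃ m, ∀ j, L.agree m p ∅ j := by
  have hs : Shows D p p 0 := by simp [Shows]
  by_contra hcon
  push Not at hcon
  have key : (∀ n ≥ N, ∃ j : ℤ, 0 ≤ j ∧ ¬ L.agree n p ∅ j) ∨
      ∀ n ≥ N, ∃ j : ℤ, j ≤ 0 ∧ ¬ L.agree n p ∅ j := by
    by_contra h
    push Not at h
    obtain ⟨⟨n₁, hn₁, h₁⟩, n₂, hn₂, h₂⟩ := h
    have step : ∀ n ≥ N, L.agree n p ∅ 0 := fun n hn => L.agree_of_close' (hw.close_zero hs hn)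
    have r : ∀ n, n₁ ≤ n → ∀ j : ℤ, 0 ≤ j → L.agree n p ∅ j := by
      intro n hn
      induction n, hn using Nat.le_induction with
      | base => exact h₁
      | succ n hn ih =>
        intro j hj
        rcases eq_or_lt_of_le hj with rfl | h
        · exact step _ (by omega)
        · exact L.agree_of_close' (L.step fun i h1 h2 => ih i (by omega)).2
    have l : ∀ n, n₂ ≤ n → ∀ j : ℤ, j ≤ 0 → L.agree n p ∅ j := by
      intro n hn
      induction n, hn using Nat.le_induction with
      | base => exact h₂
      | succ n hn ih =>
        intro j hj
        rcases eq_or_lt_of_le hj with rfl | h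
        · exact step _ (by omega)
        · exact L.agree_of_close' (L.step fun i h1 h2 => ih i (by omega)).2
    obtain ⟨j, hj⟩ := hcon (max n₁ n₂)
    rcases le_total 0 j with h | h
    · exact hj (r _ (le_max_left _ _) j h)
    · exact hj (l _ (le_max_right _ _) j h)
  rcases key with h | h
  · exact hw.not_right_immortal h
  · refine hw.reflect.not_right_immortal fun n hn => ?_
    obtain ⟨j, hj, hj'⟩ := h n hn
    exact ⟨-j, by omega, by simpa [LineModel.reflect] using hj'⟩

/-- Enclosing the cell between two distant walls makes it mortal without changing its early history.
An immortal cell would thus give mortal configurations with late visits far from their start. -/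
theorem mortal_singleton (L : LineModel) : ∃ m, ∀ j, L.agree m {0} ∅ j := by
  obtain ⟨D, N, p, hw⟩ := L.exists_isWall
  obtain ⟨m, hm⟩ := hw.mortal
  by_contra hcon
  push Not at hcon
  refine L.not_nested fun D' N' => ?_
  obtain ⟨N₂, hN₂⟩ := L.eventually_close_Icc {0} (D' + 3)
  obtain ⟨a, ha⟩ := hcon (max N₂ N')
  have haC : a < -(D' + 3 : ℕ) ∨ (D' + 3 : ℕ) < a := by
    by_contra h
    exact ha (L.agree_of_close' (hN₂ _ (le_max_left _ _) a (by omega) (by omega)))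
  obtain ⟨n, hn⟩ : ∃ n, n = max N₂ N' := ⟨_, rfl⟩
  rw [← hn] at ha
  -- The walls at `-h` and `h` are beyond the range from which the origin can be influenced by time
  -- `n`, and their patterns miss both the cell `-a` and the window `[-D', D']`.
  obtain ⟨h, hh⟩ : ∃ h : ℤ, h = a.natAbs + n + 2 * D + D' + 10 := ⟨_, rfl⟩
  obtain ⟨Y, hY⟩ : ∃ Y : Set ℤ, Y = {x | x = -a ∨ x + h ∈ p ∨ x + -h ∈ p} := ⟨_, rfl⟩
  have memY : ∀ x, x ∈ Y ↔ x = -a ∨ x + h ∈ p ∨ x + -h ∈ p := by intro x; rw [hY]; rfl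
  have far : ∀ x : ℤ, (x < -D ∨ (D : ℤ) < x) → x ∉ p := fun x hx hp => by
    have := hw.sub x hp; omega
  have hsp : ∀ b : ℤ, Shows D p {x | x + b ∈ p} (-b) := by
    intro b i h1 h2
    rw [Set.mem_ofPred_eq, neg_add_cancel_right]
  have hsp' : Shows D p {x | x + -h ∈ p} h := by simpa using hsp (-h)
  have el : ∀ i : ℤ, i ≤ -h + D → (i ∈ Y ↔ i + h ∈ p) := by
    intro i hi
    rw [memY]
    have h1 : i ≠ -a := by omega
    have h2 := far (i + -h) (by omega)
    tauto
  have er : ∀ i : ℤ, h - D ≤ i → (i ∈ Y ↔ i + -h ∈ p) := by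
    intro i hi
    rw [memY]
    have h1 : i ≠ -a := by omega
    have h2 := far (i + h) (by omega)
    tauto
  refine ⟨Y, 0, n, by omega, ?_, ⟨a.natAbs + h.natAbs + D + 2, ?_⟩, ?_, 0, by omega, by omega, ?_⟩
  · refine hw.mortal_of_two (J₁ := {x | x + h ∈ p}) (J₂ := {x | x + -h ∈ p}) (x := -h) (y := h)
      (m := max m N) ?_ (hsp h) (fun i hi => el i (by omega)) ?_ hsp'
      (fun i hi => er i (by omega)) (le_max_right _ _)
      (L.agree_translate _ (L.agree_empty_mono (le_max_left _ _) hm))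
      (L.agree_translate _ (L.agree_empty_mono (le_max_left _ _) hm))
    · intro i h1 h2
      rw [el _ (by omega), neg_add_cancel_right]
    · intro i h1 h2
      rw [er _ (by omega), add_neg_cancel_right]
  · intro j hj
    refine L.agree_of_close' (L.init fun i h1 h2 => ?_)
    rw [memY]
    have h3 : i ≠ -a := by omega
    have h4 := far (i + h) (by omega)
    have h5 := far (i + -h) (by omega)
    simp [h3, h4, h5]
  · intro j h1 h2
    refine L.agree_of_close' (L.init fun i h1 h2 => ?_)
    rw [memY]
    have h3 : i ≠ -a := by omega
    have h4 := far (i + h) (by omega)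
    have h5 := far (i + -h) (by omega)
    simp [h3, h4, h5]
  · intro hc
    rw [zero_add] at hc
    have h1 : L.close n {x | x + a ∈ ({0} : Set ℤ)} Y 0 := by
      refine L.close_of_eq_window fun i h1 h2 => ?_
      rw [memY]
      have h4 := far (i + h) (by omega)
      have h5 := far (i + -h) (by omega)
      simp only [h4, h5, or_false, Set.mem_ofPred_eq, Set.mem_singleton_iff]
      omega
    have h2 := (L.agree_shift n {0} ∅ 0 a).2 (by simpa using L.agree_of_close h1 hc)
    exact ha (by simpa using h2)

end Wall
end LineModel

/-! ### Dynamics of separated subsets of a group -/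

section
open scoped Pointwise

/-- Distinct elements of `S` do not differ by left multiplication by an element of `K`. -/
def IsSep {Γ : Type u} [Group Γ] (K S : Set Γ) : Prop :=
  ∀ s ∈ S, ∀ s' ∈ S, s' * s⁻¹ ∈ K → s' = s

/-- `S` is invariant under right multiplication by `R`. -/
def IsPer {Γ : Type u} [Group Γ] (R : Subgroup Γ) (S : Set Γ) : Prop :=
  ∀ x, ∀ r ∈ R, x ∈ S → x * r ∈ S

/-- An abstract asymptotically nilpotent dynamics on separated subsets of `Γ`. -/
structure GroupModel (Γ : Type u) [Group Γ] where
  sep : Set Γ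
  window : Set Γ
  nbhd : Set Γ
  sep_finite : sep.Finite
  window_finite : window.Finite
  nbhd_finite : nbhd.Finite
  agree : ℕ → Set Γ → Set Γ → Γ → Prop
  close : ℕ → Set Γ → Set Γ → Γ → Prop
  close_refl : ∀ n S g, close n S S g
  close_symm : ∀ {n S S' g}, close n S S' g → close n S' S g
  agree_of_close : ∀ {n S S' S'' g}, close n S S' g → close n S' S'' g → agree n S S'' g
  init : ∀ {S S' g}, IsSep sep S → IsSep sep S' →
    (∀ k ∈ window, k * g ∈ S ↔ k * g ∈ S') → close 0 S S' g
  step : ∀ {n S S' g}, (∀ k ∈ nbhd, agree n S S' (k * g)) →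
    close n S S' g ∧ close (n + 1) S S' g
  agree_shift : ∀ n S S' g h,
    agree n S S' (g * h) ↔ agree n {x | x * h ∈ S} {x | x * h ∈ S'} g
  close_shift : ∀ n S S' g h,
    close n S S' (g * h) ↔ close n {x | x * h ∈ S} {x | x * h ∈ S'} g
  eventually_close : ∀ S g, ∃ N, ∀ n ≥ N, close n S ∅ g
  not_nested : ∀ (R : Subgroup Γ) (H : Set Γ), H.Finite →
    ¬ ∀ (F : Set Γ) (N : ℕ), F.Finite → ∃ (S : Set Γ) (τ n : ℕ), IsSep sep S ∧ N ≤ n ∧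
      (∃ m, ∀ g, agree m S ∅ g) ∧
      (∃ F' : Set Γ, F'.Finite ∧ ∀ g, ¬ agree τ S ∅ g → g ∈ F' * (R : Set Γ)) ∧
      (∀ g ∈ F * (R : Set Γ), agree τ S ∅ g) ∧ ∃ h ∈ H, ¬ close (τ + n) S ∅ h

theorem IsSep.mono {Γ : Type u} [Group Γ] {K S S' : Set Γ} (h : IsSep K S) (hS : S' ⊆ S) :
    IsSep K S' :=
  fun s hs s' hs' => h s (hS hs) s' (hS hs')

theorem IsSep.shift {Γ : Type u} [Group Γ] {K S : Set Γ} (h : IsSep K S) (a : Γ) :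
    IsSep K {x | x * a ∈ S} := by
  intro s hs s' hs' hk
  have := h _ hs _ hs' (by simpa [mul_assoc] using hk)
  exact mul_right_cancel this

theorem isSep_empty {Γ : Type u} [Group Γ] (K : Set Γ) : IsSep K ∅ := fun _ h => h.elim

theorem isPer_iff {Γ : Type u} [Group Γ] {R : Subgroup Γ} {S : Set Γ} (h : IsPer R S) {x r : Γ}
    (hr : r ∈ R) : x * r ∈ S ↔ x ∈ S :=
  ⟨fun hx => by simpa using h _ _ (R.inv_mem hr) hx, h x r hr⟩

namespace GroupModel

variable {Γ : Type u} [Group Γ] (M : GroupModel Γ)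

/-- All sites are eventually in the empty state. -/
def Mortal (S : Set Γ) : Prop := ∃ m, ∀ g, M.agree m S ∅ g

theorem agree_of_close' {n : ℕ} {S S' : Set Γ} {g : Γ} (h : M.close n S S' g) :
    M.agree n S S' g :=
  M.agree_of_close h (M.close_refl _ _ _)

theorem exists_window (n : ℕ) : ∃ W : Set Γ, W.Finite ∧ ∀ S S' g, IsSep M.sep S →
    IsSep M.sep S' → (∀ k ∈ W, k * g ∈ S ↔ k * g ∈ S') → M.close n S S' g := by
  induction n with
  | zero => exact ⟨M.window, M.window_finite, fun S S' g h h' hk => M.init h h' hk⟩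
  | succ n ih =>
    obtain ⟨W, hW, h⟩ := ih
    refine ⟨W * M.nbhd, hW.mul M.nbhd_finite, fun S S' g hS hS' hk => (M.step fun b hb => ?_).2⟩
    refine M.agree_of_close' (h _ _ _ hS hS' fun k hkW => ?_)
    simpa [mul_assoc] using hk (k * b) (Set.mul_mem_mul hkW hb)

theorem exists_spread (n : ℕ) : ∃ W : Set Γ, W.Finite ∧ ∀ S g, IsSep M.sep S →
    ¬ M.agree n S ∅ g → g ∈ W * S := by
  obtain ⟨W, hW, h⟩ := M.exists_window n
  refine ⟨W⁻¹, hW.inv, fun S g hS hg => ?_⟩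
  by_contra hn
  refine hg (M.agree_of_close' (h S ∅ g hS (isSep_empty _) fun k hk => ?_))
  simp only [Set.mem_empty_iff_false, iff_false]
  exact fun hkS => hn ⟨k⁻¹, by simpa using hk, k * g, hkS, by simp⟩

theorem agree_empty_mono {S : Set Γ} {m n : ℕ} (hmn : m ≤ n) (h : ∀ g, M.agree m S ∅ g) :
    ∀ g, M.agree n S ∅ g := by
  induction n, hmn using Nat.le_induction with
  | base => exact h
  | succ n _ ih => exact fun j => M.agree_of_close' (M.step fun i _ => ih _).2

theorem close_per {R : Subgroup Γ} {S : Set Γ} (h : IsPer R S) {n : ℕ} {g r : Γ} (hr : r ∈ R) :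
    M.close n S ∅ (g * r) ↔ M.close n S ∅ g := by
  rw [M.close_shift]
  have : {x | x * r ∈ S} = S := by ext x; exact isPer_iff h hr
  simp [this]

theorem eventually_close_of_per {R : Subgroup Γ} {S F : Set Γ} (h : IsPer R S) (hF : F.Finite) :
    ∃ N, ∀ n ≥ N, ∀ g ∈ F * (R : Set Γ), M.close n S ∅ g := by
  choose N hN using M.eventually_close S
  refine ⟨hF.toFinset.sup N, fun n hn g hg => ?_⟩
  obtain ⟨x, hx, r, hr, rfl⟩ := hg
  refine (M.close_per h hr).2 (hN x n (le_trans ?_ hn))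
  exact Finset.le_sup (f := N) (hF.mem_toFinset.2 hx)

/-- By periodicity, only finitely many representatives have to be waited for. -/
theorem mortal_of_confined {R : Subgroup Γ} {S F : Set Γ} (h : IsPer R S) (hF : F.Finite)
    (hc : ∀ n g, ¬ M.agree n S ∅ g → g ∈ F * (R : Set Γ)) : M.Mortal S := by
  obtain ⟨N, hN⟩ := M.eventually_close_of_per h hF
  exact ⟨N, fun g => by_contra fun hg => hg (M.agree_of_close' (hN N le_rfl g (hc N g hg)))⟩

/-- If separated sets which are periodic modulo deep subgroups `L` between `R` and `P` are mortal,
then the dynamics of `R`-periodic sets inside `F P` is confined to some `H P`. -/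
theorem exists_confinement {R P A : Subgroup Γ} (hPA : P ≤ A)
    (hRA : ∀ x ∈ A, ∀ r ∈ R, x * r * x⁻¹ ∈ R) (hPn : ∀ x ∈ A, ∀ r ∈ P, x * r * x⁻¹ ∈ P)
    {F F₀ HA : Set Γ} (hF₀ : F₀.Finite) (hHA : HA.Finite) (hF₀F : F₀ ⊆ F * (A : Set Γ))
    (hamb : ∀ S, IsSep M.sep S → IsPer R S → S ⊆ F * (A : Set Γ) → ∀ n g,
      ¬ M.agree n S ∅ g → g ∈ HA * (A : Set Γ))
    (hL : ∀ X : Set Γ, X.Finite → X ⊆ P → (∀ x ∈ X, x ∉ R) → ∃ L : Subgroup Γ, R ≤ L ∧ L ≤ P ∧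
      (∀ x ∈ X, x ∉ L) ∧ ∀ S, IsSep M.sep S → IsPer L S →
        (∃ Φ : Set Γ, Φ.Finite ∧ S ⊆ Φ * (L : Set Γ)) → S ⊆ F * (A : Set Γ) → M.Mortal S) :
    ∃ H : Set Γ, H.Finite ∧ ∀ S, IsSep M.sep S → IsPer R S → S ⊆ F₀ * (P : Set Γ) →
      ∀ n g, ¬ M.agree n S ∅ g → g ∈ H * (P : Set Γ) := by
  by_contra hcon
  push Not at hcon
  refine M.not_nested P HA hHA fun F₁ N hF₁ => ?_
  choose W hWf hW using M.exists_spread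
  choose E hEf hE using M.exists_window
  -- Avoiding the first set forces the visit to be later than `N`. Avoiding the second puts it so
  -- far from the initial set that, after translating the visit into `HA`, the window `F₁ P` is
  -- empty at time `0`.
  obtain ⟨S, hS, hSR, hSF, n, g, hg, hgH⟩ := hcon ((⋃ n ∈ Finset.range N, W n * F₀) ∪
    HA * F₁⁻¹ * W 0 * F₀) (Set.Finite.union
      (Set.Finite.biUnion (Finset.finite_toSet _) fun n _ => (hWf n).mul hF₀)
      (((hHA.mul hF₁.inv).mul (hWf 0)).mul hF₀))
  have hn : N ≤ n := by
    by_contra hn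
    obtain ⟨x, hx, s, hs, rfl⟩ := hW n S g hS hg
    obtain ⟨f, hf, p, hp, rfl⟩ := hSF hs
    refine hgH ⟨x * f, Or.inl ?_, p, hp, by simp [mul_assoc]⟩
    simp only [Set.mem_iUnion]
    exact ⟨n, Finset.mem_range.2 (by omega), Set.mul_mem_mul hx hf⟩
  have hSFA : S ⊆ F * (A : Set Γ) := by
    intro x hx
    obtain ⟨f, hf, p, hp, rfl⟩ := hSF hx
    obtain ⟨f', hf', q, hq, rfl⟩ := hF₀F hf
    exact ⟨f', hf', q * p, A.mul_mem hq (hPA hp), by simp [mul_assoc]⟩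
  obtain ⟨h, hh, m, hm, rfl⟩ := hamb S hS hSR hSFA n g hg
  set S₁ : Set Γ := {x | x * m ∈ S} with hS₁
  have hS₁sep : IsSep M.sep S₁ := hS.shift m
  have hS₁R : IsPer R S₁ := by
    intro x r hr hx
    have : x * r * m = x * m * (m⁻¹ * r * m⁻¹⁻¹) := by group
    change x * r * m ∈ S
    rw [this]
    exact hSR _ _ (hRA _ (A.inv_mem hm) _ hr) hx
  have hg₁ : ¬ M.agree n S₁ ∅ h := by
    rw [M.agree_shift] at hg
    simpa using hg
  set Y : Set Γ := S₁ ∩ (E n * {h}) with hY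
  have hYf : Y.Finite := Set.Finite.inter_of_right ((hEf n).mul (Set.finite_singleton h)) _
  -- The finite part `Y` of the translated set determines the visit at `h`. The subgroup `L` is
  -- chosen so deep that `Y L` is still separated and meets the window `E n * {h}` exactly where
  -- `S₁` does; it is mortal, and visits `h` as `S₁` does.
  obtain ⟨L, hRL, hLP, hLX, hLm⟩ := hL ({x | x ∈ P ∧ x ∉ R} ∩
      (Y⁻¹ * M.sep * Y ∪ Y⁻¹ * (E n * {h})))
    (Set.Finite.inter_of_right (((hYf.inv.mul M.sep_finite).mul hYf).union
      (hYf.inv.mul ((hEf n).mul (Set.finite_singleton h)))) _)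
    (fun x hx => hx.1.1) (fun x hx => hx.1.2)
  have hLR : ∀ x ∈ L, x ∈ Y⁻¹ * M.sep * Y ∪ Y⁻¹ * (E n * {h}) → x ∈ R := fun x hx hx' =>
    by_contra fun hxR => hLX x ⟨⟨hLP hx, hxR⟩, hx'⟩ hx
  have hYP : ∀ y ∈ Y, ∀ p ∈ P, y * p * m ∈ F₀ * (P : Set Γ) := by
    intro y hy p hp
    obtain ⟨f, hf, q, hq, hfq⟩ := hSF hy.1
    refine ⟨f, hf, q * (m⁻¹ * p * m⁻¹⁻¹), P.mul_mem hq (hPn _ (A.inv_mem hm) _ hp), ?_⟩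
    simp only at hfq
    simp only [← mul_assoc, hfq]
    group
  have hTsep : IsSep M.sep (Y * (L : Set Γ)) := by
    rintro _ ⟨y, hy, l, hl, rfl⟩ _ ⟨y', hy', l', hl', rfl⟩ hk
    have hl'' : l' * l⁻¹ ∈ R := by
      refine hLR _ (L.mul_mem hl' (L.inv_mem hl)) (Or.inl ?_)
      exact ⟨y'⁻¹ * (y' * l' * (y * l)⁻¹), ⟨y'⁻¹, by simpa using hy', _, hk, rfl⟩, y, hy,
        by simp only; group⟩
    have := hS₁sep y hy.1 (y' * (l' * l⁻¹)) (hS₁R _ _ hl'' hy'.1)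
      (by simpa [mul_assoc] using hk)
    calc y' * l' = y' * (l' * l⁻¹) * l := by group
      _ = y * l := by rw [this]
  have hTm : ∀ x ∈ Y * (L : Set Γ), x * m ∈ F₀ * (P : Set Γ) := by
    rintro _ ⟨y, hy, l, hl, rfl⟩
    exact hYP y hy l (hLP hl)
  refine ⟨Y * (L : Set Γ), 0, n, hTsep, hn, ?_, ⟨W 0 * Y, (hWf 0).mul hYf, ?_⟩, ?_, h, hh, ?_⟩
  · refine hLm _ hTsep ?_ ⟨Y, hYf, subset_rfl⟩ ?_
    · rintro _ r hr ⟨y, hy, l, hl, rfl⟩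
      exact ⟨y, hy, l * r, L.mul_mem hl hr, by simp [mul_assoc]⟩
    · intro x hx
      obtain ⟨f, hf, p, hp, hfp⟩ := hTm x hx
      obtain ⟨f', hf', q, hq, rfl⟩ := hF₀F hf
      refine ⟨f', hf', q * p * m⁻¹, A.mul_mem (A.mul_mem hq (hPA hp)) (A.inv_mem hm), ?_⟩
      simp only at hfp ⊢
      rw [← mul_inv_eq_iff_eq_mul.2 hfp.symm.symm]
      simp [mul_assoc]
  · intro g hg
    obtain ⟨x, hx, _, ⟨y, hy, l, hl, rfl⟩, rfl⟩ := hW 0 _ g hTsep hg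
    exact ⟨x * y, Set.mul_mem_mul hx hy, l, hLP hl, by simp [mul_assoc]⟩
  · rintro _ ⟨f, hf, p, hp, rfl⟩
    by_contra hg
    obtain ⟨x, hx, t, ht, hxt⟩ := hW 0 _ _ hTsep hg
    obtain ⟨f', hf', q, hq, hfq⟩ := hTm t ht
    simp only at hfq hxt
    refine hgH ⟨h * f⁻¹ * x * f', Or.inr ?_, q * (m⁻¹ * p⁻¹ * m⁻¹⁻¹),
      P.mul_mem hq (hPn _ (A.inv_mem hm) _ (P.inv_mem hp)), ?_⟩
    · exact Set.mul_mem_mul (Set.mul_mem_mul (Set.mul_mem_mul hh (by simpa using hf)) hx) hf'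
    · have : t = x⁻¹ * (f * p) := by rw [← hxt]; group
      calc h * f⁻¹ * x * f' * (q * (m⁻¹ * p⁻¹ * m⁻¹⁻¹))
          = h * f⁻¹ * x * (f' * q) * (m⁻¹ * p⁻¹ * m⁻¹⁻¹) := by group
        _ = h * m := by rw [hfq, this]; group
  · rw [zero_add]
    intro hclose
    refine hg₁ (M.agree_of_close (hE n S₁ (Y * (L : Set Γ)) h hS₁sep hTsep fun k hk => ?_) hclose)
    constructor
    · intro hkS
      exact ⟨k * h, ⟨hkS, ⟨k, hk, h, rfl, rfl⟩⟩, 1, L.one_mem, by simp⟩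
    · rintro ⟨y, hy, l, hl, hyl⟩
      simp only at hyl
      rw [← hyl]
      refine hS₁R _ _ (hLR l hl (Or.inr ⟨y⁻¹, by simpa using hy, k * h,
        ⟨k, hk, h, rfl, rfl⟩, ?_⟩)) hy.1
      simp only [← hyl]; group

end GroupModel
end

/-! ### Infinite cyclic directions as one-dimensional models. -/

section
open scoped Pointwise

namespace GroupModel

variable {Γ : Type u} [Group Γ] (M : GroupModel Γ)

theorem _root_.Subgroup.zpow_conj_mem {R : Subgroup Γ} {c : Γ}
    (hc : c ∈ Subgroup.normalizer (R : Set Γ)) (i : ℤ) {r : Γ} (hr : r ∈ R) :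
    c ^ i * r * c ^ (-i) ∈ R := by
  have := (Subgroup.mem_normalizer_iff.1 (Subgroup.zpow_mem _ hc i) r).1 hr
  simpa [zpow_neg] using this

theorem _root_.Subgroup.mem_sup_zpowers_iff {R : Subgroup Γ} {c : Γ}
    (hc : c ∈ Subgroup.normalizer (R : Set Γ)) {x : Γ} :
    x ∈ R ⊔ Subgroup.zpowers c ↔ ∃ r ∈ R, ∃ i : ℤ, x = r * c ^ i := by
  have hle : Subgroup.zpowers c ≤ Subgroup.normalizer (R : Set Γ) := by
    rwa [Subgroup.zpowers_le]
  rw [← SetLike.mem_coe, Subgroup.coe_mul_of_right_le_normalizer_left _ _ hle]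
  constructor
  · rintro ⟨r, hr, _, ⟨i, rfl⟩, rfl⟩
    exact ⟨r, hr, i, rfl⟩
  · rintro ⟨r, hr, i, rfl⟩
    exact ⟨r, hr, _, ⟨i, rfl⟩, rfl⟩

/-- Because `c` normalizes `R` and has infinite order modulo `R`, an element of the form `r * c ^ i
* r'` determines `i`. -/
theorem exists_exponent_bound {R : Subgroup Γ} {c : Γ}
    (hc : c ∈ Subgroup.normalizer (R : Set Γ)) (hinf : ∀ i : ℤ, c ^ i ∈ R → i = 0)
    {Z : Set Γ} (hZ : Z.Finite) :
    ∃ e : ℕ, ∀ i : ℤ, ∀ r ∈ R, ∀ r' ∈ R, r * c ^ i * r' ∈ Z → -(e : ℤ) ≤ i ∧ i ≤ e := by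
  have huniq : ∀ z : Γ, ∃ j : ℤ, ∀ i : ℤ, ∀ r ∈ R, ∀ r' ∈ R, r * c ^ i * r' = z → i = j := by
    intro z
    by_cases h : ∃ j : ℤ, ∃ r ∈ R, ∃ r' ∈ R, r * c ^ j * r' = z
    · obtain ⟨j, ρ, hρ, ρ', hρ', rfl⟩ := h
      refine ⟨j, fun i r hr r' hr' he => ?_⟩
      have h1 : c ^ (i - j) = r⁻¹ * ρ * (c ^ j * (ρ' * r'⁻¹) * c ^ (-j)) := by
        have : c ^ i = r⁻¹ * (ρ * c ^ j * ρ') * r'⁻¹ := by rw [← he]; group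
        rw [zpow_sub, this, zpow_neg]; group
      have h2 : c ^ (i - j) ∈ R := by
        rw [h1]
        exact R.mul_mem (R.mul_mem (R.inv_mem hr) hρ)
          (Subgroup.zpow_conj_mem hc _ (R.mul_mem hρ' (R.inv_mem hr')))
      have := hinf _ h2
      omega
    · exact ⟨0, fun i r hr r' hr' he => (h ⟨i, r, hr, r', hr', he⟩).elim⟩
  choose j hj using huniq
  refine ⟨hZ.toFinset.sup fun z => (j z).natAbs, fun i r hr r' hr' hz => ?_⟩
  have h1 := hj _ i r hr r' hr' rfl
  have h2 : (j (r * c ^ i * r')).natAbs ≤ hZ.toFinset.sup fun z => (j z).natAbs :=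
    Finset.le_sup (f := fun z => (j z).natAbs) (hZ.mem_toFinset.2 hz)
  rw [← h1] at h2
  omega

theorem _root_.Int.ediv_near {k i i' : ℤ} (hk : 0 < k) (h : i' ≤ i + k) (h' : i ≤ i' + k) :
    i / k - 1 ≤ i' / k ∧ i' / k ≤ i / k + 1 := by
  have h1 := Int.ediv_le_ediv hk h
  have h2 := Int.ediv_le_ediv hk h'
  rw [Int.add_ediv_of_dvd_right (dvd_refl k), Int.ediv_self hk.ne'] at h1 h2
  omega

/-- A set which is periodic and finite modulo `R` is mortal, if the dynamics of such sets is
confined modulo the extension of `R` by an infinite cyclic group. -/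
theorem mortal_of_zpowers {R : Subgroup Γ} {c : Γ}
    (hc : c ∈ Subgroup.normalizer (R : Set Γ)) (hinf : ∀ i : ℤ, c ^ i ∈ R → i = 0)
    {Φ H₀ S : Set Γ} (hΦ : Φ.Finite) (hH₀ : H₀.Finite)
    (hconf : ∀ T, IsSep M.sep T → IsPer R T → T ⊆ Φ * ((R ⊔ Subgroup.zpowers c : Subgroup Γ) : Set Γ)
      → ∀ n g, ¬ M.agree n T ∅ g → g ∈ H₀ * ((R ⊔ Subgroup.zpowers c : Subgroup Γ) : Set Γ))
    (hS : IsSep M.sep S) (hSR : IsPer R S) (hSΦ : S ⊆ Φ * (R : Set Γ)) : M.Mortal S := by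
  have hP : ∀ {x}, x ∈ ((R ⊔ Subgroup.zpowers c : Subgroup Γ) : Set Γ) ↔
    ∃ r ∈ R, ∃ i : ℤ, x = r * c ^ i := Subgroup.mem_sup_zpowers_iff hc
  set P := R ⊔ Subgroup.zpowers c
  -- The thickening ensures that sites outside `H P` are `close` to empty, not merely in agreement
  -- with it.
  set H := H₀ ∪ M.nbhd⁻¹ * H₀ with hH
  have hHf : H.Finite := hH₀.union (M.nbhd_finite.inv.mul hH₀)
  obtain ⟨e, he⟩ := exists_exponent_bound hc hinf
    (Z := (Φ⁻¹ * M.sep * Φ) ∪ ((H⁻¹ * M.nbhd * H) ∪ (Φ⁻¹ * M.window * H)))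
    (((hΦ.inv.mul M.sep_finite).mul hΦ).union
      (((hHf.inv.mul M.nbhd_finite).mul hHf).union ((hΦ.inv.mul M.window_finite).mul hHf)))
  -- Separation conflicts, neighbourhoods and windows involve exponents differing by at most `e`.
  -- With blocks of length `k`, translates of `S` by different powers of `c ^ k` stay separated and
  -- a block is influenced only by its two neighbours.
  set k : ℤ := e + 1 with hk
  have hk0 : 0 < k := by omega
  -- A subset `J` of the line is encoded by one copy of `S` at each `c ^ (k * j)` with `j ∈ J`; the
  -- site `j` of the line is the block `U j`. The claim for `S = T {0}` is then mortality of a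
  -- single cell.
  let T : Set ℤ → Set Γ := fun J => {x | ∃ j ∈ J, x * c ^ (-(k * j)) ∈ S}
  let U : ℤ → Set Γ := fun j => {g | ∃ h ∈ H, ∃ r ∈ R, ∃ i : ℤ, i / k = j ∧ g = h * r * c ^ i}
  have hTmem : ∀ {J x}, x ∈ T J → ∃ f ∈ Φ, ∃ r ∈ R, ∃ j ∈ J, x = f * r * c ^ (k * j) := by
    rintro J x ⟨j, hj, hx⟩
    obtain ⟨f, hf, r, hr, hfr⟩ := hSΦ hx
    refine ⟨f, hf, r, hr, j, hj, ?_⟩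
    simp only at hfr
    rw [hfr, zpow_neg]; group
  have hTsep : ∀ J, IsSep M.sep (T J) := by
    rintro J x ⟨j, hj, hx⟩ x' ⟨j', hj', hx'⟩ hxx
    obtain ⟨f, hf, r, hr, hfr⟩ := hSΦ hx
    obtain ⟨f', hf', r', hr', hfr'⟩ := hSΦ hx'
    simp only at hfr hfr'
    have hx1 : x = f * r * c ^ (k * j) := by rw [hfr, zpow_neg]; group
    have hx1' : x' = f' * r' * c ^ (k * j') := by rw [hfr', zpow_neg]; group
    have hb := he (k * (j' - j)) r' hr' r⁻¹ (R.inv_mem hr) (Or.inl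
      ⟨f'⁻¹ * (x' * x⁻¹), ⟨f'⁻¹, by simpa using hf', _, hxx, rfl⟩, f, hf, by
        simp only [hx1, hx1', mul_sub, zpow_sub]; group⟩)
    have hjj : j' = j := by
      by_contra hne
      rcases lt_or_gt_of_ne hne with h | h
      · nlinarith
      · nlinarith
    subst hjj
    exact mul_right_cancel (hS _ hx _ hx' (by simpa [mul_assoc] using hxx))
  have hTR : ∀ J, IsPer R (T J) := by
    rintro J x r hr ⟨j, hj, hx⟩
    refine ⟨j, hj, ?_⟩
    have : x * r * c ^ (-(k * j)) =
        x * c ^ (-(k * j)) * (c ^ (k * j) * r * c ^ (-(k * j))) := by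
      rw [zpow_neg]; group
    rw [this]
    exact hSR _ _ (Subgroup.zpow_conj_mem hc _ hr) hx
  have hconfT : ∀ J n g, ¬ M.agree n (T J) ∅ g → g ∈ H₀ * (P : Set Γ) := by
    refine fun J => hconf _ (hTsep J) (hTR J) fun x hx => ?_
    obtain ⟨f, hf, r, hr, j, hj, rfl⟩ := hTmem hx
    exact ⟨f, hf, r * c ^ (k * j), hP.2 ⟨r, hr, _, rfl⟩, by simp [mul_assoc]⟩
  have hout : ∀ J n g, g ∉ H * (P : Set Γ) → M.close n (T J) ∅ g := by
    intro J n g hg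
    refine (M.step fun b hb => ?_).1
    by_contra hn
    obtain ⟨h, hh, p, hp, hhp⟩ := hconfT J n _ hn
    refine hg ⟨b⁻¹ * h, Or.inr ⟨b⁻¹, by simpa using hb, h, hh, rfl⟩, p, hp, ?_⟩
    simp only at hhp ⊢
    rw [mul_assoc, hhp]; group
  have hTe : T ∅ = ∅ := by ext x; simp [T]
  have hin : ∀ g ∈ H * (P : Set Γ), ∃ h ∈ H, ∃ r ∈ R, ∃ i : ℤ, g = h * r * c ^ i := by
    rintro _ ⟨h, hh, p, hp, rfl⟩
    obtain ⟨r, hr, i, rfl⟩ := hP.1 hp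
    exact ⟨h, hh, r, hr, i, by simp [mul_assoc]⟩
  have hUfin : ∀ s t : ℤ, ∃ Y : Set Γ, Y.Finite ∧
      ∀ j, s ≤ j → j ≤ t → U j ⊆ Y * (R : Set Γ) := by
    intro s t
    refine ⟨H * ((fun i : ℤ => c ^ i) '' Set.Icc (k * s) (k * t + k)),
      hHf.mul ((Set.finite_Icc _ _).image _), ?_⟩
    rintro j hs ht _ ⟨h, hh, r, hr, i, rfl, rfl⟩
    refine ⟨h * c ^ i, ⟨h, hh, c ^ i, ⟨i, ⟨?_, ?_⟩, rfl⟩, rfl⟩,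
      c ^ (-i) * r * c ^ (- -i), Subgroup.zpow_conj_mem hc _ hr, ?_⟩
    · have := Int.mul_ediv_add_emod i k
      have := Int.emod_nonneg i hk0.ne'
      nlinarith
    · have := Int.mul_ediv_add_emod i k
      have := Int.emod_lt_of_pos i hk0
      nlinarith
    · simp only [zpow_neg]; group
  have hTshift : ∀ (J : Set ℤ) (d : ℤ), {x | x * c ^ (k * d) ∈ T J} = T {x | x + d ∈ J} := by
    intro J d
    ext x
    constructor
    · rintro ⟨j, hj, hx⟩
      refine ⟨j - d, by simpa using hj, ?_⟩
      convert hx using 1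
      rw [mul_assoc, ← zpow_add]; congr 2; ring
    · rintro ⟨j, hj, hx⟩
      refine ⟨j + d, hj, ?_⟩
      convert hx using 1
      rw [mul_assoc, ← zpow_add]; congr 2; ring
  have hUshift : ∀ g j d, g * c ^ (k * d) ∈ U (j + d) ↔ g ∈ U j := by
    intro g j d
    constructor
    · rintro ⟨h, hh, r, hr, i, hi, hg⟩
      refine ⟨h, hh, r, hr, i - k * d, ?_, ?_⟩
      · have : i - k * d = i + k * (-d) := by ring
        rw [this, Int.add_mul_ediv_left _ _ hk0.ne', hi]; ring
      · rw [zpow_sub, ← mul_assoc, ← hg]; group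
    · rintro ⟨h, hh, r, hr, i, hi, rfl⟩
      refine ⟨h, hh, r, hr, i + k * d, ?_, ?_⟩
      · rw [Int.add_mul_ediv_left _ _ hk0.ne', hi]
      · rw [zpow_add]; group
  let L : LineModel :=
  { agree := fun n J J' j => ∀ g ∈ U j, M.agree n (T J) (T J') g
    close := fun n J J' j => ∀ g ∈ U j, M.close n (T J) (T J') g
    close_refl := fun n J j g _ => M.close_refl _ _ _
    close_symm := fun h g hg => M.close_symm (h g hg)
    agree_of_close := fun h h' g hg => M.agree_of_close (h g hg) (h' g hg)
    init := by
      rintro J J' j hJ g ⟨h, hh, r, hr, i, rfl, rfl⟩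
      refine M.init (hTsep _) (hTsep _) fun y hy => ?_
      have key : ∀ j, y * (h * r * c ^ i) * c ^ (-(k * j)) ∈ S → i / k - 1 ≤ j ∧ j ≤ i / k + 1 := by
        intro j' hj'
        obtain ⟨f, hf, r', hr', hfr⟩ := hSΦ hj'
        simp only at hfr
        have hb := he (k * j' - i) r' hr' r⁻¹ (R.inv_mem hr) (Or.inr (Or.inr
          ⟨f⁻¹ * y, ⟨f⁻¹, by simpa using hf, y, hy, rfl⟩, h, hh, by
            have : f⁻¹ * y * h = r' * c ^ (k * j') * (r * c ^ i)⁻¹ := by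
              have h1 : r' = f⁻¹ * (y * (h * r * c ^ i) * c ^ (-(k * j'))) := by
                rw [← hfr]; group
              rw [h1, zpow_neg]; group
            simp only [this, zpow_sub]; group⟩))
        have := Int.ediv_near (i := i) (i' := k * j') hk0 (by omega) (by omega)
        rwa [Int.mul_ediv_cancel_left _ hk0.ne'] at this
      constructor
      · rintro ⟨j, hj, hx⟩
        exact ⟨j, (hJ j (key j hx).1 (key j hx).2).1 hj, hx⟩
      · rintro ⟨j, hj, hx⟩
        exact ⟨j, (hJ j (key j hx).1 (key j hx).2).2 hj, hx⟩
    step := by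
      intro n J J' j hJ
      suffices h : ∀ g ∈ U j, ∀ b ∈ M.nbhd, M.agree n (T J) (T J') (b * g) from
        ⟨fun g hg => (M.step (h g hg)).1, fun g hg => (M.step (h g hg)).2⟩
      rintro g ⟨h, hh, r, hr, i, rfl, rfl⟩ b hb
      by_cases hbg : b * (h * r * c ^ i) ∈ H * (P : Set Γ)
      · obtain ⟨h', hh', r', hr', i', hi'⟩ := hin _ hbg
        have hbd := he (i' - i) r' hr' r⁻¹ (R.inv_mem hr) (Or.inr (Or.inl
          ⟨h'⁻¹ * b, ⟨h'⁻¹, by simpa using hh', b, hb, rfl⟩, h, hh, by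
            have : h'⁻¹ * b * h = h'⁻¹ * (b * (h * r * c ^ i)) * (r * c ^ i)⁻¹ := by group
            simp only [this, hi', zpow_sub]; group⟩))
        have := Int.ediv_near (i := i) (i' := i') hk0 (by omega) (by omega)
        exact hJ (i' / k) this.1 this.2 _ ⟨h', hh', r', hr', i', rfl, hi'⟩
      · exact M.agree_of_close (hout J n _ hbg) (M.close_symm (hout J' n _ hbg))
    agree_shift := by
      intro n J J' j d
      constructor
      · intro h g hg
        have := h (g * c ^ (k * d)) ((hUshift g j d).2 hg)
        rwa [M.agree_shift, hTshift, hTshift] at this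
      · intro h g hg
        have hg' : g = g * c ^ (-(k * d)) * c ^ (k * d) := by rw [zpow_neg]; group
        have := h (g * c ^ (-(k * d))) ((hUshift _ j d).1 (by rwa [← hg']))
        rw [← hTshift, ← hTshift, ← M.agree_shift] at this
        rwa [hg']
    eventually_close := by
      intro J j
      obtain ⟨Y, hY, hYU⟩ := hUfin j j
      obtain ⟨N, hN⟩ := M.eventually_close_of_per (hTR J) hY
      refine ⟨N, fun n hn g hg => ?_⟩
      rw [hTe]
      exact hN n hn g (hYU j le_rfl le_rfl hg)
    not_nested := by
      intro hnest
      simp only [hTe] at hnest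
      obtain ⟨Y, hY, hYU⟩ := hUfin (-1) 1
      refine M.not_nested R Y hY fun F N hF => ?_
      -- Inside `H P`, the set `F R` meets only blocks with index at most `d + 1` in absolute value.
      obtain ⟨d, hd⟩ := exists_exponent_bound hc hinf (hHf.inv.mul hF)
      obtain ⟨J, τ, n, hn, ⟨m, hm⟩, ⟨D', hD'⟩, hD, j, hj1, hj2, hj⟩ := hnest (d + 1) N
      have hall : ∀ n, (∀ j, ∀ g ∈ U j, M.agree n (T J) ∅ g) → ∀ g, M.agree n (T J) ∅ g := by
        intro n hn g
        by_cases hg : g ∈ H * (P : Set Γ)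
        · obtain ⟨h, hh, r, hr, i, hi⟩ := hin g hg
          exact hn _ g ⟨h, hh, r, hr, i, rfl, hi⟩
        · exact M.agree_of_close' (hout J n g hg)
      refine ⟨T J, τ, n, hTsep J, hn, ⟨m, hall m hm⟩, ?_, ?_, ?_⟩
      · obtain ⟨Y', hY', hYU'⟩ := hUfin (-D') D'
        refine ⟨Y', hY', fun g hg => ?_⟩
        have hgH : g ∈ H * (P : Set Γ) := by
          by_contra hgH
          exact hg (M.agree_of_close' (hout J τ g hgH))
        obtain ⟨h, hh, r, hr, i, hi⟩ := hin g hgH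
        have hgU : g ∈ U (i / k) := ⟨h, hh, r, hr, i, rfl, hi⟩
        have : ¬ (i / k < -D' ∨ D' < i / k) := fun hlt => hg (hD' _ hlt g hgU)
        exact hYU' (i / k) (by omega) (by omega) hgU
      · rintro _ ⟨f, hf, ρ, hρ, rfl⟩
        by_cases hgH : f * ρ ∈ H * (P : Set Γ)
        · obtain ⟨h, hh, r, hr, i, hi⟩ := hin _ hgH
          have hb := hd i r hr ρ⁻¹ (R.inv_mem hρ) ⟨h⁻¹, by simpa using hh, f, hf, by
            have : f = h * r * c ^ i * ρ⁻¹ := by rw [← hi]; group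
            simp only; rw [this]; group⟩
          have h1 : i / k ≤ d + 1 := by
            have := Int.ediv_le_ediv hk0 hb.2
            have := Int.ediv_le_self (a := (d : ℤ)) k (by omega)
            omega
          have h2 : -(d + 1 : ℤ) ≤ i / k := by
            rw [Int.le_ediv_iff_mul_le hk0]
            nlinarith
          exact hD (i / k) (by push_cast; omega) (by push_cast; omega) _
            ⟨h, hh, r, hr, i, rfl, hi⟩
        · exact M.agree_of_close' (hout J τ _ hgH)
      · push Not at hj
        obtain ⟨g, hg, hgc⟩ := hj
        obtain ⟨y, hy, r, hr, rfl⟩ := hYU j hj1 hj2 hg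
        exact ⟨y, hy, fun h => hgc ((M.close_per (hTR J) hr).2 h)⟩ }
  obtain ⟨m, hm⟩ := L.mortal_singleton
  refine ⟨m, fun g => ?_⟩
  have hT0 : T {0} = S := by ext x; simp [T]
  by_cases hg : g ∈ H * (P : Set Γ)
  · obtain ⟨h, hh, r, hr, i, hi⟩ := hin g hg
    have := hm (i / k) g ⟨h, hh, r, hr, i, rfl, hi⟩
    rwa [hT0, hTe] at this
  · have := M.agree_of_close' (hout {0} m g hg)
    rwa [hT0] at this

end GroupModel
end

/-! ### Abelian layers and descent along the derived series. -/

section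
open scoped Pointwise

theorem Group.exists_normal_finiteIndex_avoiding {Γ : Type u} [Group Γ] [Group.ResiduallyFinite Γ]
    {X : Set Γ} (hX : X.Finite) :
    ∃ K : Subgroup Γ, K.Normal ∧ K.FiniteIndex ∧ ∀ x ∈ X, x ≠ 1 → x ∉ K := by
  have hex : ∀ x : Γ, ∃ K : Subgroup Γ, K.Normal ∧ K.FiniteIndex ∧ (x ≠ 1 → x ∉ K) := by
    intro x
    by_cases hx : x = 1
    · exact ⟨⊤, inferInstance, inferInstance, fun h => (h hx).elim⟩
    · obtain ⟨K, hK⟩ := Group.exists_finiteIndexNormalSubgroup_notMem x hx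
      exact ⟨K.toSubgroup, inferInstance, inferInstance, fun _ => hK⟩
  choose k hkn hkf hk using hex
  have := hX.fintype
  exact ⟨⨅ x : X, k x, Subgroup.normal_iInf_normal fun x => hkn x,
    Subgroup.finiteIndex_iInf fun x => hkf x,
    fun x hx hx1 hmem => hk x hx1 (Subgroup.mem_iInf.1 hmem ⟨x, hx⟩)⟩

namespace GroupModel

variable {Γ : Type u} [Group Γ] (M : GroupModel Γ)

theorem _root_.Subgroup.mem_normalizer_of_commutator {R Q A : Subgroup Γ} (hRQ : R ≤ Q)
    (hQA : Q ≤ A) (hcomm : ∀ x ∈ A, ∀ y ∈ A, x * y * x⁻¹ * y⁻¹ ∈ R) {x : Γ} (hx : x ∈ A) :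
    x ∈ Subgroup.normalizer (Q : Set Γ) := by
  have key : ∀ x ∈ A, ∀ q ∈ Q, x * q * x⁻¹ ∈ Q := fun x hx q hq => by
    have := Q.mul_mem (hRQ (hcomm x hx q (hQA hq))) hq
    simpa [mul_assoc] using this
  refine Subgroup.mem_normalizer_iff.2 fun q => ⟨key x hx q, fun h => ?_⟩
  have := key x⁻¹ (A.inv_mem hx) _ h
  simpa [mul_assoc] using this

theorem _root_.Subgroup.sup_zpowers_subset {Q : Subgroup Γ} {c : Γ}
    (hc : c ∈ Subgroup.normalizer (Q : Set Γ)) {k : ℤ} (hk : 0 < k) :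
    ∃ Φ : Set Γ, Φ.Finite ∧ ((Q ⊔ Subgroup.zpowers c : Subgroup Γ) : Set Γ) ⊆
      Φ * ((Q ⊔ Subgroup.zpowers (c ^ k) : Subgroup Γ) : Set Γ) := by
  refine ⟨(fun i : ℤ => c ^ i) '' Set.Icc 0 k, (Set.finite_Icc _ _).image _, fun x hx => ?_⟩
  obtain ⟨q, hq, i, rfl⟩ := (Subgroup.mem_sup_zpowers_iff hc).1 hx
  refine ⟨c ^ (i % k), ⟨i % k, ⟨Int.emod_nonneg _ hk.ne', (Int.emod_lt_of_pos _ hk).le⟩, rfl⟩,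
    c ^ (-(i % k)) * q * c ^ (- -(i % k)) * (c ^ k) ^ (i / k),
    mul_mem ((le_sup_left : Q ≤ _) (Subgroup.zpow_conj_mem hc _ hq))
      ((le_sup_right : Subgroup.zpowers (c ^ k) ≤ _) ⟨_, rfl⟩), ?_⟩
  have : c ^ i = c ^ (i % k) * (c ^ k) ^ (i / k) := by
    rw [← zpow_mul, ← zpow_add, Int.emod_add_mul_ediv]
  simp only [this, zpow_neg, inv_inv]
  group

theorem _root_.Subgroup.sup_closure_insert (R : Subgroup Γ) (c : Γ) (C : Set Γ) :
    R ⊔ Subgroup.closure (insert c C) = R ⊔ Subgroup.closure C ⊔ Subgroup.zpowers c := by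
  rw [Set.insert_eq, Subgroup.closure_union, ← Subgroup.zpowers_eq_closure, sup_assoc,
    sup_comm (Subgroup.zpowers c)]

/-- If the dynamics of sets inside `F A` is confined to `H A` and `A` is finitely generated abelian
modulo `R`, then sets inside `F A` which are periodic and finite modulo `R` are mortal. -/
theorem mortal_of_abelian {A : Subgroup Γ} {F HA : Set Γ} (hHA : HA.Finite)
    (hconf : ∀ S, IsSep M.sep S → S ⊆ F * (A : Set Γ) → ∀ n g, ¬ M.agree n S ∅ g →
      g ∈ HA * (A : Set Γ)) {C : Set Γ} (hC : C.Finite) :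
    ∀ R : Subgroup Γ, R ≤ A → (∀ x ∈ A, ∀ y ∈ A, x * y * x⁻¹ * y⁻¹ ∈ R) → C ⊆ (A : Set Γ) →
      (∃ Φ : Set Γ, Φ.Finite ∧
        (A : Set Γ) ⊆ Φ * ((R ⊔ Subgroup.closure C : Subgroup Γ) : Set Γ)) →
      ∀ S, IsSep M.sep S → IsPer R S → (∃ Φ : Set Γ, Φ.Finite ∧ S ⊆ Φ * (R : Set Γ)) →
        S ⊆ F * (A : Set Γ) → M.Mortal S := by
  induction C, hC using Set.Finite.induction_on with
  | empty =>
    rintro R hRA hcomm - ⟨Φ, hΦ, hA⟩ S hS hSR - hSF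
    simp only [Subgroup.closure_empty, bot_le, sup_of_le_left] at hA
    refine M.mortal_of_confined hSR (hHA.mul hΦ) fun n g hg => ?_
    obtain ⟨h, hh, x, hx, rfl⟩ := hconf S hS hSF n g hg
    rw [mul_assoc]
    exact Set.mul_mem_mul hh (hA hx)
  | @insert c C hcC hC ih =>
    rintro R hRA hcomm hCA ⟨Φ, hΦ, hA⟩ S hS hSR ⟨Φ', hΦ', hSΦ'⟩ hSF
    have hcA : c ∈ A := hCA (Set.mem_insert _ _)
    have hCA' : C ⊆ (A : Set Γ) := (Set.subset_insert _ _).trans hCA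
    rw [Subgroup.sup_closure_insert] at hA
    have hQA : R ⊔ Subgroup.closure C ≤ A := sup_le hRA ((Subgroup.closure_le _).2 hCA')
    have hcQ := Subgroup.mem_normalizer_of_commutator le_sup_left hQA hcomm hcA
    have hcR := Subgroup.mem_normalizer_of_commutator le_rfl hRA hcomm hcA
    have hAk : ∀ k : ℤ, 0 < k → ∃ Φ : Set Γ, Φ.Finite ∧ (A : Set Γ) ⊆
        Φ * ((R ⊔ Subgroup.closure C ⊔ Subgroup.zpowers (c ^ k) : Subgroup Γ) : Set Γ) := by
      intro k hk
      obtain ⟨Ψ, hΨ, hΨQ⟩ := Subgroup.sup_zpowers_subset hcQ hk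
      refine ⟨Φ * Ψ, hΦ.mul hΨ, fun x hx => ?_⟩
      obtain ⟨y, hy, z, hz, rfl⟩ := hA hx
      rw [mul_assoc]
      exact Set.mul_mem_mul hy (hΨQ hz)
    -- If `c` has finite order modulo `R`, the other generators already generate a subgroup over
    -- which `A` is finite, and `c` can be dropped.
    by_cases hfin : ∃ k : ℤ, 0 < k ∧ c ^ k ∈ R
    · obtain ⟨k, hk, hkR⟩ := hfin
      refine ih R hRA hcomm hCA' ?_ S hS hSR ⟨Φ', hΦ', hSΦ'⟩ hSF
      have := hAk k hk
      rwa [sup_eq_left.2 ((Subgroup.zpowers_le.2 hkR).trans le_sup_left)] at this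
    · push Not at hfin
      have hinf : ∀ i : ℤ, c ^ i ∈ R → i = 0 := by
        intro i hi
        by_contra hne
        rcases lt_or_gt_of_ne hne with h | h
        · exact hfin (-i) (by omega) (by rw [zpow_neg]; exact R.inv_mem hi)
        · exact hfin i h hi
      have hckA : ∀ k : ℤ, R ⊔ Subgroup.zpowers (c ^ k) ≤ A := fun k =>
        sup_le hRA (Subgroup.zpowers_le.2 (A.zpow_mem hcA k))
      have hP : R ⊔ Subgroup.zpowers c ≤ A := by simpa using hckA 1
      have hnorm : ∀ Q : Subgroup Γ, R ≤ Q → Q ≤ A → ∀ x ∈ A, ∀ r ∈ Q, x * r * x⁻¹ ∈ Q :=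
        fun Q hRQ hQA x hx r => (Subgroup.mem_normalizer_iff.1
          (Subgroup.mem_normalizer_of_commutator hRQ hQA hcomm hx) r).1
      have hΨ : (Φ' ∩ (F * (A : Set Γ))).Finite := hΦ'.inter_of_left _
      have hSΨ : S ⊆ (Φ' ∩ (F * (A : Set Γ))) * (R : Set Γ) := by
        intro x hx
        obtain ⟨y, hy, r, hr, hyr⟩ := hSΦ' hx
        obtain ⟨f, hf, z, hz, hfz⟩ := hSF hx
        refine ⟨y, ⟨hy, f, hf, z * r⁻¹, A.mul_mem hz (A.inv_mem (hRA hr)), ?_⟩, r, hr, hyr⟩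
        simp only at hfz hyr ⊢
        rw [← mul_assoc, hfz, ← hyr]; group
      -- The deep subgroups are generated by `R` and a high power of `c`. Modulo these `c` is
      -- torsion, so the induction hypothesis applies with one generator fewer; the exponent is
      -- taken beyond all those occurring in `X`.
      obtain ⟨H, hH, hconfH⟩ := M.exists_confinement (P := R ⊔ Subgroup.zpowers c) hP
        (hnorm R le_rfl hRA) (hnorm _ le_sup_left hP) hΨ hHA Set.inter_subset_right
        (fun S hS _ => hconf S hS) (by
          intro X hX hXP hXR
          obtain ⟨e, he⟩ := exists_exponent_bound hcR hinf hX
          refine ⟨R ⊔ Subgroup.zpowers (c ^ (e + 1 : ℤ)), le_sup_left, sup_le le_sup_left ?_, ?_,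
            ih _ (hckA _) (fun x hx y hy => (le_sup_left : R ≤ _) (hcomm x hx y hy)) hCA' ?_⟩
          · exact (Subgroup.zpowers_le.2 (Subgroup.zpow_mem_zpowers _ _)).trans le_sup_right
          · intro x hx hxL
            obtain ⟨r, hr, i, rfl⟩ := (Subgroup.mem_sup_zpowers_iff
              (Subgroup.mem_normalizer_of_commutator le_rfl hRA hcomm (A.zpow_mem hcA _))).1 hxL
            rw [← zpow_mul] at hx hxL
            have hb := he _ r hr 1 R.one_mem (by simpa using hx)
            have hi : i = 0 := by
              by_contra hne
              rcases lt_or_gt_of_ne hne with h | h <;> nlinarith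
            subst hi
            exact hXR _ hx (by simpa using hr)
          · have := hAk (e + 1) (by omega)
            rwa [sup_right_comm] at this)
      exact M.mortal_of_zpowers hcR hinf hΨ hH hconfH hS hSR hSΨ

theorem _root_.Subgroup.exists_finite_cover (K : Subgroup Γ) [K.FiniteIndex] (Y : Set Γ) :
    ∃ Φ : Set Γ, Φ.Finite ∧ Φ ⊆ Y ∧ ∀ y ∈ Y, ∃ p ∈ Φ, p⁻¹ * y ∈ K := by
  have hch : ∀ q : Γ ⧸ K, ∃ p : Γ, (∃ y ∈ Y, (y : Γ ⧸ K) = q) → p ∈ Y ∧ (p : Γ ⧸ K) = q := by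
    intro q
    by_cases h : ∃ y ∈ Y, (y : Γ ⧸ K) = q
    · obtain ⟨y, hy, hq⟩ := h
      exact ⟨y, fun _ => ⟨hy, hq⟩⟩
    · exact ⟨1, fun h' => (h h').elim⟩
  choose p hp using hch
  have hfin : (Set.univ : Set (Γ ⧸ K)).Finite := Set.toFinite _
  refine ⟨p '' {q | ∃ y ∈ Y, (y : Γ ⧸ K) = q}, (hfin.subset (Set.subset_univ _)).image p, ?_, ?_⟩
  · rintro _ ⟨q, hq, rfl⟩
    exact (hp q hq).1
  · intro y hy
    refine ⟨p y, ⟨y, ⟨y, hy, rfl⟩, rfl⟩, ?_⟩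
    exact QuotientGroup.eq.1 (hp y ⟨y, hy, rfl⟩).2

/-- Sets which are periodic and finite modulo `N ⊓ K` are mortal for all `K` of finite index. -/
def MortalModulo (N : Subgroup Γ) : Prop :=
  ∀ K : Subgroup Γ, K.Normal → K.FiniteIndex → ∀ S, IsSep M.sep S → IsPer (N ⊓ K) S →
    (∃ Φ : Set Γ, Φ.Finite ∧ S ⊆ Φ * ((N ⊓ K : Subgroup Γ) : Set Γ)) → M.Mortal S

/-- The whole group is finite modulo `N ⊓ K`, so confinement is automatic. -/
theorem mortalModulo_of_finiteIndex (N : Subgroup Γ) [N.FiniteIndex] : M.MortalModulo N := by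
  intro K _ hK S hS hSK _
  obtain ⟨Φ, hΦ, -, h⟩ := Subgroup.exists_finite_cover (N ⊓ K) Set.univ
  refine M.mortal_of_confined hSK hΦ fun n g _ => ?_
  obtain ⟨p, hp, hpg⟩ := h g trivial
  exact ⟨p, hp, p⁻¹ * g, hpg, by simp⟩

/-- Mortality modulo the subgroups `N ⊓ K'` confines finite configurations to the cosets of `N`.
Inside `N ⊓ K` only finitely many transition elements occur, so the dynamics lives in a subgroup
that is finitely generated, and abelian modulo `⁅N, N⁆ ⊓ K`. -/
theorem MortalModulo.commutator [Group.ResiduallyFinite Γ] {N : Subgroup Γ} [N.Normal]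
    (hN : M.MortalModulo N) : M.MortalModulo ⁅N, N⁆ := by
  intro K hKn hK S hS hSL ⟨F, hF, hSF⟩
  set L := ⁅N, N⁆ ⊓ K with hL
  have hNN : ⁅N, N⁆ ≤ N := Subgroup.commutator_le_left N N
  -- With `A = ⊤` the ambient confinement is vacuous; residual finiteness provides the deep
  -- subgroups `N ⊓ K'` avoiding a finite set.
  obtain ⟨H, hH, hconf⟩ := M.exists_confinement (R := ⊥) (P := N) (A := ⊤) (F := {1}) (F₀ := F)
    (HA := {1}) le_top (by simp)
    (fun x _ r hr => Subgroup.Normal.conj_mem inferInstance r hr x) hF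
    (Set.finite_singleton _) (fun x _ => ⟨1, rfl, x, trivial, by simp⟩)
    (fun _ _ _ _ _ x _ => ⟨1, rfl, x, trivial, by simp⟩) (by
      intro X hX hXN hX1
      obtain ⟨K', hno, hfi, hK'⟩ := Group.exists_normal_finiteIndex_avoiding hX
      exact ⟨N ⊓ K', bot_le, inf_le_left,
        fun x hx hxk => hK' x hx (fun h => hX1 x hx (by simp [h])) hxk.2,
        fun S hS hSL hSF _ => hN _ hno hfi S hS hSL hSF⟩)
  obtain ⟨Φ, hΦ, hΦN, hΦK⟩ := Subgroup.exists_finite_cover K (N : Set Γ)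
  set P := N ⊓ K with hP
  obtain ⟨W, hW, hWS⟩ := M.exists_spread 0
  set H₁ := H * Φ ∪ W * F with hH₁
  have hH₁f : H₁.Finite := (hH.mul hΦ).union (hW.mul hF)
  have hbot : ∀ T : Set Γ, IsPer ⊥ T := by
    intro T x r hr hx
    rw [Subgroup.mem_bot] at hr
    simpa [hr] using hx
  have hconfP : ∀ T, IsSep M.sep T → T ⊆ F * (P : Set Γ) → ∀ n g, ¬ M.agree n T ∅ g →
      g ∈ H₁ * (P : Set Γ) := by
    intro T hT hTP n g hg
    obtain ⟨h, hh, m, hm, rfl⟩ := hconf T hT (hbot T)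
      (hTP.trans (Set.mul_subset_mul_left fun x hx => hx.1)) n g hg
    obtain ⟨p, hp, hpm⟩ := hΦK m hm
    exact ⟨h * p, Or.inl (Set.mul_mem_mul hh hp), p⁻¹ * m,
      ⟨N.mul_mem (N.inv_mem (hΦN hp)) hm, hpm⟩, by simp [mul_assoc]⟩
  -- The elements of `P` by which a live site can move in one step, relative to the representatives
  -- in `H₁`. By induction on time, configurations in `F A` stay in `H₁ A`.
  set C : Set Γ := (H₁⁻¹ * M.nbhd⁻¹ * H₁) ∩ P with hC
  have hCf : C.Finite := ((hH₁f.inv.mul M.nbhd_finite.inv).mul hH₁f).inter_of_left _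
  set A := L ⊔ Subgroup.closure C with hA
  have hLP : L ≤ P := inf_le_inf_right _ hNN
  have hAP : A ≤ P := sup_le hLP ((Subgroup.closure_le _).2 Set.inter_subset_right)
  have hconfA : ∀ T, IsSep M.sep T → T ⊆ F * (A : Set Γ) → ∀ n g, ¬ M.agree n T ∅ g →
      g ∈ H₁ * (A : Set Γ) := by
    intro T hT hTA n
    induction n with
    | zero =>
      intro g hg
      obtain ⟨x, hx, t, ht, rfl⟩ := hWS T g hT hg
      obtain ⟨f, hf, y, hy, rfl⟩ := hTA ht
      exact ⟨x * f, Or.inr (Set.mul_mem_mul hx hf), y, hy, by simp [mul_assoc]⟩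
    | succ n ih =>
      intro g hg
      obtain ⟨h, hh, m, hm, rfl⟩ := hconfP T hT
        (hTA.trans (Set.mul_subset_mul_left hAP)) (n + 1) g hg
      have : ∃ b ∈ M.nbhd, ¬ M.agree n T ∅ (b * (h * m)) := by
        by_contra hn
        push Not at hn
        exact hg (M.agree_of_close' (M.step hn).2)
      obtain ⟨b, hb, hbg⟩ := this
      obtain ⟨h', hh', y, hy, hhy⟩ := ih _ hbg
      simp only at hhy
      have hmy : m * y⁻¹ = h⁻¹ * b⁻¹ * h' := by
        have : h' = b * (h * m) * y⁻¹ := by rw [← hhy]; group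
        rw [this]; group
      have hmC : m * y⁻¹ ∈ C := by
        refine ⟨?_, P.mul_mem hm (P.inv_mem (hAP hy))⟩
        rw [hmy]
        exact Set.mul_mem_mul (Set.mul_mem_mul (by simpa using hh) (by simpa using hb)) hh'
      have hmA : m * y⁻¹ * y ∈ A := A.mul_mem
        ((le_sup_right : _ ≤ A) (Subgroup.subset_closure hmC)) hy
      exact ⟨h, hh, m, by simpa using hmA, rfl⟩
  refine M.mortal_of_abelian hH₁f hconfA hCf L le_sup_left ?_ ?_ ?_ S hS hSL ⟨F, hF, hSF⟩
    (hSF.trans (Set.mul_subset_mul_left fun x hx => (le_sup_left : L ≤ A) hx))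
  · intro x hx y hy
    have hx' := hAP hx
    have hy' := hAP hy
    refine ⟨Subgroup.commutator_mem_commutator hx'.1 hy'.1, ?_⟩
    exact K.mul_mem (K.mul_mem (K.mul_mem hx'.2 hy'.2) (K.inv_mem hx'.2)) (K.inv_mem hy'.2)
  · exact fun x hx => (le_sup_right : _ ≤ A) (Subgroup.subset_closure hx)
  · exact ⟨{1}, Set.finite_singleton _, fun x hx => ⟨1, rfl, x, hx, by simp⟩⟩

/-- Starting from the normal core of the solvable subgroup, iterated commutators remain normal and
lie below the derived series, hence become trivial. -/
theorem mortal_singleton_one [Group.ResiduallyFinite Γ] (hΓ : IsVirtuallySolvable Γ) :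
    M.Mortal {1} := by
  obtain ⟨H, hH, hsol⟩ := hΓ
  have hN : ∀ n, ∃ N : Subgroup Γ, N.Normal ∧ M.MortalModulo N ∧
      N ≤ (derivedSeries H n).map H.subtype := by
    intro n
    induction n with
    | zero =>
      exact ⟨H.normalCore, H.normalCore_normal, M.mortalModulo_of_finiteIndex _, by
        simpa [← MonoidHom.range_eq_map] using H.normalCore_le⟩
    | succ n ih =>
      obtain ⟨N, h1, h2, h3⟩ := ih
      refine ⟨⁅N, N⁆, inferInstance, h2.commutator, ?_⟩
      rw [derivedSeries_succ, Subgroup.map_commutator]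
      exact Subgroup.commutator_mono h3 h3
  obtain ⟨n, hn⟩ := hsol
  obtain ⟨N, -, hm, hle⟩ := hN n
  rw [hn, Subgroup.map_bot, le_bot_iff] at hle
  subst hle
  refine hm ⊤ inferInstance inferInstance {1} ?_ ?_ ⟨{1}, Set.finite_singleton _, ?_⟩
  · rintro _ rfl _ rfl _
    rfl
  · intro x r hr hx
    have : r = 1 := by simpa using hr
    simpa [this] using hx
  · rintro _ rfl
    exact ⟨1, rfl, 1, Subgroup.one_mem _, by simp⟩

end GroupModel
end

/-! ### Superposition of orbits -/

section
open scoped Pointwise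

/-- An expansive system in which points of the set `base` can be glued, together with the
positions `pos n x` of its points under an asymptotically nilpotent map. -/
structure Arena (Γ : Type c) [Group Γ] (P : Type a) [MulAction Γ P] (Z : Type a)
    [MetricSpace Z] where
  pos : ℕ → P → Z
  zero : P
  base : Set P
  Δ : ℝ
  Δ_pos : 0 < Δ
  smul_zero : ∀ g : Γ, g • zero = zero
  pos_zero : ∀ n, pos n zero = pos 0 zero
  pos_injective : Function.Injective (pos 0)
  zero_mem : zero ∈ base
  smul_mem : ∀ (g : Γ) {x}, x ∈ base → g • x ∈ base
  loc : ∀ ε : ℝ, 0 < ε → ∃ B : Set Γ, B.Finite ∧ ∀ n x y,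
    (∀ b ∈ B, dist (pos n (b • x)) (pos n (b • y)) ≤ Δ) → dist (pos n x) (pos n y) < ε
  continuous_step : ∀ ε : ℝ, 0 < ε → ∃ δ : ℝ, 0 < δ ∧ ∀ n x y,
    dist (pos n x) (pos n y) < δ → dist (pos (n + 1) x) (pos (n + 1) y) < ε
  tendsto : ∀ x, Tendsto (fun n => pos n x) atTop (𝓝 (pos 0 zero))
  glue : ∀ ε : ℝ, 0 < ε → ∃ δ : ℝ, 0 < δ ∧ ∃ E : Set Γ, E.Finite ∧
    ∀ (I : Type c) (A : I → Set Γ) (x : I → P), (∀ i, x i ∈ base) →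
      (∀ i j, i ≠ j → Disjoint (A i) (A j)) → (∀ g, ∃ i, g ∈ A i) →
      (∀ i, ∀ g ∈ border E (A i), dist (pos 0 (g • x i)) (pos 0 zero) < δ) →
      ∃ y, ∀ i, ∀ g ∈ A i, dist (pos 0 (g • y)) (pos 0 (g • x i)) < ε

namespace Arena

variable {Γ : Type c} [Group Γ] {P : Type a} [MulAction Γ P] {Z : Type a} [MetricSpace Z]
  (𝔸 : Arena Γ P Z)

/-- `x` and `y` are indistinguishable at the site `g` at time `n`. -/
def agree (n : ℕ) (x y : P) (g : Γ) : Prop :=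
  dist (𝔸.pos n (g • x)) (𝔸.pos n (g • y)) ≤ 𝔸.Δ

/-- `x` and `y` are close at the site `g` at time `n`. -/
def close (n : ℕ) (x y : P) (g : Γ) : Prop :=
  dist (𝔸.pos n (g • x)) (𝔸.pos n (g • y)) < 𝔸.Δ / 2

variable {𝔸}

theorem close_refl (n : ℕ) (x : P) (g : Γ) : 𝔸.close n x x g := by
  simp [close, 𝔸.Δ_pos]

theorem close.symm {n : ℕ} {x y : P} {g : Γ} (h : 𝔸.close n x y g) : 𝔸.close n y x g := by
  rwa [close, dist_comm]

theorem agree_of_close {n : ℕ} {x y z : P} {g : Γ} (h : 𝔸.close n x y g)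
    (h' : 𝔸.close n y z g) : 𝔸.agree n x z g := by
  have := dist_triangle (𝔸.pos n (g • x)) (𝔸.pos n (g • y)) (𝔸.pos n (g • z))
  unfold close at h h'
  unfold agree
  linarith

theorem agree_of_close' {n : ℕ} {x y : P} {g : Γ} (h : 𝔸.close n x y g) : 𝔸.agree n x y g :=
  agree_of_close h (close_refl n y g)

theorem pos_eq_of_agree {n : ℕ} {x y : P} (h : ∀ g, 𝔸.agree n x y g) (g : Γ) :
    𝔸.pos n (g • x) = 𝔸.pos n (g • y) := by
  refine dist_le_zero.1 (le_of_forall_pos_le_add fun ε hε => ?_)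
  obtain ⟨B, -, hB⟩ := 𝔸.loc ε hε
  have := hB n (g • x) (g • y) fun b _ => by simpa [agree, mul_smul] using h (b * g)
  linarith

theorem eq_of_agree {x y : P} (h : ∀ g, 𝔸.agree 0 x y g) : x = y :=
  𝔸.pos_injective (by simpa using pos_eq_of_agree h 1)

theorem pos_succ_eq {n : ℕ} {x y : P} (h : 𝔸.pos n x = 𝔸.pos n y) :
    𝔸.pos (n + 1) x = 𝔸.pos (n + 1) y := by
  refine dist_le_zero.1 (le_of_forall_pos_le_add fun ε hε => ?_)
  obtain ⟨δ, hδ, hs⟩ := 𝔸.continuous_step ε hε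
  have := hs n x y (by simpa [h] using hδ)
  linarith

theorem agree_mono {m n : ℕ} (hmn : m ≤ n) {x y : P} (h : ∀ g, 𝔸.agree m x y g) (g : Γ) :
    𝔸.agree n x y g := by
  have : 𝔸.pos n (g • x) = 𝔸.pos n (g • y) := by
    induction n, hmn using Nat.le_induction with
    | base => exact pos_eq_of_agree h g
    | succ n _ ih => exact pos_succ_eq ih
  simp [agree, this, 𝔸.Δ_pos.le]

theorem eventually_close (x : P) (g : Γ) : ∃ N, ∀ n ≥ N, 𝔸.close n x 𝔸.zero g := by
  obtain ⟨N, hN⟩ := (Metric.tendsto_atTop.1 (𝔸.tendsto (g • x))) (𝔸.Δ / 2) (half_pos 𝔸.Δ_pos)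
  refine ⟨N, fun n hn => ?_⟩
  rw [close, 𝔸.smul_zero, 𝔸.pos_zero]
  exact hN n hn

variable (𝔸)

/-- Expansivity in the form `loc` is uniform in time, so one finite set serves as the neighbourhood
of a local rule at every step. -/
theorem exists_nbhd : ∃ B : Set Γ, B.Finite ∧ ∀ n x y g, (∀ b ∈ B, 𝔸.agree n x y (b * g)) →
    𝔸.close n x y g ∧ 𝔸.close (n + 1) x y g := by
  obtain ⟨δ, hδ, hs⟩ := 𝔸.continuous_step (𝔸.Δ / 2) (half_pos 𝔸.Δ_pos)
  obtain ⟨B, hBf, hB⟩ := 𝔸.loc (min δ (𝔸.Δ / 2)) (lt_min hδ (half_pos 𝔸.Δ_pos))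
  refine ⟨B, hBf, fun n x y g h => ?_⟩
  have := hB n (g • x) (g • y) fun b hb => by simpa [agree, mul_smul] using h b hb
  exact ⟨this.trans_le (min_le_right _ _), hs _ _ _ (this.trans_le (min_le_left _ _))⟩

/-- A finite set of sites determining the state of a site in one step. -/
def nbhd : Set Γ := 𝔸.exists_nbhd.choose

theorem nbhd_finite : 𝔸.nbhd.Finite := 𝔸.exists_nbhd.choose_spec.1

variable {𝔸} in
theorem step {n : ℕ} {x y : P} {g : Γ} (h : ∀ b ∈ 𝔸.nbhd, 𝔸.agree n x y (b * g)) :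
    𝔸.close n x y g ∧ 𝔸.close (n + 1) x y g :=
  𝔸.exists_nbhd.choose_spec.2 n x y g h

/-- The sites where `x` differs from the zero point. -/
def supp (x : P) : Set Γ := {g | ¬ 𝔸.agree 0 x 𝔸.zero g}

/-- On the `E`-border of a sufficiently thick collar of its support, a point is already `δ`-close to
zero; so disjoint collars form a designation, the zero point filling the rest of the group. -/
theorem exists_collar : ∃ C : Set Γ, C.Finite ∧ 𝔸.nbhd⁻¹ ⊆ C ∧
    ∀ (I : Type c) (Y : I → P), (∀ i, Y i ∈ 𝔸.base) →
      (∀ i j, i ≠ j → Disjoint (C * 𝔸.supp (Y i)) (C * 𝔸.supp (Y j))) →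
      ∃ z, (∀ i, ∀ g ∈ C * 𝔸.supp (Y i),
          dist (𝔸.pos 0 (g • z)) (𝔸.pos 0 (g • Y i)) < 𝔸.Δ / 4) ∧
        ∀ g, (∀ i, g ∉ C * 𝔸.supp (Y i)) →
          dist (𝔸.pos 0 (g • z)) (𝔸.pos 0 𝔸.zero) < 𝔸.Δ / 4 := by
  obtain ⟨δ, hδ, E, hE, hglue⟩ := 𝔸.glue (𝔸.Δ / 4) (by linarith [𝔸.Δ_pos])
  obtain ⟨B, hBf, hB⟩ := 𝔸.loc δ hδ
  refine ⟨E * B⁻¹ ∪ 𝔸.nbhd⁻¹, (hE.mul hBf.inv).union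
    𝔸.nbhd_finite.inv,
    fun x hx => Or.inr hx, fun I Y hY hdisj => ?_⟩
  set C := E * B⁻¹ ∪ 𝔸.nbhd⁻¹ with hC
  let A : Option I → Set Γ := fun i => i.elim {g | ∀ i, g ∉ C * 𝔸.supp (Y i)}
    fun i => C * 𝔸.supp (Y i)
  let x : Option I → P := fun i => i.elim 𝔸.zero Y
  suffices h : ∃ z, ∀ i, ∀ g ∈ A i, dist (𝔸.pos 0 (g • z)) (𝔸.pos 0 (g • x i)) < 𝔸.Δ / 4 by
    obtain ⟨z, hz⟩ := h
    refine ⟨z, fun i g hg => hz (some i) g hg, fun g hg => ?_⟩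
    simpa [x, 𝔸.smul_zero] using hz none g hg
  refine hglue (Option I) A x ?_ ?_ ?_ ?_
  · rintro (_ | i)
    exacts [𝔸.zero_mem, hY i]
  · rintro (_ | i) (_ | j) hij
    · exact (hij rfl).elim
    · exact Set.disjoint_left.2 fun g hg hg' => hg j hg'
    · exact Set.disjoint_left.2 fun g hg hg' => hg' i hg
    · exact hdisj i j fun h => hij (by rw [h])
  · intro g
    by_cases h : ∃ i, g ∈ C * 𝔸.supp (Y i)
    · exact ⟨some h.choose, h.choose_spec⟩
    · exact ⟨none, not_exists.1 h⟩
  · rintro (_ | i) g ⟨hg, e, he, heg⟩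
    · simpa [x, 𝔸.smul_zero] using hδ
    · have := hB 0 (g • Y i) (g • 𝔸.zero) fun b hb => by
        by_contra hn
        refine heg ⟨e * b⁻¹, Or.inl (Set.mul_mem_mul he (by simpa using hb)), b * g, ?_,
          by simp only; group⟩
        simpa [supp, agree, mul_smul] using hn
      rw [𝔸.smul_zero] at this
      exact this

/-- The spreading of supports at time `0`. -/
def collar : Set Γ := 𝔸.exists_collar.choose

theorem collar_finite : 𝔸.collar.Finite := 𝔸.exists_collar.choose_spec.1

theorem nbhd_inv_subset_collar : 𝔸.nbhd⁻¹ ⊆ 𝔸.collar := 𝔸.exists_collar.choose_spec.2.1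

theorem exists_glued {I : Type c} (Y : I → P) (hY : ∀ i, Y i ∈ 𝔸.base)
    (h : ∀ i j, i ≠ j → Disjoint (𝔸.collar * 𝔸.supp (Y i)) (𝔸.collar * 𝔸.supp (Y j))) :
    ∃ z, (∀ i, ∀ g ∈ 𝔸.collar * 𝔸.supp (Y i),
        dist (𝔸.pos 0 (g • z)) (𝔸.pos 0 (g • Y i)) < 𝔸.Δ / 4) ∧
      ∀ g, (∀ i, g ∉ 𝔸.collar * 𝔸.supp (Y i)) →
        dist (𝔸.pos 0 (g • z)) (𝔸.pos 0 𝔸.zero) < 𝔸.Δ / 4 :=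
  𝔸.exists_collar.choose_spec.2.2 I Y hY h

/-- The spreading of supports at time `n`. -/
def spread : ℕ → Set Γ
  | 0 => 𝔸.collar
  | n + 1 => 𝔸.nbhd⁻¹ * spread n ∪ spread n

theorem spread_finite (n : ℕ) : (𝔸.spread n).Finite := by
  induction n with
  | zero => exact 𝔸.collar_finite
  | succ n ih => exact (𝔸.nbhd_finite.inv.mul ih).union ih

theorem spread_mono : Monotone 𝔸.spread :=
  monotone_nat_of_le_succ fun _ => Set.subset_union_right

theorem mem_spread_succ {n : ℕ} {U : Set Γ} {b g : Γ} (hb : b ∈ 𝔸.nbhd)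
    (h : b * g ∈ 𝔸.spread n * U) : g ∈ 𝔸.spread (n + 1) * U := by
  obtain ⟨x, hx, u, hu, hxu⟩ := h
  refine ⟨b⁻¹ * x, Or.inl (Set.mul_mem_mul (by simpa using hb) hx), u, hu, ?_⟩
  simp only at hxu ⊢
  rw [mul_assoc, hxu]; group

theorem mem_spread_of_not_close (x : P) (n : ℕ) : ∀ g, ¬ 𝔸.close n x 𝔸.zero g →
    g ∈ 𝔸.spread n * 𝔸.supp x := by
  induction n with
  | zero =>
    intro g hg
    have : ∃ b ∈ 𝔸.nbhd, ¬ 𝔸.agree 0 x 𝔸.zero (b * g) := by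
      by_contra hn
      push Not at hn
      exact hg (step hn).1
    obtain ⟨b, hb, hbg⟩ := this
    exact ⟨b⁻¹, 𝔸.nbhd_inv_subset_collar (by simpa using hb), b * g, hbg, by simp⟩
  | succ n ih =>
    intro g hg
    have : ∃ b ∈ 𝔸.nbhd, ¬ 𝔸.agree n x 𝔸.zero (b * g) := by
      by_contra hn
      push Not at hn
      exact hg (step hn).2
    obtain ⟨b, hb, hbg⟩ := this
    exact 𝔸.mem_spread_succ hb (ih _ fun h => hbg (agree_of_close' h))

/-- Points `Y i` which stay apart as long as they are alive have a common superposition. -/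
theorem exists_superposition {I : Type c} (Y : I → P) (hY : ∀ i, Y i ∈ 𝔸.base)
    (alive : I → ℕ → Prop) (hmono : ∀ i n, alive i (n + 1) → alive i n) (h0 : ∀ i, alive i 0)
    (hdead : ∀ i n, ¬ alive i (n + 1) → ∀ g, 𝔸.agree n (Y i) 𝔸.zero g)
    (hfar : ∀ i j n, i ≠ j → alive i n → alive j n →
      Disjoint (𝔸.spread (n + 1) * 𝔸.supp (Y i)) (𝔸.spread (n + 1) * 𝔸.supp (Y j))) :
    ∃ z, ∀ n, (∀ i, alive i n → ∀ g ∈ 𝔸.spread n * 𝔸.supp (Y i), 𝔸.close n z (Y i) g) ∧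
      ∀ g, (∀ i, alive i n → g ∉ 𝔸.spread n * 𝔸.supp (Y i)) → 𝔸.close n z 𝔸.zero g := by
  obtain ⟨z, hz1, hz2⟩ := 𝔸.exists_glued Y hY fun i j hij =>
    (hfar i j 0 hij (h0 i) (h0 j)).mono (Set.mul_subset_mul_right (𝔸.spread_mono (Nat.zero_le 1)))
      (Set.mul_subset_mul_right (𝔸.spread_mono (Nat.zero_le 1)))
  have hΔ := 𝔸.Δ_pos
  refine ⟨z, fun n => ?_⟩
  induction n with
  | zero =>
    refine ⟨fun i _ g hg => ?_, fun g hg => ?_⟩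
    · have := hz1 i g hg
      unfold close; linarith
    · have := hz2 g fun i => hg i (h0 i)
      unfold close; rw [𝔸.smul_zero]; linarith
  | succ n ih =>
    -- Spreads of distinct live points are disjoint one step ahead, so a neighbour of a site in one
    -- spread lies in no other. A point dead at time `n + 1` already agrees with zero at time `n`,
    -- hence its spread may be forgotten.
    refine ⟨fun i hi g hg => (step fun b hb => ?_).2, fun g hg => (step fun b hb => ?_).2⟩
    · by_cases hex : ∃ j, alive j n ∧ b * g ∈ 𝔸.spread n * 𝔸.supp (Y j)
      · obtain ⟨j, hj, hjg⟩ := hex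
        by_cases hij : i = j
        · subst hij
          exact agree_of_close' (ih.1 i hj _ hjg)
        · exact (Set.disjoint_left.1 (hfar i j n hij (hmono i n hi) hj) hg
            (𝔸.mem_spread_succ hb hjg)).elim
      · push Not at hex
        refine agree_of_close (ih.2 _ hex) (close.symm ?_)
        by_contra hn
        exact hex i (hmono i n hi) (𝔸.mem_spread_of_not_close _ _ _ hn)
    · by_cases hex : ∃ j, alive j n ∧ b * g ∈ 𝔸.spread n * 𝔸.supp (Y j)
      · obtain ⟨j, hj, hjg⟩ := hex
        have hjd : ¬ alive j (n + 1) := fun h => hg j h (𝔸.mem_spread_succ hb hjg)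
        have h1 := agree_of_close' (ih.1 j hj _ hjg)
        have h2 := pos_eq_of_agree (hdead j n hjd) (b * g)
        unfold agree at h1 ⊢
        rwa [← h2]
      · push Not at hex
        exact agree_of_close' (ih.2 _ hex)

end Arena
end

/-! ### Exclusion of nested families, and superpositions of translates. -/

section
open scoped Pointwise

namespace Arena

variable {Γ : Type c} [Group Γ] {P : Type a} [MulAction Γ P] {Z : Type a} [MetricSpace Z]
  {Γ' : Type c} [Group Γ'] {P' : Type a} [MulAction Γ' P']

/-- In `𝔸` there is no infinite family of nested dying configurations with late visits to `H`. -/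
def NotNested (𝔸 : Arena Γ P Z) : Prop :=
  ∀ (R : Subgroup Γ) (H : Set Γ), H.Finite →
    ¬ ∀ (F : Set Γ) (N : ℕ), F.Finite → ∃ (x : P) (τ n : ℕ), N ≤ n ∧
      (∃ m, ∀ g, 𝔸.agree m x 𝔸.zero g) ∧
      (∃ F' : Set Γ, F'.Finite ∧ ∀ g, ¬ 𝔸.agree τ x 𝔸.zero g → g ∈ F' * (R : Set Γ)) ∧
      (∀ g ∈ F * (R : Set Γ), 𝔸.agree τ x 𝔸.zero g) ∧ ∃ h ∈ H, ¬ 𝔸.close (τ + n) x 𝔸.zero h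

/-- The second arena is needed to restart orbits: the state at time `τ` of a point of `𝔸` need not
lie in `𝔸`, but it is a point of `𝔹` that can be glued. -/
theorem notNested_of_lift (𝔸 : Arena Γ P Z) (𝔹 : Arena Γ' P' Z) (ψ : Γ' →* Γ)
    (hψ : Function.Surjective ψ) (hO : 𝔹.pos 0 𝔹.zero = 𝔸.pos 0 𝔸.zero) (hΔ : 𝔹.Δ ≤ 𝔸.Δ / 2)
    (hlift : ∀ (τ : ℕ) (x : P), ∃ Y ∈ 𝔹.base, ∀ n g, 𝔹.pos n (g • Y) = 𝔸.pos (τ + n) (ψ g • x)) :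
    𝔸.NotNested := by
  intro R H hH hnest
  have hΔpos := 𝔸.Δ_pos
  have hΔpos' := 𝔹.Δ_pos
  choose σ hσ using hψ
  obtain ⟨B, hBf, hB⟩ := 𝔸.loc 𝔹.Δ hΔpos'
  -- a member of the family: a point, the time of its visit, its life time, a bound for its support
  let α := P' × ℕ × ℕ × Set Γ
  let good : α → Prop := fun p => p.1 ∈ 𝔹.base ∧
    (∀ k ≥ p.2.2.1, ∀ g, 𝔹.agree k p.1 𝔹.zero g) ∧
    p.2.2.2.Finite ∧ (∀ g ∈ 𝔹.supp p.1, ψ g ∈ p.2.2.2 * (R : Set Γ)) ∧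
    ∃ h ∈ H, 𝔸.Δ / 2 ≤ dist (𝔹.pos p.2.1 (σ h • p.1)) (𝔹.pos 0 𝔹.zero)
  let rel : α → α → Prop := fun p p' => p.2.1 < p'.2.1 ∧
    Disjoint (𝔹.spread (p.2.2.1 + 1) * 𝔹.supp p.1) (𝔹.spread (p.2.2.1 + 1) * 𝔹.supp p'.1)
  obtain ⟨y, hgood, hrel⟩ := exists_seq_of_forall_finset_exists good rel (by
    intro s hs
    -- A new member whose state at time `τ` vanishes on `B * F₀`, modulo `R`, cannot meet an earlier
    -- member `p` before `p` dies.
    let F₀ : Set Γ := ⋃ p ∈ s,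
      ψ '' ((𝔹.spread (p.2.2.1 + 1))⁻¹ * 𝔹.spread (p.2.2.1 + 1)) * p.2.2.2
    have hF₀ : F₀.Finite := Set.Finite.biUnion s.finite_toSet fun p hp =>
      ((((𝔹.spread_finite _).inv.mul (𝔹.spread_finite _)).image ψ).mul (hs p hp).2.2.1)
    obtain ⟨x, τ, n, hn, ⟨m, hm⟩, ⟨F', hF', hxF'⟩, hxF, h, hh, hxh⟩ :=
      hnest (B * F₀) (s.sup (fun p => p.2.1) + 1) (hBf.mul hF₀)
    obtain ⟨Y, hYb, hY⟩ := hlift τ x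
    have hsupp : ∀ g ∈ 𝔹.supp Y, ∃ b ∈ B, ¬ 𝔸.agree τ x 𝔸.zero (b * ψ g) := by
      intro g hg
      by_contra hcon
      push Not at hcon
      refine hg ?_
      have := hB τ (ψ g • x) (ψ g • 𝔸.zero) fun b hb => by
        simpa [agree, mul_smul] using hcon b hb
      rw [agree, hY, 𝔹.smul_zero, hO]
      rw [𝔸.smul_zero, 𝔸.pos_zero] at this
      simpa using this.le
    refine ⟨(Y, n, m, B⁻¹ * F'), ⟨hYb, ?_, hBf.inv.mul hF', ?_, h, hh, ?_⟩, fun p hp => ⟨?_, ?_⟩⟩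
    · intro k hk g
      have h1 := pos_eq_of_agree (agree_mono (le_trans hk (Nat.le_add_left k τ)) hm) (ψ g)
      rw [agree, hY, h1, 𝔹.smul_zero, 𝔹.pos_zero, hO, 𝔸.smul_zero, 𝔸.pos_zero, dist_self]
      exact hΔpos'.le
    · intro g hg
      obtain ⟨b, hb, hbg⟩ := hsupp g hg
      obtain ⟨f, hf, r, hr, hfr⟩ := hxF' _ hbg
      refine ⟨b⁻¹ * f, Set.mul_mem_mul (by simpa using hb) hf, r, hr, ?_⟩
      simp only at hfr ⊢
      rw [mul_assoc, hfr]; group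
    · simp only
      rw [hY, hσ, hO]
      rw [close, 𝔸.smul_zero, 𝔸.pos_zero] at hxh
      exact not_lt.1 hxh
    · have := Finset.le_sup (f := fun p : α => p.2.1) hp
      simp only at this ⊢
      omega
    · refine Set.disjoint_left.2 ?_
      rintro _ ⟨w, hw, u, hu, rfl⟩ ⟨w', hw', u', hu', hwu⟩
      simp only at hwu
      obtain ⟨b, hb, hbg⟩ := hsupp u' hu'
      obtain ⟨f, hf, r, hr, hfr⟩ := (hs p hp).2.2.2.1 u hu
      simp only at hfr
      refine hbg (hxF _ ⟨b * (ψ (w'⁻¹ * w) * f), Set.mul_mem_mul hb ?_, r, hr, ?_⟩)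
      · exact Set.mem_biUnion hp (Set.mul_mem_mul
          ⟨_, Set.mul_mem_mul (by simpa using hw') hw, rfl⟩ hf)
      · have : u' = w'⁻¹ * w * u := by rw [mul_assoc, ← hwu]; group
        simp only [this, map_mul, ← hfr, mul_assoc])
  let Y : ULift.{c} ℕ → P' := fun i => (y i.down).1
  let m : ULift.{c} ℕ → ℕ := fun i => (y i.down).2.2.1
  have hfar : ∀ i j : ULift.{c} ℕ, i.down < j.down → ∀ n ≤ m i,
      Disjoint (𝔹.spread (n + 1) * 𝔹.supp (Y i)) (𝔹.spread (n + 1) * 𝔹.supp (Y j)) :=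
    fun i j hij n hn => (hrel _ _ hij).2.mono
      (Set.mul_subset_mul_right (𝔹.spread_mono (Nat.succ_le_succ hn)))
      (Set.mul_subset_mul_right (𝔹.spread_mono (Nat.succ_le_succ hn)))
  have hdead : ∀ i n, m i ≤ n → ∀ g, 𝔹.agree n (Y i) 𝔹.zero g := fun i n hn =>
    (hgood i.down).2.1 n hn
  obtain ⟨z, hz⟩ := 𝔹.exists_superposition Y (fun i => (hgood i.down).1) (fun i n => n ≤ m i)
    (fun i n h => by omega) (fun i => Nat.zero_le _)
    (fun i n h => hdead i n (by omega)) (by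
      intro i j n hij hi hj
      rcases lt_or_gt_of_ne (fun h => hij (ULift.ext _ _ h) : i.down ≠ j.down) with h | h
      · exact hfar i j h n hi
      · exact (hfar j i h n hj).symm)
  have hev : ∀ h : Γ, ∃ N, ∀ n ≥ N,
      dist (𝔹.pos n (σ h • z)) (𝔹.pos 0 𝔹.zero) < 𝔸.Δ / 4 := fun h =>
    Metric.tendsto_atTop.1 (𝔹.tendsto (σ h • z)) _ (by linarith)
  choose N hN using hev
  have hymono : StrictMono fun i => (y i).2.1 := strictMono_nat_of_lt_succ fun i =>
    (hrel i (i + 1) (Nat.lt_succ_self i)).1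
  -- By this time `z` is within `𝔸.Δ / 4` of zero at all sites of `H`. But the `i`-th member is then
  -- at least `𝔸.Δ / 2` away from zero at some `h ∈ H`, and `z` follows it within `𝔹.Δ / 2 ≤ 𝔸.Δ /
  -- 4`.
  set i := hH.toFinset.sup N with hi
  obtain ⟨h, hh, hhit⟩ := (hgood i).2.2.2.2
  have hnc : ¬ 𝔹.close (y i).2.1 (Y ⟨i⟩) 𝔹.zero (σ h) := by
    rw [close, 𝔹.smul_zero, 𝔹.pos_zero, not_lt]
    simp only [Y]
    linarith
  have halive : (y i).2.1 ≤ m ⟨i⟩ := by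
    by_contra hlt
    refine hnc ?_
    have := pos_eq_of_agree (hdead ⟨i⟩ (y i).2.1 (by omega)) (σ h)
    rw [close, this, dist_self]
    linarith
  have hcl := (hz (y i).2.1).1 ⟨i⟩ halive (σ h) (𝔹.mem_spread_of_not_close _ _ _ hnc)
  have hsmall := hN h (y i).2.1 (le_trans (Finset.le_sup (f := N) (hH.mem_toFinset.2 hh))
    (hymono.id_le i))
  unfold close at hcl
  rw [dist_comm] at hcl
  have := dist_triangle (𝔹.pos (y i).2.1 (σ h • (y i).1)) (𝔹.pos (y i).2.1 (σ h • z))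
    (𝔹.pos 0 𝔹.zero)
  simp only [Y] at hcl
  linarith

section Translates

variable (𝔸 : Arena Γ P Z) (q : P)

/-- The sites controlled by `q`. -/
def territory : Set Γ := 𝔸.collar * 𝔸.supp q

/-- `z` looks like the superposition of the translates of `q` by the elements of `S`. -/
def IsConfig (S : Set Γ) (z : P) : Prop :=
  ∀ g : Γ, (∀ s ∈ S, g * s⁻¹ ∈ 𝔸.territory q →
      dist (𝔸.pos 0 (g • z)) (𝔸.pos 0 ((g * s⁻¹) • q)) < 𝔸.Δ / 4) ∧
    ((∀ s ∈ S, g * s⁻¹ ∉ 𝔸.territory q) → dist (𝔸.pos 0 (g • z)) (𝔸.pos 0 𝔸.zero) < 𝔸.Δ / 4)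

variable {𝔸 q}

theorem IsConfig.close {S S' : Set Γ} {z z' : P} (h : 𝔸.IsConfig q S z)
    (h' : 𝔸.IsConfig q S' z') {g : Γ}
    (hg : ∀ k ∈ (𝔸.territory q)⁻¹, k * g ∈ S ↔ k * g ∈ S') : 𝔸.close 0 z z' g := by
  have hS : ∀ s, g * s⁻¹ ∈ 𝔸.territory q → (s ∈ S ↔ s ∈ S') := fun s hs => by
    simpa using hg (s * g⁻¹) (by simpa using hs)
  by_cases hex : ∃ s ∈ S, g * s⁻¹ ∈ 𝔸.territory q
  · obtain ⟨s, hs, hgs⟩ := hex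
    have h1 := (h g).1 s hs hgs
    have h2 := (h' g).1 s ((hS s hgs).1 hs) hgs
    have := dist_triangle_right (𝔸.pos 0 (g • z)) (𝔸.pos 0 (g • z')) (𝔸.pos 0 ((g * s⁻¹) • q))
    unfold Arena.close
    linarith
  · push Not at hex
    have h1 := (h g).2 hex
    have h2 := (h' g).2 fun s hs hgs => hex s ((hS s hgs).2 hs) hgs
    have := dist_triangle_right (𝔸.pos 0 (g • z)) (𝔸.pos 0 (g • z')) (𝔸.pos 0 𝔸.zero)
    unfold Arena.close
    linarith

theorem IsConfig.unique {S : Set Γ} {z z' : P} (h : 𝔸.IsConfig q S z) (h' : 𝔸.IsConfig q S z') :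
    z = z' :=
  eq_of_agree fun _ => agree_of_close' (h.close h' fun _ _ => Iff.rfl)

theorem IsConfig.shift {S : Set Γ} {z : P} (h : 𝔸.IsConfig q S z) (a : Γ) :
    𝔸.IsConfig q {x | x * a ∈ S} (a • z) := by
  intro g
  rw [← mul_smul]
  refine ⟨fun s hs hgs => ?_, fun hs => (h (g * a)).2 fun s hsS hgs => ?_⟩
  · have e : g * a * (s * a)⁻¹ = g * s⁻¹ := by group
    have := (h (g * a)).1 (s * a) hs (by rwa [e])
    rwa [e] at this
  · refine hs (s * a⁻¹) (by simpa using hsS) ?_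
    have e : g * (s * a⁻¹)⁻¹ = g * a * s⁻¹ := by group
    rwa [e]

theorem exists_isConfig (hq : q ∈ 𝔸.base) {S : Set Γ}
    (hS : IsSep ((𝔸.territory q)⁻¹ * 𝔸.territory q) S) : ∃ z, 𝔸.IsConfig q S z := by
  have hmem : ∀ s g : Γ, g ∈ 𝔸.collar * 𝔸.supp (s⁻¹ • q) ↔ g * s⁻¹ ∈ 𝔸.territory q := by
    intro s g
    have hsupp : ∀ u, u ∈ 𝔸.supp (s⁻¹ • q) ↔ u * s⁻¹ ∈ 𝔸.supp q := by
      intro u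
      simp [supp, agree, mul_smul, 𝔸.smul_zero]
    constructor
    · rintro ⟨x, hx, u, hu, rfl⟩
      exact ⟨x, hx, u * s⁻¹, (hsupp u).1 hu, by simp [mul_assoc]⟩
    · rintro ⟨x, hx, u, hu, hxu⟩
      refine ⟨x, hx, u * s, (hsupp _).2 (by simpa using hu), ?_⟩
      simp only at hxu ⊢
      rw [← mul_assoc, hxu]; group
  obtain ⟨z, hz1, hz2⟩ := 𝔸.exists_glued (fun s : S => (s : Γ)⁻¹ • q)
    (fun s => 𝔸.smul_mem _ hq) (by
      intro s s' hne
      refine Set.disjoint_left.2 fun g hg hg' => hne (Subtype.ext ?_)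
      rw [hmem] at hg hg'
      refine hS _ s'.2 _ s.2 ⟨(g * (s : Γ)⁻¹)⁻¹, by simpa using hg, _, hg', ?_⟩
      simp only; group)
  refine ⟨z, fun g => ⟨fun s hs hgs => ?_, fun hs => hz2 g fun s hgs => ?_⟩⟩
  · have := hz1 ⟨s, hs⟩ g ((hmem s g).2 hgs)
    rwa [← mul_smul] at this
  · exact hs s s.2 ((hmem s g).1 hgs)

variable (𝔸 q)

open Classical in
/-- The superposition of the translates of `q` by `S`, if it exists. -/
noncomputable def config (S : Set Γ) : P :=
  if h : ∃ z, 𝔸.IsConfig q S z then h.choose else 𝔸.zero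

variable {𝔸 q}

theorem isConfig_config {S : Set Γ} (h : ∃ z, 𝔸.IsConfig q S z) :
    𝔸.IsConfig q S (𝔸.config q S) := by
  rw [config, dif_pos h]
  exact h.choose_spec

theorem config_empty : 𝔸.config q ∅ = 𝔸.zero := by
  have h : 𝔸.IsConfig q ∅ 𝔸.zero := fun g =>
    ⟨fun s hs => hs.elim, fun _ => by simp [𝔸.smul_zero, 𝔸.Δ_pos]⟩
  exact (isConfig_config ⟨_, h⟩).unique h

/-- Superpositions are unique where they exist, and otherwise both sides are the default `𝔸.zero`,
which is fixed; so no separation of `S` is needed. -/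
theorem config_shift (S : Set Γ) (a : Γ) : 𝔸.config q {x | x * a ∈ S} = a • 𝔸.config q S := by
  by_cases h : ∃ z, 𝔸.IsConfig q S z
  · have h' := (isConfig_config h).shift a
    exact (isConfig_config ⟨_, h'⟩).unique h'
  · have h' : ¬ ∃ z, 𝔸.IsConfig q {x | x * a ∈ S} z := by
      rintro ⟨z, hz⟩
      refine h ⟨a⁻¹ • z, ?_⟩
      simpa using hz.shift a⁻¹
    rw [config, config, dif_neg h, dif_neg h', 𝔸.smul_zero]

theorem config_one (hq : q ∈ 𝔸.base) : 𝔸.config q {1} = q := by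
  have h := isConfig_config (exists_isConfig (𝔸 := 𝔸) (S := {1}) hq
    (by rintro _ rfl _ rfl _; rfl))
  refine eq_of_agree (𝔸 := 𝔸) fun g => ?_
  have hΔ := 𝔸.Δ_pos
  by_cases hg : g ∈ 𝔸.territory q
  · have := (h g).1 1 rfl (by simpa using hg)
    simp only [inv_one, mul_one] at this
    unfold agree; linarith
  · have h1 := (h g).2 (by rintro _ rfl; simpa using hg)
    refine agree_of_close (y := 𝔸.zero) ?_ (close.symm ?_)
    · unfold Arena.close; rw [𝔸.smul_zero]; linarith
    · by_contra hn
      exact hg (𝔸.mem_spread_of_not_close q 0 g hn)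

/-- The dynamics of superpositions of translates of `q`. -/
noncomputable def toGroupModel (𝔸 : Arena Γ P Z) (q : P) (hn : 𝔸.NotNested) (hq : q ∈ 𝔸.base)
    (hfin : (𝔸.supp q).Finite) : GroupModel Γ where
  sep := (𝔸.territory q)⁻¹ * 𝔸.territory q
  window := (𝔸.territory q)⁻¹
  nbhd := 𝔸.nbhd
  sep_finite := (𝔸.collar_finite.mul hfin).inv.mul (𝔸.collar_finite.mul hfin)
  window_finite := (𝔸.collar_finite.mul hfin).inv
  nbhd_finite := 𝔸.nbhd_finite
  agree n S S' g := 𝔸.agree n (𝔸.config q S) (𝔸.config q S') g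
  close n S S' g := 𝔸.close n (𝔸.config q S) (𝔸.config q S') g
  close_refl n S g := close_refl n _ g
  close_symm h := h.symm
  agree_of_close h h' := agree_of_close h h'
  init h h' hk := (isConfig_config (exists_isConfig hq h)).close
    (isConfig_config (exists_isConfig hq h')) hk
  step h := step h
  agree_shift n S S' g h := by simp only [agree, config_shift, mul_smul]
  close_shift n S S' g h := by simp only [close, config_shift, mul_smul]
  eventually_close S g := by
    rw [config_empty]
    exact eventually_close _ g
  not_nested R H hH hnest := by
    refine hn R H hH fun F N hF => ?_
    obtain ⟨S, τ, n, -, h⟩ := hnest F N hF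
    rw [config_empty] at h
    exact ⟨_, τ, n, h⟩

theorem mortal_of_finite_supp [Group.ResiduallyFinite Γ] (hΓ : IsVirtuallySolvable Γ)
    (hn : 𝔸.NotNested) (hq : q ∈ 𝔸.base) (hfin : (𝔸.supp q).Finite) :
    ∃ m, ∀ g, 𝔸.agree m q 𝔸.zero g := by
  obtain ⟨m, hm⟩ := (𝔸.toGroupModel q hn hq hfin).mortal_singleton_one hΓ
  refine ⟨m, fun g => ?_⟩
  have := hm g
  change 𝔸.agree m (𝔸.config q {1}) (𝔸.config q ∅) g at this
  rwa [config_one hq, config_empty] at this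

end Translates

end Arena
end

/-! ### Nil-rigidity of virtually solvable groups -/

section
open scoped Pointwise

/-- Compactness of the set of pairs at distance at least `ε`: expansivity says that the closed
conditions indexed by `g` have no common solution there. -/
theorem exists_finset_of_expansive {G : Type u} {X : Type v} [Group G] [MetricSpace X]
    [CompactSpace X] [MulAction G X] (hcont : ∀ g : G, Continuous fun x : X => g • x) {Δ : ℝ}
    (hΔ : ∀ x y : X, (∀ g : G, dist (g • x) (g • y) ≤ Δ) → x = y) {ε : ℝ} (hε : 0 < ε) :
    ∃ B : Finset G, ∀ x y : X, (∀ b ∈ B, dist (b • x) (b • y) ≤ Δ) → dist x y < ε := by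
  have hK : IsCompact {p : X × X | ε ≤ dist p.1 p.2} :=
    (isClosed_le continuous_const (continuous_fst.dist continuous_snd)).isCompact
  obtain ⟨B, hB⟩ := hK.elim_finite_subfamily_closed
    (fun g : G => {p : X × X | dist (g • p.1) (g • p.2) ≤ Δ})
    (fun g => isClosed_le (((hcont g).comp continuous_fst).dist ((hcont g).comp continuous_snd))
      continuous_const) (by
      refine Set.eq_empty_iff_forall_notMem.2 ?_
      rintro ⟨x, y⟩ ⟨h1, h2⟩
      have := hΔ x y fun g => Set.mem_iInter.1 h2 g
      subst this
      have h1' : ε ≤ dist x x := h1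
      rw [dist_self] at h1'
      linarith)
  refine ⟨B, fun x y h => ?_⟩
  by_contra hn
  have : (x, y) ∈ ({p : X × X | ε ≤ dist p.1 p.2} ∩
      ⋂ g ∈ B, {p : X × X | dist (g • p.1) (g • p.2) ≤ Δ}) :=
    ⟨not_lt.1 hn, Set.mem_iInter₂.2 h⟩
  rw [hB] at this
  exact this

theorem IsAsymptoticallyNilpotent.map_zero {X : Type v} [TopologicalSpace X] [T2Space X] {o : X}
    {f : X → X} (h : IsAsymptoticallyNilpotent o f) (hf : Continuous f) : f o = o := by
  refine tendsto_nhds_unique ((hf.tendsto o).comp (h o)) ?_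
  have := (tendsto_add_atTop_iff_nat 1).2 (h o)
  simpa only [Function.iterate_succ', Function.comp_def] using this

/-! ### Tiered systems: arenas, dying homoclinic points, uniform nilpotency. -/

namespace TDS

variable {𝒳 : TDS.{a, b, c}} {f : 𝒳.Space → 𝒳.Space}

theorem IsEvolution.smul_iterate (hf : 𝒳.IsEvolution f) {t s : 𝒳.Index} (h : t ≤ s)
    (hs : ∀ k : ℕ, ∀ x ∈ 𝒳.tier t, f^[k] x ∈ 𝒳.tier s) (x : 𝒳.tier t) (n : ℕ) (g : 𝒳.Grp s) :
    ((g • (⟨f^[n] x, hs n x x.2⟩ : 𝒳.tier s) : 𝒳.tier s) : 𝒳.Space) =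
      f^[n] (𝒳.φ h g • x : 𝒳.tier t) := by
  induction n with
  | zero => exact (𝒳.φ_smul h x g).symm
  | succ n ih =>
    have hfx : f (f^[n] x) ∈ 𝒳.tier s := by
      simpa only [Function.iterate_succ_apply'] using hs (n + 1) x x.2
    have h1 := hf.map_smul (le_refl s) ⟨f^[n] x, hs n x x.2⟩ hfx g
    rw [𝒳.φ_refl, MonoidHom.id_apply, ih] at h1
    rw [Function.iterate_succ_apply' f n (𝒳.φ h g • x : 𝒳.tier t), h1]
    have e : (⟨f^[n + 1] x, hs (n + 1) x x.2⟩ : 𝒳.tier s) = ⟨f (f^[n] x), hfx⟩ :=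
      Subtype.ext (Function.iterate_succ_apply' f n x)
    rw [e]

theorem IsEvolution.smul_iterate_of_le (hf : 𝒳.IsEvolution f) {t s r : 𝒳.Index} (h : t ≤ s)
    (hs : ∀ k : ℕ, ∀ x ∈ 𝒳.tier t, f^[k] x ∈ 𝒳.tier s) (h' : s ≤ r) (x : 𝒳.tier t) (n : ℕ)
    (g : 𝒳.Grp r) :
    ((g • (⟨f^[n] x, 𝒳.tier_mono h' (hs n x x.2)⟩ : 𝒳.tier r) : 𝒳.tier r) : 𝒳.Space) =
      f^[n] (𝒳.φ (h.trans h') g • x : 𝒳.tier t) := by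
  rw [← 𝒳.φ_trans h h', MonoidHom.comp_apply, ← hf.smul_iterate h hs x n]
  exact (𝒳.φ_smul h' ⟨f^[n] x, hs n x x.2⟩ g).symm

/-- The arena of points of the tier `t`, inside a gluing tier `r`. -/
theorem exists_arena (hf : 𝒳.IsEvolution f) (hstab : 𝒳.IsStabilizing f)
    (hglue : 𝒳.IsWeaklyGluing) (hnil : IsAsymptoticallyNilpotent 𝒳.zero f) (t : 𝒳.Index)
    {Δ₀ : ℝ} (hΔ₀ : 0 < Δ₀) :
    ∃ (r s : 𝒳.Index) (_ : t ≤ r) (_ : r ≤ s)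
      (𝔸 : Arena (𝒳.Grp r) (𝒳.tier r) 𝒳.Space), (∀ n x, 𝔸.pos n x = f^[n] x) ∧
      𝔸.zero = 𝒳.zeroAt r ∧ (∀ x : 𝒳.tier r, x ∈ 𝔸.base ↔ (x : 𝒳.Space) ∈ 𝒳.tier t) ∧
      𝔸.Δ ≤ Δ₀ ∧ ∀ k : ℕ, ∀ x ∈ 𝒳.tier r, f^[k] x ∈ 𝒳.tier s := by
  -- Points of `t` are glued in `r`, and all orbits of `r` stay in `s`. Expansivity of the single
  -- tier `s` therefore localizes all times at once.
  obtain ⟨r, htr, hr⟩ := hglue t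
  obtain ⟨s, hrs, hs⟩ := hstab r
  obtain ⟨Δ, hΔ, -, hexp⟩ := 𝒳.isExpansive s
  have hf0 : f 𝒳.zero = 𝒳.zero := hnil.map_zero hf.continuous
  have hf0' : ∀ n, f^[n] 𝒳.zero = 𝒳.zero := fun n => Function.iterate_fixed hf0 n
  have := (𝒳.isPointedSystem s).compact
  refine ⟨r, s, htr, hrs,
  { pos := fun n x => f^[n] x
    zero := 𝒳.zeroAt r
    base := {x | (x : 𝒳.Space) ∈ 𝒳.tier t}
    Δ := min Δ Δ₀
    Δ_pos := lt_min hΔ hΔ₀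
    smul_zero := (𝒳.isPointedSystem r).smul_zero
    pos_zero := fun n => hf0' n
    pos_injective := Subtype.coe_injective
    zero_mem := 𝒳.zero_mem t
    smul_mem := ?_
    loc := ?_
    continuous_step := ?_
    tendsto := fun x => hnil x
    glue := ?_ }, fun n x => rfl, rfl, fun x => Iff.rfl, min_le_right _ _, hs⟩
  · intro g x hx
    have := 𝒳.φ_smul htr ⟨x, hx⟩ g
    change ((g • x : 𝒳.tier r) : 𝒳.Space) ∈ 𝒳.tier t
    rw [← this]
    exact Subtype.coe_prop _
  · intro ε hε
    obtain ⟨B, hB⟩ := exists_finset_of_expansive (Δ := min Δ Δ₀)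
      (𝒳.isPointedSystem s).continuous_smul
      (fun x y h => hexp x y fun g => (h g).trans (min_le_left _ _)) hε
    refine ⟨𝒳.φ hrs '' B, B.finite_toSet.image _, fun n x y h => ?_⟩
    refine hB ⟨f^[n] x, hs n x x.2⟩ ⟨f^[n] y, hs n y y.2⟩ fun b hb => ?_
    rw [Subtype.dist_eq, hf.smul_iterate hrs hs, hf.smul_iterate hrs hs]
    exact h _ ⟨b, hb, rfl⟩
  · intro ε hε
    obtain ⟨δ, hδ, h⟩ := Metric.uniformContinuous_iff.1
      (CompactSpace.uniformContinuous_of_continuous hf.continuous) ε hε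
    refine ⟨δ, hδ, fun n x y hxy => ?_⟩
    simp only [Function.iterate_succ', Function.comp_apply]
    exact h hxy
  · intro ε hε
    obtain ⟨δ, hδ, E, hE⟩ := hr ε hε
    refine ⟨δ, hδ, E, E.finite_toSet, fun I A x hx hdisj hcov hnear => ?_⟩
    exact hE I A (fun i => ⟨x i, hx i⟩) ⟨hdisj, hcov, hnear⟩

/-- The orbits of the first arena remain in a tier `s`; a second arena with base `s` makes their
later states available for gluing. -/
theorem exists_arena_notNested (hf : 𝒳.IsEvolution f) (hstab : 𝒳.IsStabilizing f)
    (hglue : 𝒳.IsWeaklyGluing) (hnil : IsAsymptoticallyNilpotent 𝒳.zero f) (t : 𝒳.Index) :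
    ∃ (r : 𝒳.Index) (_ : t ≤ r) (𝔸 : Arena (𝒳.Grp r) (𝒳.tier r) 𝒳.Space),
      (∀ n x, 𝔸.pos n x = f^[n] x) ∧ 𝔸.zero = 𝒳.zeroAt r ∧
      (∀ x : 𝒳.tier r, x ∈ 𝔸.base ↔ (x : 𝒳.Space) ∈ 𝒳.tier t) ∧ 𝔸.NotNested := by
  obtain ⟨r, s, htr, hrs, 𝔸, hpos, hzero, hbase, -, hs⟩ :=
    exists_arena hf hstab hglue hnil t one_pos
  obtain ⟨r', s', hsr', -, 𝔹, hpos', hzero', hbase', hΔ, -⟩ :=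
    exists_arena hf hstab hglue hnil s (half_pos 𝔸.Δ_pos)
  refine ⟨r, htr, 𝔸, hpos, hzero, hbase, 𝔸.notNested_of_lift 𝔹 (𝒳.φ (hrs.trans hsr'))
    (𝒳.φ_surjective _) (by rw [hpos, hpos', hzero, hzero']; rfl) hΔ fun τ x =>
    ⟨⟨f^[τ] x, 𝒳.tier_mono hsr' (hs τ x x.2)⟩, (hbase' _).2 (hs τ x x.2), fun n g => ?_⟩⟩
  rw [hpos, hpos', hf.smul_iterate_of_le hrs hs hsr' x τ g, ← Function.iterate_add_apply,
    Nat.add_comm]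

theorem finite_supp_of_isHomoclinic {t r : 𝒳.Index} (h : t ≤ r) {q : 𝒳.tier t}
    (hq : IsHomoclinic (𝒳.Grp t) (𝒳.zeroAt t) q) {Δ : ℝ} (hΔ : 0 < Δ) :
    {g : 𝒳.Grp r | Δ < dist ((g • 𝒳.lift h q : 𝒳.tier r) : 𝒳.Space) 𝒳.zero}.Finite := by
  obtain ⟨E, hE⟩ := hq Δ hΔ
  refine Set.Finite.subset (Set.Finite.biUnion E.finite_toSet fun e _ => 𝒳.φ_finite h e) ?_
  intro g hg
  simp only [Set.mem_iUnion]
  by_contra hn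
  push Not at hn
  have h1 := hE (𝒳.φ h g) fun hmem => hn _ hmem rfl
  rw [Subtype.dist_eq, 𝒳.φ_smul h q g] at h1
  exact lt_asymm h1 hg

theorem exists_iterate_eq_zero (hf : 𝒳.IsEvolution f) (hstab : 𝒳.IsStabilizing f)
    (hglue : 𝒳.IsWeaklyGluing) (hnil : IsAsymptoticallyNilpotent 𝒳.zero f)
    (hres : ∀ t, Group.ResiduallyFinite (𝒳.Grp t)) (hsol : ∀ t, IsVirtuallySolvable (𝒳.Grp t))
    {t : 𝒳.Index} {q : 𝒳.tier t} (hq : IsHomoclinic (𝒳.Grp t) (𝒳.zeroAt t) q) :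
    ∃ m, f^[m] q = 𝒳.zero := by
  obtain ⟨r, htr, 𝔸, hpos, hzero, hbase, hn⟩ := exists_arena_notNested hf hstab hglue hnil t
  have := hres r
  have hfin : (𝔸.supp (𝒳.lift htr q)).Finite := by
    refine (finite_supp_of_isHomoclinic htr hq 𝔸.Δ_pos).subset fun g hg => ?_
    have hg' : ¬ 𝔸.agree 0 (𝒳.lift htr q) 𝔸.zero g := hg
    rw [Arena.agree, 𝔸.smul_zero, hpos, hpos, hzero, not_le] at hg'
    exact hg'
  obtain ⟨m, hm⟩ := Arena.mortal_of_finite_supp (hsol r) hn ((hbase _).2 q.2) hfin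
  refine ⟨m, ?_⟩
  have h1 := Arena.pos_eq_of_agree hm 1
  rw [one_smul, one_smul, 𝔸.pos_zero, hpos, hpos, hzero] at h1
  exact h1

/-- Baire category in the closure of the union of the tiers: one of the closed sets of points that
stay within `Δ` of zero from time `N` on has interior, and homoclinic points are dense. -/
theorem exists_uniform_homoclinic (hf : 𝒳.IsEvolution f) (hhom : 𝒳.HasWeaklyDenseHomoclinic)
    (hnil : IsAsymptoticallyNilpotent 𝒳.zero f) {Δ : ℝ} (hΔ : 0 < Δ) :
    ∃ (N : ℕ) (ρ : ℝ) (t : 𝒳.Index) (q : 𝒳.tier t), 0 < ρ ∧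
      IsHomoclinic (𝒳.Grp t) (𝒳.zeroAt t) q ∧
      ∀ (r : 𝒳.Index) (y : 𝒳.tier r), dist (y : 𝒳.Space) q < ρ → ∀ n ≥ N,
        dist (f^[n] y) 𝒳.zero ≤ Δ := by
  let X : Set 𝒳.Space := closure (⋃ t, 𝒳.tier t)
  have hX : ∀ t, 𝒳.tier t ⊆ X := fun t => (Set.subset_iUnion _ t).trans subset_closure
  have : CompactSpace X := isCompact_iff_compactSpace.1 isClosed_closure.isCompact
  have : Nonempty X := ⟨⟨𝒳.zero, hX ⊥ (𝒳.zero_mem ⊥)⟩⟩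
  obtain ⟨N, ⟨x₀, hx₀⟩⟩ := nonempty_interior_of_iUnion_of_closed
    (f := fun N : ℕ => {x : X | ∀ n ≥ N, dist (f^[n] x) 𝒳.zero ≤ Δ}) (by
      intro N
      simp only [Set.ofPred_forall]
      refine isClosed_iInter fun n => isClosed_iInter fun _ => isClosed_le ?_ continuous_const
      exact ((hf.continuous.iterate n).comp continuous_subtype_val).dist continuous_const) (by
      refine Set.eq_univ_of_forall fun x => Set.mem_iUnion.2 ?_
      obtain ⟨N, hN⟩ := Metric.tendsto_atTop.1 (hnil x) Δ hΔ
      exact ⟨N, fun n hn => (hN n hn).le⟩)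
  obtain ⟨ρ, hρ, hball⟩ := Metric.isOpen_iff.1 isOpen_interior x₀ hx₀
  obtain ⟨x₁, hx₁, hd₁⟩ := Metric.mem_closure_iff.1 x₀.2 (ρ / 4) (by linarith)
  obtain ⟨t₁, ht₁⟩ := Set.mem_iUnion.1 hx₁
  obtain ⟨t, -, q, hd₂, hq⟩ := hhom t₁ ⟨x₁, ht₁⟩ (ρ / 4) (by linarith)
  refine ⟨N, ρ / 2, t, q, by linarith, hq, fun r y hy => ?_⟩
  have hmem : (⟨y, hX r y.2⟩ : X) ∈ Metric.ball x₀ ρ := by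
    rw [Metric.mem_ball, Subtype.dist_eq, dist_comm]
    have h1 := dist_triangle (x₀ : 𝒳.Space) x₁ y
    have h2 := dist_triangle x₁ (q : 𝒳.Space) y
    rw [dist_comm (y : 𝒳.Space)] at hy
    simp only at hd₂ ⊢
    linarith
  exact interior_subset (hball hmem)

/-- A point of the tier `s` which is small on a suitable finite set stays small from some time on,
since it can be superposed with a dying homoclinic point. -/
theorem exists_uniform_bound (hf : 𝒳.IsEvolution f) (hstab : 𝒳.IsStabilizing f)
    (hglue : 𝒳.IsWeaklyGluing) (hhom : 𝒳.HasWeaklyDenseHomoclinic)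
    (hnil : IsAsymptoticallyNilpotent 𝒳.zero f)
    (hres : ∀ t, Group.ResiduallyFinite (𝒳.Grp t)) (hsol : ∀ t, IsVirtuallySolvable (𝒳.Grp t))
    (s : 𝒳.Index) {Δ : ℝ} (hΔ : 0 < Δ) :
    ∃ (r : 𝒳.Index) (hsr : s ≤ r) (D : Set (𝒳.Grp r)) (δ : ℝ) (N : ℕ), D.Finite ∧ 0 < δ ∧
      ∀ z : 𝒳.tier s, (∀ g ∈ D, dist ((g • 𝒳.lift hsr z : 𝒳.tier r) : 𝒳.Space) 𝒳.zero ≤ δ) →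
        ∀ n ≥ N, dist (f^[n] z) 𝒳.zero ≤ Δ := by
  obtain ⟨N, ρ, t, q, hρ, hq, hN⟩ := exists_uniform_homoclinic hf hhom hnil hΔ
  obtain ⟨m, hm⟩ := exists_iterate_eq_zero hf hstab hglue hnil hres hsol hq
  obtain ⟨t', htt', hst'⟩ := exists_ge_ge t s
  obtain ⟨r, -, htr, -, 𝔸, hpos, hzero, hbase, -, -⟩ :=
    exists_arena hf hstab hglue hnil t' one_pos
  have hagree : ∀ (n : ℕ) (x : 𝒳.tier r) (g : 𝒳.Grp r), 𝔸.agree n x 𝔸.zero g ↔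
      dist (f^[n] (g • x : 𝒳.tier r)) 𝒳.zero ≤ 𝔸.Δ := by
    intro n x g
    rw [Arena.agree, 𝔸.smul_zero, 𝔸.pos_zero, hpos, hpos, hzero]
    rfl
  set Q := 𝒳.lift (htt'.trans htr) q with hQ
  have hfin : (𝔸.supp Q).Finite := by
    refine (finite_supp_of_isHomoclinic (htt'.trans htr) hq 𝔸.Δ_pos).subset fun g hg => ?_
    simp only [Arena.supp, Set.mem_ofPred_eq, hagree] at hg
    exact not_le.1 hg
  obtain ⟨B, hBf, hB⟩ := 𝔸.loc ρ hρ
  -- Smallness on the first part keeps `z` apart from `Q` until `Q` is dead. Smallness on the second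
  -- keeps `z` off the window `B`, so that the superposition is `ρ`-close to `q`.
  set D : Set (𝒳.Grp r) := (𝔸.spread (m + 1))⁻¹ * (𝔸.spread (m + 1) * 𝔸.supp Q) ∪
    (𝔸.spread 0)⁻¹ * B with hD
  refine ⟨r, hst'.trans htr, D, 𝔸.Δ, max N (m + 1), ?_, 𝔸.Δ_pos, fun z hz n hn => ?_⟩
  · exact ((𝔸.spread_finite _).inv.mul ((𝔸.spread_finite _).mul hfin)).union
      ((𝔸.spread_finite _).inv.mul hBf)
  set z' := 𝒳.lift (hst'.trans htr) z with hz'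
  have hzD : ∀ g ∈ D, g ∉ 𝔸.supp z' := by
    intro g hg hgs
    exact hgs ((hagree 0 z' g).2 (hz g hg))
  have hQdead : ∀ n, m ≤ n → ∀ g, 𝔸.agree n Q 𝔸.zero g := by
    intro n hn
    refine Arena.agree_mono hn fun g => (hagree m Q g).2 ?_
    obtain ⟨s', hts', hs'⟩ := hstab t
    have h1 := hf.smul_iterate hts' hs' q m
    -- The tier `r` need not contain the orbit of `q`, so equivariance of the iterates is applied in
    -- a common higher tier.
    obtain ⟨r', hrr', hsr'⟩ := exists_ge_ge r s'
    obtain ⟨g', rfl⟩ := 𝒳.φ_surjective hrr' g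
    have h2 := hf.smul_iterate_of_le hts' hs' hsr' q m g'
    have h3 : ((𝒳.φ hrr' g' • Q : 𝒳.tier r) : 𝒳.Space) =
        (𝒳.φ (hts'.trans hsr') g' • q : 𝒳.tier t) := by
      rw [𝒳.φ_smul hrr' Q g', 𝒳.φ_smul (hts'.trans hsr') q g']
      rfl
    rw [h3, ← h2]
    have h4 : (⟨f^[m] q, 𝒳.tier_mono hsr' (hs' m q q.2)⟩ : 𝒳.tier r') = 𝒳.zeroAt r' :=
      Subtype.ext hm
    rw [h4]
    have h5 := (𝒳.isPointedSystem r').smul_zero g'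
    change dist ((g' • (⟨𝒳.zero, 𝒳.zero_mem r'⟩ : 𝒳.tier r') : 𝒳.tier r') : 𝒳.Space) _ ≤ _
    rw [h5]
    simpa using 𝔸.Δ_pos.le
  have hfar : ∀ n ≤ m, Disjoint (𝔸.spread (n + 1) * 𝔸.supp Q) (𝔸.spread (n + 1) * 𝔸.supp z') := by
    intro n hn
    refine Set.disjoint_left.2 ?_
    rintro x hx ⟨w, hw, u, hu, rfl⟩
    refine hzD u (Or.inl ⟨w⁻¹, ?_, w * u, Set.mul_subset_mul_right
      (𝔸.spread_mono (Nat.succ_le_succ hn)) hx, by simp⟩) hu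
    simpa using 𝔸.spread_mono (Nat.succ_le_succ hn) hw
  let Y : ULift.{c} Bool → 𝒳.tier r := fun i => bif i.down then Q else z'
  obtain ⟨y, hy⟩ := 𝔸.exists_superposition Y
    (by
      rintro ⟨_ | _⟩
      · exact (hbase _).2 (𝒳.tier_mono hst' z.2)
      · exact (hbase _).2 (𝒳.tier_mono htt' q.2))
    (fun i n => i.down = true → n ≤ m) (fun i n h hi => by have := h hi; omega)
    (fun i _ => Nat.zero_le m)
    (by
      rintro ⟨_ | _⟩ n h
      · exact (h fun hc => by simp at hc).elim
      · refine hQdead n ?_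
        by_contra hlt
        exact h fun _ => by omega)
    (by
      rintro ⟨_ | _⟩ ⟨_ | _⟩ n hij hi hj
      · exact (hij rfl).elim
      · exact (hfar n (hj rfl)).symm
      · exact hfar n (hi rfl)
      · exact (hij rfl).elim)
  have hyz : ∀ n, m + 1 ≤ n → f^[n] y = f^[n] z := by
    intro n hn
    have hall : ∀ g, 𝔸.agree n y z' g := by
      intro g
      by_cases hg : g ∈ 𝔸.spread n * 𝔸.supp z'
      · exact Arena.agree_of_close' ((hy n).1 ⟨false⟩ (fun h => by simp at h) g hg)
      · refine Arena.agree_of_close ((hy n).2 g ?_) (Arena.close.symm ?_)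
        · rintro ⟨_ | _⟩ hi
          · exact hg
          · have := hi rfl
            omega
        · by_contra hc
          exact hg (𝔸.mem_spread_of_not_close _ _ _ hc)
    have := Arena.pos_eq_of_agree hall 1
    rwa [one_smul, one_smul, hpos, hpos] at this
  have hyq : dist (y : 𝒳.Space) q < ρ := by
    have := hB 0 y Q fun b hb => by
      by_cases hb' : b ∈ 𝔸.spread 0 * 𝔸.supp Q
      · exact Arena.agree_of_close' ((hy 0).1 ⟨true⟩ (fun _ => Nat.zero_le m) b hb')
      · refine Arena.agree_of_close (𝔸 := 𝔸) ((hy 0).2 b ?_) (Arena.close.symm ?_)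
        · rintro ⟨_ | _⟩ hi
          · rintro ⟨w, hw, u, hu, rfl⟩
            exact hzD u (Or.inr ⟨w⁻¹, by simpa using hw, w * u, hb, by simp⟩) hu
          · exact hb'
        · by_contra hc
          exact hb' (𝔸.mem_spread_of_not_close _ _ _ hc)
    rwa [hpos, hpos] at this
  rw [← hyz n (le_trans (le_max_right _ _) hn)]
  exact hN r y hyq n (le_trans (le_max_left _ _) hn)

/-- Without nilpotency there are points still large at any given late time. By
`exists_uniform_bound` such a point cannot be small on `D` much earlier, and compactness produces
one point that is never small on the finite set `D`. -/
theorem isNilpotentOn_tier (hf : 𝒳.IsEvolution f) (hstab : 𝒳.IsStabilizing f)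
    (hglue : 𝒳.IsWeaklyGluing) (hhom : 𝒳.HasWeaklyDenseHomoclinic)
    (hnil : IsAsymptoticallyNilpotent 𝒳.zero f)
    (hres : ∀ t, Group.ResiduallyFinite (𝒳.Grp t)) (hsol : ∀ t, IsVirtuallySolvable (𝒳.Grp t))
    (t : 𝒳.Index) : IsNilpotentOn 𝒳.zero f (𝒳.tier t) := by
  obtain ⟨s, hts, hs⟩ := hstab t
  obtain ⟨Δ, hΔ, -, hexp⟩ := 𝒳.isExpansive s
  obtain ⟨r, hsr, D, δ, N, hD, hδ, hb⟩ :=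
    exists_uniform_bound hf hstab hglue hhom hnil hres hsol s hΔ
  have hcpt := (𝒳.isPointedSystem t).compact
  by_contra hcon
  have hbig : ∀ n, ∃ x : 𝒳.tier t, Δ < dist (f^[n] x) 𝒳.zero := by
    intro n
    by_contra hn
    push Not at hn
    refine hcon ⟨n, fun x hx => ?_⟩
    have h0 : (⟨f^[n] x, hs n x hx⟩ : 𝒳.tier s) = ⟨𝒳.zero, 𝒳.zero_mem s⟩ := by
      refine hexp _ _ fun g => ?_
      rw [(𝒳.isPointedSystem s).smul_zero, Subtype.dist_eq]
      exact (congrArg (dist · 𝒳.zero) (hf.smul_iterate hts hs ⟨x, hx⟩ n g)).trans_le (hn _)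
    exact congrArg Subtype.val h0
  let L : ℕ → Set (𝒳.tier t) := fun n =>
    {x | ∀ j ≤ n, ∃ g ∈ D, δ ≤ dist (f^[j] (𝒳.φ (hts.trans hsr) g • x : 𝒳.tier t)) 𝒳.zero}
  have hclosed : ∀ n, IsClosed (L n) := by
    intro n
    have : L n = ⋂ j, ⋂ (_ : j ≤ n), ⋃ g ∈ D,
        {x | δ ≤ dist (f^[j] (𝒳.φ (hts.trans hsr) g • x : 𝒳.tier t)) 𝒳.zero} := by
      ext x; simp [L]
    rw [this]
    refine isClosed_iInter fun j => isClosed_iInter fun _ => hD.isClosed_biUnion fun g _ =>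
      isClosed_le continuous_const ?_
    exact ((hf.continuous.iterate j).comp (continuous_subtype_val.comp
      ((𝒳.isPointedSystem t).continuous_smul _))).dist continuous_const
  obtain ⟨x, hx⟩ := IsCompact.nonempty_iInter_of_sequence_nonempty_isCompact_isClosed L
    (fun n x hx j hj => hx j (by omega)) (by
      intro n
      obtain ⟨x, hx⟩ := hbig (n + N)
      refine ⟨x, fun j hj => ?_⟩
      by_contra hno
      push Not at hno
      have := hb ⟨f^[j] x, hs j x x.2⟩ (fun g hg => by
        have h1 := hf.smul_iterate_of_le hts hs hsr x j g
        exact (congrArg (dist · 𝒳.zero) h1).trans_le (hno g hg).le) (n + N - j) (by omega)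
      rw [← Function.iterate_add_apply, Nat.sub_add_cancel (by omega)] at this
      exact absurd hx (not_lt.2 this)) (hclosed 0).isCompact hclosed
  have hev : ∀ g : 𝒳.Grp r, ∃ N, ∀ n ≥ N,
      dist (f^[n] (𝒳.φ (hts.trans hsr) g • x : 𝒳.tier t)) 𝒳.zero < δ := fun g =>
    Metric.tendsto_atTop.1 (hnil _) δ hδ
  choose M hM using hev
  obtain ⟨g, hg, hgx⟩ := Set.mem_iInter.1 hx (hD.toFinset.sup M) _ le_rfl
  exact absurd (hM g _ (Finset.le_sup (f := M) (hD.mem_toFinset.2 hg))) (not_lt.2 hgx)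

end TDS

/-- Residual finiteness gives a finite-index subgroup meeting the finite kernel trivially. This
passes virtual solvability from the base group to all groups of the tiers. -/
theorem IsVirtuallySolvable.of_finite_ker {Γ : Type u} {G : Type v} [Group Γ] [Group G]
    [Group.ResiduallyFinite Γ] (hG : IsVirtuallySolvable G) (ψ : Γ →* G)
    (hψ : (ψ.ker : Set Γ).Finite) : IsVirtuallySolvable Γ := by
  obtain ⟨H, hH, hsol⟩ := hG
  obtain ⟨K, -, hK, hKX⟩ := Group.exists_normal_finiteIndex_avoiding hψ
  have : (H.comap ψ).FiniteIndex := ⟨by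
    rw [Subgroup.index_comap]
    exact fun h => hH.index_ne_zero (Subgroup.index_eq_zero_of_relIndex_eq_zero h)⟩
  refine ⟨H.comap ψ ⊓ K, inferInstance, ?_⟩
  let θ : (H.comap ψ ⊓ K : Subgroup Γ) →* H :=
    (ψ.comp (Subgroup.subtype _)).codRestrict H fun x => x.2.1
  refine Group.isSolvable_of_isSolvable_injective (f := θ)
    ((injective_iff_map_eq_one θ).2 fun x hx => ?_)
  by_contra hne
  refine hKX x ?_ (fun h => hne (Subtype.ext h)) x.2.2
  exact congrArg Subtype.val hx

theorem isNilRigidGroupOn_classC3 {G : Type u} [Group G] (hG : IsVirtuallySolvable G) :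
    IsNilRigidGroupOn G classC3.{a, b, c} := by
  rintro 𝒳 ⟨e⟩ f hf ⟨⟨hstab, hglue, hhom⟩, hres⟩ hnil t
  refine TDS.isNilpotentOn_tier hf hstab hglue hhom hnil hres (fun t => ?_) t
  have := hres t
  refine hG.of_finite_ker (e.toMonoidHom.comp (𝒳.φ (bot_le : ⊥ ≤ t))) ?_
  refine (𝒳.φ_finite (bot_le : ⊥ ≤ t) 1).subset fun g hg => ?_
  have : e (𝒳.φ bot_le g) = 1 := hg
  simpa using this

end

/-! ### Systems with shadowing -/

/-- The action of `G` on the whole space as a subset of itself. -/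
abbrev singleTierAction (G : Type u) (X : Type v) [Group G] [MulAction G X] :
    MulAction G (Set.univ : Set X) where
  smul g x := ⟨g • x.1, trivial⟩
  one_smul x := Subtype.ext (one_smul G x.1)
  mul_smul g h x := Subtype.ext (mul_smul g h x.1)

/-- A pointed dynamical system as a tiered system with a single tier. -/
def singleTier (G : Type u) (X : Type v) [Group G] [MetricSpace X] [CompactSpace X]
    [MulAction G X] (o : X) (h : IsPointedSystem G X o) (hexp : IsExpansive G X) :
    TDS.{v, 0, u} :=
  letI := singleTierAction G X
  { Space := X
    zero := o
    Index := PUnit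
    Grp := fun _ => G
    tier := fun _ => Set.univ
    zero_mem := fun _ => trivial
    isPointedSystem := fun _ =>
      ⟨isCompact_iff_compactSpace.1 isCompact_univ,
        fun g => ((h.continuous_smul g).comp continuous_subtype_val).subtype_mk _,
        fun g => Subtype.ext (h.smul_zero g)⟩
    isExpansive := fun _ => by
      obtain ⟨Δ, h0, h1, hΔ⟩ := hexp
      exact ⟨Δ, h0, h1, fun x y hxy => Subtype.ext (hΔ x y hxy)⟩
    tier_mono := fun _ => subset_rfl
    φ := fun _ => MonoidHom.id G
    φ_surjective := fun _ => Function.surjective_id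
    φ_finite := fun _ g => Set.finite_singleton g
    φ_refl := fun _ => rfl
    φ_trans := fun _ _ => rfl
    φ_smul := fun _ _ _ => rfl }

/-- A designation defines the pseudo-orbit `g ↦ g • x (i g)`, where `g ∈ A (i g)`. It is exact
except at transitions between pieces, where both values are near the fixed point `o`. -/
theorem HasShadowing.exists_realization {G : Type u} {X : Type v} [Group G] [MetricSpace X]
    [MulAction G X] {o : X} (h : IsPointedSystem G X o) (hsh : HasShadowing G X) {ε : ℝ}
    (hε : 0 < ε) : ∃ δ : ℝ, 0 < δ ∧ ∃ E : Finset G, ∀ (I : Type w) (A : I → Set G) (x : I → X),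
      IsDesignation o δ (E : Set G) A x → ∃ y : X, IsRealization ε A x y := by
  classical
  obtain ⟨δ, hδ, S, hS⟩ := hsh ε hε
  have hcont : ∀ s : G, ∃ η : ℝ, 0 < η ∧ ∀ x : X, dist x o < η → dist (s • x) o < δ / 2 := by
    intro s
    obtain ⟨η, hη, hs⟩ := Metric.continuousAt_iff.1 (h.continuous_smul s).continuousAt (δ / 2)
      (half_pos hδ)
    refine ⟨η, hη, fun x hx => ?_⟩
    have := hs hx
    rwa [h.smul_zero] at this
  choose η hη hηs using hcont
  have hmin : ∃ δ' : ℝ, 0 < δ' ∧ δ' ≤ δ / 2 ∧ ∀ s ∈ S, δ' ≤ η s := by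
    clear hS
    induction S using Finset.induction_on with
    | empty => exact ⟨δ / 2, half_pos hδ, le_rfl, by simp⟩
    | insert s S _ ih =>
      obtain ⟨δ', h1, h2, h3⟩ := ih
      refine ⟨min δ' (η s), lt_min h1 (hη s), (min_le_left _ _).trans h2, fun s' hs' => ?_⟩
      rcases Finset.mem_insert.1 hs' with rfl | hs'
      · exact min_le_right _ _
      · exact (min_le_left _ _).trans (h3 s' hs')
  obtain ⟨δ', hδ', hδ'δ, hδ'η⟩ := hmin
  -- Inverses are included so that, when `g` and `s * g` lie in different pieces, both are border
  -- elements.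
  refine ⟨δ', hδ', S ∪ S.image (·⁻¹), fun I A x hd => ?_⟩
  choose i hi using hd.cover
  have hiu : ∀ g j, g ∈ A j → i g = j := by
    intro g j hg
    by_contra hne
    exact Set.disjoint_left.1 (hd.disjoint _ _ hne) (hi g) hg
  obtain ⟨y, hy⟩ := hS (fun g => g • x (i g)) (by
    intro g s hs
    by_cases hg : s * g ∈ A (i g)
    · rw [hiu _ _ hg, mul_smul, dist_self]
      exact hδ
    · have h1 : dist (g • x (i g)) o < δ' :=
        hd.near _ g ⟨hi g, s, by simp [hs], hg⟩
      have h2 : dist ((s * g) • x (i (s * g))) o < δ' := by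
        refine hd.near _ (s * g) ⟨hi _, s⁻¹, by simp [hs], fun hmem => hg ?_⟩
        rw [inv_mul_cancel_left] at hmem
        rw [hiu _ _ hmem]
        exact hi _
      have h3 := hηs s _ (h1.trans_le (hδ'η s hs))
      have := dist_triangle_right (s • g • x (i g)) ((s * g) • x (i (s * g))) o
      linarith)
  refine ⟨y, fun j g hg => ?_⟩
  have := hy g
  rw [hiu g j hg, dist_comm] at this
  exact this

theorem isNilpotentOn_of_shadowing {G : Type u} [Group G] [hres : Group.ResiduallyFinite G]
    (hG : IsVirtuallySolvable G) {X : Type v} [MetricSpace X] [MulAction G X] {o : X}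
    (h : IsPointedSystem G X o) (hexp : IsExpansive G X) (hsh : HasShadowing G X)
    (hdense : Dense {x : X | IsHomoclinic G o x}) {f : X → X} (hf : IsEndomorphism G o f)
    (hnil : IsAsymptoticallyNilpotent o f) : IsNilpotentOn o f Set.univ := by
  have := h.compact
  have hdist : ∀ (x : X) (ε : ℝ), 0 < ε → ∃ y, dist x y < ε ∧ IsHomoclinic G o y := by
    intro x ε hε
    obtain ⟨y, hy, hxy⟩ := Metric.dense_iff.1 hdense x ε hε
    exact ⟨y, by rwa [Metric.mem_ball, dist_comm] at hy, hxy⟩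
  let 𝒳 := singleTier G X o h hexp
  have hev : 𝒳.IsEvolution f := ⟨hf.continuous, fun _ x _ g => hf.map_smul g x.1⟩
  refine isNilRigidGroupOn_classC3 hG 𝒳 ⟨MulEquiv.refl G⟩ f hev ⟨⟨?_, ?_, ?_⟩, fun _ => hres⟩ hnil
    PUnit.unit
  · exact fun t => ⟨t, le_rfl, fun _ _ _ => trivial⟩
  · intro t
    refine ⟨t, le_rfl, fun ε hε => ?_⟩
    obtain ⟨δ, hδ, E, hE⟩ := hsh.exists_realization h hε
    refine ⟨δ, hδ, E, fun I A x hd => ?_⟩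
    obtain ⟨y, hy⟩ := hE I A (fun i => (x i).1) ⟨hd.disjoint, hd.cover, hd.near⟩
    exact ⟨⟨y, trivial⟩, hy⟩
  · intro t x ε hε
    obtain ⟨y, hy, hxy⟩ := hdist x.1 ε hε
    exact ⟨t, le_rfl, ⟨y, trivial⟩, hy, hxy⟩

/-! ### Symbolic systems -/

/-- Compactness, applied to a cover by cylinders; it supplies the finite windows of the subshift, of
the local rule and of the metric. -/
theorem exists_finset_of_locally {ι : Type u} {A : Type w} [TopologicalSpace A]
    [DiscreteTopology A] {Q : Type v} [TopologicalSpace Q] [CompactSpace Q] {e : Q → ι → A}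
    (he : IsInducing e) {r : Q → Q → Prop}
    (hr : ∀ x, ∃ U ∈ 𝓝 x, ∀ y ∈ U, ∀ y' ∈ U, r y y') :
    ∃ F : Finset ι, ∀ y y', (∀ i ∈ F, e y i = e y' i) → r y y' := by
  classical
  have hcyl : ∀ x, ∃ F : Finset ι, ∀ y y', (∀ i ∈ F, e y i = e x i) → (∀ i ∈ F, e y' i = e x i) →
      r y y' := by
    intro x
    obtain ⟨U, hU, hUr⟩ := hr x
    rw [he.nhds_eq_comap, mem_comap] at hU
    obtain ⟨V, hV, hVU⟩ := hU
    obtain ⟨O, hOV, hO, hxO⟩ := mem_nhds_iff.1 hV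
    obtain ⟨F, u, hu, hFsub⟩ := isOpen_pi_iff.1 hO _ hxO
    refine ⟨F, fun y y' hy hy' => hUr y (hVU (hOV (hFsub ?_))) y' (hVU (hOV (hFsub ?_)))⟩
    · exact fun i hi => by rw [hy i hi]; exact (hu i hi).2
    · exact fun i hi => by rw [hy' i hi]; exact (hu i hi).2
  choose F hF using hcyl
  obtain ⟨t, ht⟩ := isCompact_univ.elim_finite_subcover
    (fun x => e ⁻¹' SymbolicDynamics.FullShift.cylinder (F x) (e x))
    (fun x => (SymbolicDynamics.FullShift.isOpen_cylinder _ _).preimage he.continuous)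
    (fun x _ => Set.mem_iUnion.2 ⟨x, fun _ _ => rfl⟩)
  refine ⟨t.biUnion F, fun y y' hyy => ?_⟩
  obtain ⟨x, hx, hxy⟩ := Set.mem_iUnion₂.1 (ht (Set.mem_univ y))
  refine hF x y y' hxy fun i hi => ?_
  rw [← hyy i (Finset.mem_biUnion.2 ⟨x, hx, hi⟩)]
  exact hxy i hi

theorem exists_dist_of_continuous {Q : Type v} [MetricSpace Q] [CompactSpace Q] {A : Type w}
    [TopologicalSpace A] [DiscreteTopology A] {p : Q → A} (hp : Continuous p) :
    ∃ δ : ℝ, 0 < δ ∧ ∀ x y, dist x y < δ → p x = p y := by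
  have hopen : IsOpen {x : Q × Q | p x.1 = p x.2} := by
    have : {x : Q × Q | p x.1 = p x.2} =
        (fun x : Q × Q => (p x.1, p x.2)) ⁻¹' {q : A × A | q.1 = q.2} := rfl
    rw [this]
    exact (isOpen_discrete _).preimage (by fun_prop)
  have hK : IsCompact {x : Q × Q | p x.1 = p x.2}ᶜ := hopen.isClosed_compl.isCompact
  rcases Set.eq_empty_or_nonempty {x : Q × Q | p x.1 = p x.2}ᶜ with h | h
  · refine ⟨1, one_pos, fun x y _ => ?_⟩
    by_contra hne
    have : (x, y) ∈ {x : Q × Q | p x.1 = p x.2}ᶜ := hne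
    rw [h] at this
    exact this
  · obtain ⟨⟨x₀, y₀⟩, hx₀, hmin⟩ := hK.exists_isMinOn h
      (continuous_fst.dist continuous_snd).continuousOn
    refine ⟨dist x₀ y₀, dist_pos.2 fun hxy => hx₀ (by simp [hxy]), fun x y hxy => ?_⟩
    by_contra hne
    exact absurd hxy (not_lt.2 (hmin (a := (x, y)) hne))

/-- The nilpotency theorem for a shift of finite type, given by an embedding `e` into a full
shift. -/
theorem isNilpotentOn_of_symbolic {G : Type u} [Group G] [Group.ResiduallyFinite G]
    (hG : IsVirtuallySolvable G) {A : Type w} [TopologicalSpace A] [DiscreteTopology A] {z : A}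
    {Q : Type v} [MetricSpace Q] [CompactSpace Q] [MulAction G Q] {e : Q → G → A}
    (he : IsEmbedding e) (hsmul : ∀ g x h, e (g • x) h = e x (g⁻¹ * h)) {o : Q}
    (ho : ∀ h, e o h = z) {W : Finset G}
    (hW : ∀ y : G → A, (∀ g, ∃ x, ∀ w ∈ W, y (g * w) = e x w) → ∃ x, e x = y)
    (hdense : ∀ x, ∀ F : Finset G, ∃ y, {g | e y g ≠ z}.Finite ∧ ∀ h ∈ F, e y h = e x h)
    {f : Q → Q} (hf : Continuous f) (hfsmul : ∀ (g : G) x, f (g • x) = g • f x)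
    (hnil : IsAsymptoticallyNilpotent o f) : IsNilpotentOn o f Set.univ := by
  classical
  have heq : ∀ {x y}, (∀ h, e x h = e y h) → x = y := fun h => he.injective (funext h)
  have hpt : IsPointedSystem G Q o := by
    refine ⟨inferInstance, fun g => he.continuous_iff.2 ?_, fun g => heq fun h => by
      rw [hsmul, ho, ho]⟩
    refine continuous_pi fun h => ?_
    simp only [Function.comp_def, hsmul]
    exact (continuous_apply _).comp he.continuous
  have hloc : ∀ ε : ℝ, 0 < ε → ∃ F : Finset G, ∀ x y, (∀ h ∈ F, e x h = e y h) →
      dist x y < ε := by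
    intro ε hε
    refine exists_finset_of_locally he.isInducing fun x =>
      ⟨Metric.ball x (ε / 2), Metric.ball_mem_nhds _ (half_pos hε), fun y hy y' hy' => ?_⟩
    have := dist_triangle_right y y' x
    rw [Metric.mem_ball] at hy hy'
    linarith
  obtain ⟨Δ, hΔ, hΔe⟩ := exists_dist_of_continuous
    ((continuous_apply (1 : G)).comp he.continuous)
  refine isNilpotentOn_of_shadowing hG hpt ?_ ?_ ?_ ⟨hf, hnil.map_zero hf, hfsmul⟩ hnil
  · refine ⟨min (Δ / 2) 1, lt_min (half_pos hΔ) one_pos, min_le_right _ _,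
      fun x y hxy => heq fun h => ?_⟩
    have := hΔe (h⁻¹ • x) (h⁻¹ • y) (((hxy h⁻¹).trans (min_le_left _ _)).trans_lt (by linarith))
    simpa [hsmul] using this
  · intro ε hε
    obtain ⟨F, hF⟩ := hloc ε hε
    refine ⟨Δ, hΔ, (F ∪ W).image (·⁻¹), fun x hx => ?_⟩
    have hxe : ∀ g, ∀ h ∈ F ∪ W, e (x (h⁻¹ * g)) 1 = e (x g) h := by
      intro g h hh
      have := hΔe _ _ (hx g h⁻¹ (Finset.mem_image_of_mem _ hh))
      simp only [Function.comp_apply, hsmul] at this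
      simpa using this.symm
    -- The shadowing configuration reads the symbol at `1` along the pseudo-orbit. The pseudo-orbit
    -- condition over `W` makes each of its `W`-windows admissible.
    obtain ⟨y, hy⟩ := hW (fun h => e (x h⁻¹) 1) fun g => ⟨x g⁻¹, fun w hw => by
      simpa using hxe g⁻¹ w (Finset.mem_union_right _ hw)⟩
    refine ⟨y, fun g => hF _ _ fun h hh => ?_⟩
    rw [hsmul, hy, ← hxe g h (Finset.mem_union_left _ hh)]
    simp
  · refine Metric.dense_iff.2 fun x ε hε => ?_
    obtain ⟨F, hF⟩ := hloc ε hε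
    obtain ⟨y, hyfin, hy⟩ := hdense x F
    refine ⟨y, Metric.mem_ball.2 (hF _ _ hy), fun η hη => ?_⟩
    obtain ⟨F', hF'⟩ := hloc η hη
    refine ⟨(F' ×ˢ hyfin.toFinset).image fun p => p.1 * p.2⁻¹, fun g hg => hF' _ _ fun h hh => ?_⟩
    rw [hsmul, ho]
    by_contra hne
    refine hg (Finset.mem_image.2 ⟨(h, g⁻¹ * h), Finset.mem_product.2
      ⟨hh, hyfin.mem_toFinset.2 hne⟩, by simp⟩)

/-! ### Cellular automata over possibly uncountable groups. -/

section
open SymbolicDynamics.FullShift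

theorem Subgroup.countable_closure {G : Type u} [Group G] {S : Set G} (hS : S.Countable) :
    Countable (Subgroup.closure S) := by
  have hT : (S ∪ {x | x⁻¹ ∈ S}).Countable := by
    refine hS.union (hS.preimage_of_injOn (inv_injective.injOn) : (Inv.inv ⁻¹' S).Countable)
  have := hT.to_subtype
  have hsub : ((Subgroup.closure S : Subgroup G) : Set G) ⊆
      Set.range fun l : List ↥(S ∪ {x | x⁻¹ ∈ S}) => (l.map Subtype.val).prod := by
    intro x hx
    rw [SetLike.mem_coe, ← Subgroup.mem_toSubmonoid, Subgroup.closure_toSubmonoid] at hx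
    obtain ⟨l, hl, rfl⟩ := Submonoid.exists_list_of_mem_closure hx
    refine ⟨l.attach.map fun y => ⟨y.1, hl y.1 y.2⟩, ?_⟩
    simp [Function.comp_def]
  exact ((Set.countable_range _).mono hsub).to_subtype

/-- The configuration which is `x` on the subgroup `H` and `z` elsewhere. -/
noncomputable def extendBy {G : Type u} [Group G] {A : Type w} (H : Subgroup G) (z : A)
    (x : H → A) : G → A :=
  open Classical in fun g => if h : g ∈ H then x ⟨g, h⟩ else z

section extendBy

variable {G : Type u} [Group G] {A : Type w} {H : Subgroup G} {z : A}

theorem extendBy_of_mem (x : H → A) {g : G} (hg : g ∈ H) : extendBy H z x g = x ⟨g, hg⟩ :=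
  dif_pos hg

theorem extendBy_coe (x : H → A) (g : H) : extendBy H z x g = x g := extendBy_of_mem x g.2

theorem extendBy_of_notMem (x : H → A) {g : G} (hg : g ∉ H) : extendBy H z x g = z := dif_neg hg

theorem continuous_extendBy [TopologicalSpace A] : Continuous (extendBy H z) := by
  refine continuous_pi fun g => ?_
  by_cases hg : g ∈ H
  · simp only [extendBy_of_mem _ hg]
    exact continuous_apply _
  · simp only [extendBy_of_notMem _ hg]
    exact continuous_const

theorem mulShift_extendBy (x : H → A) (g : H) :
    mulShift (g : G) (extendBy H z x) = extendBy H z fun h => x (g * h) := by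
  ext h
  rw [mulShift_apply]
  by_cases hh : h ∈ H
  · rw [extendBy_of_mem _ hh, extendBy_of_mem _ (H.mul_mem g.2 hh)]
    rfl
  · rw [extendBy_of_notMem _ hh, extendBy_of_notMem _ fun hm => hh ((H.mul_mem_cancel_left g.2).1 hm)]

end extendBy

/-- The full shift over an uncountable group need not be metrizable. Both the subshift and the local
rule use finite windows, so cosets of the subgroup generated by these evolve independently; on that
countable subgroup the metric theorem applies. -/
theorem isNilpotentOn_of_isCellularAutomaton {G : Type u} [Group G] [Group.ResiduallyFinite G]
    (hG : IsVirtuallySolvable G) {A : Type w} [Finite A] [TopologicalSpace A] [DiscreteTopology A]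
    {z : A} {X : MulSubshift A G} (hX : IsSFT X) (hz : (fun _ => z) ∈ X.carrier)
    (hdense : X.carrier ⊆ closure (X.carrier ∩ finiteSupport G z))
    {f : X.carrier → X.carrier} (hf : IsCellularAutomaton X f)
    (hnil : IsAsymptoticallyNilpotent ⟨fun _ => z, hz⟩ f) :
    IsNilpotentOn ⟨fun _ => z, hz⟩ f Set.univ := by
  classical
  have hXc : CompactSpace X.carrier := isCompact_iff_compactSpace.1 X.isClosed.isCompact
  obtain ⟨C, hC, hXC⟩ := hX
  -- the windows of the subshift and of the local rule
  obtain ⟨W, hW⟩ := exists_finset_of_locally (e := fun x : G → A => x) IsInducing.id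
    (r := fun x y => x ∈ C ↔ y ∈ C) (by
      intro x
      by_cases hx : x ∈ C
      · exact ⟨C, hC.isOpen.mem_nhds hx, fun y hy y' hy' => iff_of_true hy hy'⟩
      · exact ⟨Cᶜ, hC.compl.isOpen.mem_nhds hx, fun y hy y' hy' => iff_of_false hy hy'⟩)
  obtain ⟨V, hV⟩ := exists_finset_of_locally (e := fun x : X.carrier => (x : G → A))
    IsInducing.subtypeVal (r := fun x y => (f x : G → A) 1 = (f y : G → A) 1) (by
      intro x
      have hcont : Continuous fun y => (f y : G → A) 1 :=
        (continuous_apply _).comp (continuous_subtype_val.comp hf.continuous)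
      exact ⟨_, hcont.continuousAt.preimage_mem_nhds ((isOpen_discrete {(f x : G → A) 1}).mem_nhds rfl),
        fun y hy y' hy' => hy.trans hy'.symm⟩)
  have hmem : ∀ y : G → A, (∀ g, ∃ x ∈ X.carrier, ∀ w ∈ W, y (g * w) = x w) → y ∈ X.carrier := by
    intro y hy
    refine (hXC y).2 fun g => ?_
    obtain ⟨x, hx, hxy⟩ := hy g
    refine (hW (mulShift g y) x hxy).2 ?_
    simpa using (hXC x).1 hx 1
  have hrule : ∀ (x y : X.carrier) (g : G), (∀ v ∈ V, (x : G → A) (g * v) = (y : G → A) (g * v)) →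
      (f x : G → A) g = (f y : G → A) g := by
    intro x y g h
    have := hV ⟨mulShift g x, X.mapsTo g x.2⟩ ⟨mulShift g y, X.mapsTo g y.2⟩ h
    rw [hf.map_shift, hf.map_shift] at this
    simpa using this
  set H : Subgroup G := Subgroup.closure ((W ∪ V : Finset G) : Set G) with hH
  have hHc : Countable H := Subgroup.countable_closure (W ∪ V).countable_toSet
  have hWH : ∀ w ∈ W, w ∈ H := fun w hw => Subgroup.subset_closure (by simp [hw])
  have hVH : ∀ v ∈ V, v ∈ H := fun v hv => Subgroup.subset_closure (by simp [hv])
  have hfo : f ⟨fun _ => z, hz⟩ = ⟨fun _ => z, hz⟩ := hnil.map_zero hf.continuous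
  have hext : ∀ x : H → A, (∀ g : H, ∃ y ∈ X.carrier, ∀ (w : G) (hw : w ∈ W),
      x (g * ⟨w, hWH w hw⟩) = y w) → extendBy H z x ∈ X.carrier := by
    intro x hx
    refine hmem _ fun g => ?_
    by_cases hg : g ∈ H
    · obtain ⟨y, hy, hxy⟩ := hx ⟨g, hg⟩
      refine ⟨y, hy, fun w hw => ?_⟩
      rw [extendBy_of_mem _ (H.mul_mem hg (hWH w hw)), ← hxy w hw]
      rfl
    · refine ⟨_, hz, fun w hw => extendBy_of_notMem _ fun hm => hg ?_⟩
      exact (H.mul_mem_cancel_right (hWH w hw)).1 hm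
  -- Translates of the window `W` lie inside `H` or miss it, so a restriction to `H` may be
  -- completed by the constant `z`.
  have hres : ∀ y ∈ X.carrier, extendBy H z (fun h => y h) ∈ X.carrier := fun y hy =>
    hext _ fun g => ⟨mulShift g y, X.mapsTo _ hy, fun w hw => rfl⟩
  let X₀ : Set (H → A) := {x | extendBy H z x ∈ X.carrier}
  have hX₀ : IsClosed X₀ := X.isClosed.preimage continuous_extendBy
  have hX₀c : CompactSpace X₀ := isCompact_iff_compactSpace.1 hX₀.isCompact
  let E : X₀ → X.carrier := fun x => ⟨extendBy H z x.1, x.2⟩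
  have hE : Continuous E := (continuous_extendBy.comp continuous_subtype_val).subtype_mk _
  have hfE : ∀ x : X₀, extendBy H z (fun h => (f (E x) : G → A) h) = (f (E x) : G → A) := by
    intro x
    ext g
    by_cases hg : g ∈ H
    · rw [extendBy_of_mem _ hg]
    · rw [extendBy_of_notMem _ hg]
      rw [hrule (E x) ⟨fun _ => z, hz⟩ g fun v hv => extendBy_of_notMem _ fun hm =>
        hg ((H.mul_mem_cancel_right (hVH v hv)).1 hm), hfo]
  let f₀ : X₀ → X₀ := fun x => ⟨fun h => (f (E x) : G → A) h, by
    change extendBy H z _ ∈ X.carrier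
    rw [hfE x]
    exact (f (E x)).2⟩
  have hEf : ∀ x, E (f₀ x) = f (E x) := fun x => Subtype.ext (hfE x)
  have hEfn : ∀ n x, E (f₀^[n] x) = f^[n] (E x) := by
    intro n
    induction n with
    | zero => exact fun x => rfl
    | succ n ih => exact fun x => by rw [Function.iterate_succ_apply, ih, hEf,
        Function.iterate_succ_apply]
  have hEinj : ∀ x : X₀, ∀ h : H, x.1 h = (E x : G → A) h := fun x h => (extendBy_coe x.1 h).symm
  have hshift : ∀ (g : H) (x : X₀), (fun h => x.1 (g⁻¹ * h)) ∈ X₀ := by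
    intro g x
    change extendBy H z _ ∈ X.carrier
    rw [← mulShift_extendBy]
    exact X.mapsTo _ x.2
  let _ : MulAction H X₀ :=
    { smul := fun g x => ⟨fun h => x.1 (g⁻¹ * h), hshift g x⟩
      one_smul := fun x => Subtype.ext (funext fun h => by
        change x.1 (1⁻¹ * h) = x.1 h
        simp)
      mul_smul := fun g g' x => Subtype.ext (funext fun h => by
        change x.1 ((g * g')⁻¹ * h) = x.1 (g'⁻¹ * (g⁻¹ * h))
        simp [mul_assoc]) }
  have hsmul : ∀ (g : H) (x : X₀) (h : H), (g • x).1 h = x.1 (g⁻¹ * h) := fun _ _ _ => rfl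
  have hEsmul : ∀ (g : H) (x : X₀),
      E (g • x) = ⟨mulShift ((g⁻¹ : H) : G) (E x), X.mapsTo _ (E x).2⟩ := fun g x =>
    Subtype.ext (mulShift_extendBy x.1 g⁻¹).symm
  let _ : MetricSpace X₀ := TopologicalSpace.metrizableSpaceMetric X₀
  have hHsol : IsVirtuallySolvable H := hG.of_finite_ker H.subtype (by
    rw [Subgroup.ker_subtype]; exact Set.finite_singleton _)
  have ho : (fun _ => z) ∈ X₀ := hres _ hz
  obtain ⟨n, hn⟩ := isNilpotentOn_of_symbolic hHsol (z := z) (Q := X₀) (e := fun x => x.1)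
    (o := ⟨fun _ => z, ho⟩) (W := W.subtype (· ∈ H)) (f := f₀) IsEmbedding.subtypeVal hsmul
    (fun _ => rfl)
    (by
      intro y hy
      refine ⟨⟨y, hext y fun g => ?_⟩, rfl⟩
      obtain ⟨x, hx⟩ := hy g
      refine ⟨_, x.2, fun w hw => ?_⟩
      rw [hx ⟨w, hWH w hw⟩ (Finset.mem_subtype.2 hw)]
      exact hEinj x ⟨w, hWH w hw⟩)
    (by
      intro x F
      obtain ⟨y, hyO, hyX, hyfin⟩ := mem_closure_iff.1 (hdense (E x).2)
        (cylinder (F.image Subtype.val) (E x : G → A)) (isOpen_cylinder _ _) fun _ _ => rfl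
      refine ⟨⟨fun h => y h, hres y hyX⟩, ?_, fun h hh => ?_⟩
      · exact Set.Finite.preimage Subtype.val_injective.injOn hyfin
      · rw [hEinj x]
        exact hyO h (Finset.mem_image_of_mem _ hh))
    (by
      refine Continuous.subtype_mk (continuous_pi fun h => ?_) _
      exact (continuous_apply _).comp (continuous_subtype_val.comp (hf.continuous.comp hE)))
    (by
      intro g x
      refine Subtype.ext (funext fun h => ?_)
      rw [hsmul]
      change (f (E (g • x)) : G → A) h = (f (E x) : G → A) (g⁻¹ * h : H)
      rw [hEsmul, hf.map_shift]
      rfl)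
    (by
      intro x
      rw [tendsto_subtype_rng]
      refine tendsto_pi_nhds.2 fun h => ?_
      have h1 := ((continuous_apply (h : G)).comp continuous_subtype_val).continuousAt.tendsto.comp
        (hnil (E x))
      refine h1.congr fun n => ?_
      simp only [Function.comp_apply]
      rw [← hEfn]
      exact (hEinj _ h).symm)
  have hagree : ∀ n (x y : X.carrier), (∀ h ∈ H, (x : G → A) h = (y : G → A) h) →
      ∀ h ∈ H, (f^[n] x : G → A) h = (f^[n] y : G → A) h := by
    intro n
    induction n with
    | zero => exact fun x y h => h
    | succ n ih =>
      intro x y hxy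
      rw [Function.iterate_succ_apply, Function.iterate_succ_apply]
      exact ih _ _ fun h hh => hrule x y h fun v hv => hxy _ (H.mul_mem hh (hVH v hv))
  have hiter : ∀ n (g : G) (x : X.carrier),
      (f^[n] ⟨mulShift g x, X.mapsTo g x.2⟩ : G → A) = mulShift g (f^[n] x : G → A) := by
    intro n
    induction n with
    | zero => exact fun g x => rfl
    | succ n ih =>
      intro g x
      have : f ⟨mulShift g x, X.mapsTo g x.2⟩ = ⟨mulShift g (f x), X.mapsTo g (f x).2⟩ :=
        Subtype.ext (hf.map_shift g x)
      rw [Function.iterate_succ_apply, Function.iterate_succ_apply, this, ih]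
  refine ⟨n, fun y _ => Subtype.ext (funext fun g => ?_)⟩
  -- Shifting brings the site `g` to `1 ∈ H`, where the orbit depends only on the restriction to
  -- `H`; the exponent `n` is the same for all sites.
  let y' : X.carrier := ⟨mulShift g y, X.mapsTo g y.2⟩
  let x : X₀ := ⟨fun h => (y' : G → A) h, hres _ y'.2⟩
  have h1 : (f^[n] y' : G → A) 1 = (f^[n] (E x) : G → A) 1 :=
    hagree n y' (E x) (fun h hh => (extendBy_of_mem x.1 hh).symm) 1 H.one_mem
  rw [hiter, ← hEfn, hn x (Set.mem_univ _), mulShift_apply, mul_one] at h1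
  rw [h1]
  exact extendBy_coe _ 1

theorem isNilpotentOn_fullShift {G : Type u} [Group G] [Group.ResiduallyFinite G]
    (hG : IsVirtuallySolvable G) {A : Type w} [Finite A] [TopologicalSpace A] [DiscreteTopology A]
    {z : A} {f : (G → A) → (G → A)} (hf : Continuous f)
    (hfs : ∀ (g : G) (x : G → A), f (mulShift g x) = mulShift g (f x))
    (hnil : IsAsymptoticallyNilpotent (fun _ => z) f) :
    IsNilpotentOn (fun _ => z) f Set.univ := by
  classical
  let F : (mulFullShift A G).carrier → (mulFullShift A G).carrier := fun x => ⟨f x, trivial⟩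
  have hF : ∀ n x, (F^[n] x : G → A) = f^[n] x := by
    intro n
    induction n with
    | zero => exact fun x => rfl
    | succ n ih => exact fun x => by rw [Function.iterate_succ_apply, ih,
        Function.iterate_succ_apply]
  obtain ⟨n, hn⟩ := isNilpotentOn_of_isCellularAutomaton hG (z := z) (X := mulFullShift A G)
    (f := F) ⟨Set.univ, isClopen_univ, fun x => by simp [mulFullShift]⟩ trivial (by
      intro x _
      refine mem_closure_iff.2 fun O hO hx => ?_
      obtain ⟨I, u, hu, hIsub⟩ := isOpen_pi_iff.1 hO x hx
      refine ⟨fun g => if g ∈ I then x g else z, hIsub fun i hi => ?_, trivial, ?_⟩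
      · simpa [Finset.mem_coe.1 hi] using (hu i hi).2
      · refine I.finite_toSet.subset fun g hg => ?_
        by_contra hgI
        exact hg (if_neg hgI))
    ⟨(hf.comp continuous_subtype_val).subtype_mk _, fun g x => hfs g x⟩ (by
      intro x
      rw [tendsto_subtype_rng]
      exact (hnil x).congr fun n => (hF n x).symm)
  refine ⟨n, fun x _ => ?_⟩
  rw [← hF n ⟨x, trivial⟩, hn _ (Set.mem_univ _)]

end

open SymbolicDynamics.FullShift in
theorem mainTheorem3 (G : Type u) [Group G] (hG : Group.ResiduallyFinite G) :
    -- residually finite solvable groups are nil-rigid on the class `ℭ₃`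
    (Group.IsSolvable G → IsNilRigidGroupOn G classC3.{a, b, c}) ∧
    (IsVirtuallySolvable G →
      -- expansive systems with shadowing and dense homoclinic points
      (∀ (X : Type v) [MetricSpace X] [MulAction G X] (o : X), IsPointedSystem G X o →
        IsExpansive G X → HasShadowing G X → Dense {x : X | IsHomoclinic G o x} →
        ∀ f : X → X, IsEndomorphism G o f → IsAsymptoticallyNilpotent o f →
          IsNilpotentOn o f Set.univ) ∧
      -- shifts of finite type with dense finite-support points
      (∀ (A : Type w) [Finite A] [TopologicalSpace A] [DiscreteTopology A] (z : A)
        (X : MulSubshift A G), IsSFT X → ∀ hz : (fun _ => z) ∈ X.carrier,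
        X.carrier ⊆ closure (X.carrier ∩ finiteSupport G z) →
        ∀ f : X.carrier → X.carrier, IsCellularAutomaton X f →
          IsAsymptoticallyNilpotent ⟨fun _ => z, hz⟩ f →
          IsNilpotentOn ⟨fun _ => z, hz⟩ f Set.univ) ∧
      -- full shifts
      (∀ (A : Type w) [Finite A] [TopologicalSpace A] [DiscreteTopology A] (z : A)
        (f : (G → A) → (G → A)), Continuous f →
          (∀ (g : G) (x : G → A), f (mulShift g x) = mulShift g (f x)) →
          IsAsymptoticallyNilpotent (fun _ => z) f →
          IsNilpotentOn (fun _ => z) f Set.univ)) := by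
  refine ⟨fun hsol => isNilRigidGroupOn_classC3 ⟨⊤, inferInstance, ?_⟩, fun hvs => ⟨?_, ?_, ?_⟩⟩
  · exact Group.isSolvable_of_isSolvable_injective (f := (⊤ : Subgroup G).subtype)
      Subtype.val_injective
  · exact fun X _ _ o h hexp hsh hd f hf hnil => isNilpotentOn_of_shadowing hvs h hexp hsh hd hf hnil
  · exact fun A _ _ _ z X hX hz hd f hf hnil =>
      isNilpotentOn_of_isCellularAutomaton hvs hX hz hd hf hnil
  · exact fun A _ _ _ z f hf hfs hnil => isNilpotentOn_fullShift hvs hf hfs hnil
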